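/- All graphs are finite, undirected and simple. A matching cut of a graph $G$ is a (possibly empty) set $M\subseteq E(G)$ such that no two edges of $M$ share an end-vertex and $M=E_G(A,B)$, the set of edges between $A$ and $B$, for some partition of $V(G)$ into two nonempty sets $A,B$. The feedback edge number of $G$ is the minimum number of edges whose deletion turns $G$ into a forest. Graphs and edge sets are encoded as binary strings (by their $0/1$ adjacency matrices), and running times are counted on a random access machine. *Enum MC, parameterized by the feedback edge number*, is the parameterized enumeration problem in which an instance $x$ encodes a graph $G$, the set ${\sf Sol}(x)$ of solutions consists of the matching cuts of $G$, and the parameter $\kappa(x)$ is the feedback edge number of $G$. A *polynomial-delay enumeration kernel* for a parameterized enumeration problem with solution sets ${\sf Sol}(x)$ and parameter $\kappa(x)$ is a pair of deterministic algorithms $\mathcal{A},\mathcal{A}'$ such that 1. for every instance $x$, $\mathcal{A}$ computes, in time polynomial in $|x|+\kappa(x)$, an instance $y$ with $|y|+\kappa(y)\le f(\kappa(x))$, for a computable function $f$ independent of $x$; 2. for every instance $x$ and every $s\in{\sf Sol}(y)$, $\mathcal{A}'$, given $x$, $y$ and $s$, lists without repetition a nonempty set $S_s\subseteq{\sf Sol}(x)$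 and halts, with delay polynomial in $|x|+|y|+\kappa(x)+\kappa(y)$ (the time before the first output, between consecutive outputs, and after the last output), and the sets $S_s$, $s\in{\sf Sol}(y)$, are pairwise disjoint with union ${\sf Sol}(x)$. **Theorem.** Enum MC, parameterized by the feedback edge number, admits a polynomial-delay enumeration kernel with $O(k)$ vertices: there are a polynomial-delay enumeration kernel for it and a constant $c$ such that, for every input graph $G$ with feedback edge number $k$, the graph encoded by the instance that the kernelization algorithm $\mathcal{A}$ computes has at most $c\,(k+1)$ vertices. -/

import Mathlib

namespace EnumKernel

/-! ## Machine model

A structured random access machine over the natural numbers: finitely many variables and arrays are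
named in a program, arrays are indexed dynamically, the arithmetic is addition and (truncated)
subtraction only, and every elementary operation costs one step. It is polynomially equivalent to
the multitape Turing machine. A program may output strings while it runs. -/

/-- Memory of the machine: variables `var v` and array cells `arr a i`. -/
@[ext]
structure State where
  var : ℕ → ℕ
  arr : ℕ → ℕ → ℕ

/-- Expressions. The value of `lt` and `eq` is `1` or `0`. -/
inductive RExpr where
  | const (c : ℕ)
  | var (v : ℕ)
  | read (a : ℕ) (i : RExpr)
  | add (e₁ e₂ : RExpr)
  | sub (e₁ e₂ : RExpr)
  | lt (e₁ e₂ : RExpr)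
  | eq (e₁ e₂ : RExpr)

/-- Value of an expression. -/
def RExpr.eval (s : State) : RExpr → ℕ
  | .const c => c
  | .var v => s.var v
  | .read a i => s.arr a (i.eval s)
  | .add e₁ e₂ => e₁.eval s + e₂.eval s
  | .sub e₁ e₂ => e₁.eval s - e₂.eval s
  | .lt e₁ e₂ => if e₁.eval s < e₂.eval s then 1 else 0
  | .eq e₁ e₂ => if e₁.eval s = e₂.eval s then 1 else 0

/-- Number of elementary operations needed to evaluate an expression. -/
def RExpr.cost : RExpr → ℕ
  | .const _ => 1
  | .var _ => 1
  | .read _ i => i.cost + 1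
  | .add e₁ e₂ => e₁.cost + e₂.cost + 1
  | .sub e₁ e₂ => e₁.cost + e₂.cost + 1
  | .lt e₁ e₂ => e₁.cost + e₂.cost + 1
  | .eq e₁ e₂ => e₁.cost + e₂.cost + 1

/-- Programs. A test `e` succeeds if the value of `e` is nonzero; `emit a e` outputs the string
formed by the first `e` cells of the array `a` (a nonzero cell is the bit `true`). -/
inductive Program where
  | skip
  | assign (v : ℕ) (e : RExpr)
  | write (a : ℕ) (i e : RExpr)
  | emit (a : ℕ) (e : RExpr)
  | seq (p q : Program)
  | ite (e : RExpr) (p q : Program)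
  | loop (e : RExpr) (p : Program)

/-- What happens in one unit of a run: a computation step, or (at no cost) an output. -/
inductive Event where
  | tick
  | out (w : List Bool)

/-- `n` computation steps. -/
def ticks (n : ℕ) : List Event := List.replicate n Event.tick

/-- The state after assigning `k` to the variable `v`. -/
def State.setVar (s : State) (v k : ℕ) : State :=
  { s with var := Function.update s.var v k }

/-- The state after writing `k` into the cell `i` of the array `a`. -/
def State.setArr (s : State) (a i k : ℕ) : State :=
  { s with arr := Function.update s.arr a (Function.update (s.arr a) i k) }

/-- The string formed by the first `n` cells of the array `a`. -/
def State.word (s : State) (a n : ℕ) : List Bool :=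
  (List.range n).map fun i => decide (s.arr a i ≠ 0)

/-- `Exec p s τ s'`: the program `p`, started in the state `s`, halts in the state `s'`, and `τ`
is the chronological list of its computation steps and outputs. Outputting a string of length `n`
takes more than `n` steps. -/
inductive Exec : Program → State → List Event → State → Prop
  | skip (s) : Exec .skip s (ticks 1) s
  | assign (v e s) : Exec (.assign v e) s (ticks (e.cost + 1)) (s.setVar v (e.eval s))
  | write (a i e s) : Exec (.write a i e) s (ticks (i.cost + e.cost + 1))
      (s.setArr a (i.eval s) (e.eval s))
  | emit (a e s) : Exec (.emit a e) s
      (ticks (e.cost + e.eval s + 1) ++ [Event.out (s.word a (e.eval s))]) s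
  | seq {p q s s₁ s₂ τ₁ τ₂} : Exec p s τ₁ s₁ → Exec q s₁ τ₂ s₂ → Exec (.seq p q) s (τ₁ ++ τ₂) s₂
  | ite_true {e p q s s' τ} : e.eval s ≠ 0 → Exec p s τ s' →
      Exec (.ite e p q) s (ticks (e.cost + 1) ++ τ) s'
  | ite_false {e p q s s' τ} : e.eval s = 0 → Exec q s τ s' →
      Exec (.ite e p q) s (ticks (e.cost + 1) ++ τ) s'
  | loop_true {e p s s₁ s₂ τ₁ τ₂} : e.eval s ≠ 0 → Exec p s τ₁ s₁ → Exec (.loop e p) s₁ τ₂ s₂ →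
      Exec (.loop e p) s (ticks (e.cost + 1) ++ (τ₁ ++ τ₂)) s₂
  | loop_false {e p s} : e.eval s = 0 → Exec (.loop e p) s (ticks (e.cost + 1)) s

/-- The machine is deterministic: a halting run is determined by the program and the start. -/
theorem Exec.unique {p : Program} {s s₁ s₂ : State} {τ₁ τ₂ : List Event}
    (h₁ : Exec p s τ₁ s₁) (h₂ : Exec p s τ₂ s₂) : τ₁ = τ₂ ∧ s₁ = s₂ := by
  induction h₁ generalizing τ₂ s₂ with
  | skip | assign | write | emit => cases h₂; exact ⟨rfl, rfl⟩
  | seq _ _ ih₁ ih₂ =>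
    cases h₂ with
    | seq a b =>
      obtain ⟨rfl, rfl⟩ := ih₁ a
      obtain ⟨rfl, rfl⟩ := ih₂ b
      exact ⟨rfl, rfl⟩
  | ite_true h _ ih =>
    cases h₂ with
    | ite_true _ a => obtain ⟨rfl, rfl⟩ := ih a; exact ⟨rfl, rfl⟩
    | ite_false h' _ => exact absurd h' h
  | ite_false h _ ih =>
    cases h₂ with
    | ite_true h' _ => exact absurd h h'
    | ite_false _ a => obtain ⟨rfl, rfl⟩ := ih a; exact ⟨rfl, rfl⟩
  | loop_true h _ _ ih₁ ih₂ =>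
    cases h₂ with
    | loop_true _ a b =>
      obtain ⟨rfl, rfl⟩ := ih₁ a
      obtain ⟨rfl, rfl⟩ := ih₂ b
      exact ⟨rfl, rfl⟩
    | loop_false h' => exact absurd h' h
  | loop_false h =>
    cases h₂ with
    | loop_true h' _ _ => exact absurd h h'
    | loop_false _ => exact ⟨rfl, rfl⟩

/-- Initial state for the input strings `ws`: the variable `i` holds the length of the `i`-th input
string and the array `i` holds its bits; all other cells are `0`. -/
def initState (ws : List (List Bool)) : State where
  var i := (ws.getD i []).length
  arr i j := if (ws.getD i []).getD j false then 1 else 0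

/-- The program `p` halts on the inputs `ws`, and `τ` is the list of its steps and outputs. -/
def RunsTo (p : Program) (ws : List (List Bool)) (τ : List Event) : Prop :=
  ∃ s', Exec p (initState ws) τ s'

/-- The output strings of a run, in order. -/
def outputs (τ : List Event) : List (List Bool) :=
  τ.filterMap fun
    | .tick => none
    | .out w => some w

/-- Running time: the number of computation steps of a run. -/
def runTime : List Event → ℕ
  | [] => 0
  | .tick :: τ => runTime τ + 1
  | .out _ :: τ => runTime τ

/-- All delays of a run are at most `d`: before the first output, between consecutive outputs, and
from the last output to the end. -/
def DelayLE (τ : List Event) (d : ℕ) : Prop :=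
  ∀ l, l <:+: τ → outputs l = [] → runTime l ≤ d

/-! ## Parameterized enumeration problems and their kernels -/

/-- A parameterized enumeration problem over the alphabet `{false, true}`: every string `x` is an
instance, with a finite set `Sol x` of solutions and a parameter `κ x`. The underlying language is
`{x | (Sol x).Nonempty}`. -/
structure EnumProblem where
  Sol : List Bool → Set (List Bool)
  finite_sol : ∀ x, (Sol x).Finite
  κ : List Bool → ℕ

/-- A polynomial-delay enumeration kernel for `P`. -/
structure PolyDelayEnumKernel (P : EnumProblem) where
  /-- the kernelization algorithm -/
  kernelize : Program
  /-- the solution-lifting algorithm -/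
  lifting : Program
  /-- the instance that the kernelization algorithm computes from `x` -/
  ker : List Bool → List Bool
  /-- the set of solutions to `x` that the solution-lifting algorithm lists for `s` -/
  lift : List Bool → List Bool → Set (List Bool)
  /-- `ker x` is computed in time polynomial in `|x| + κ x`. -/
  kernelize_spec : ∃ p : Polynomial ℕ, ∀ x, ∃ τ, RunsTo kernelize [x] τ ∧
    outputs τ = [ker x] ∧ runTime τ ≤ p.eval (x.length + P.κ x)
  /-- The size and the parameter of `ker x` are bounded in terms of the parameter of `x`. -/
  size_le : ∃ f : ℕ → ℕ, Computable f ∧ ∀ x, (ker x).length + P.κ (ker x) ≤ f (P.κ x)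
  /-- For each solution `s` to `ker x`, the elements of `lift x s` are listed without repetition,
  with delay polynomial in `|x| + |ker x| + κ x + κ (ker x)`. -/
  lifting_spec : ∃ p : Polynomial ℕ, ∀ x, ∀ s ∈ P.Sol (ker x),
    ∃ τ, RunsTo lifting [x, ker x, s] τ ∧ (outputs τ).Nodup ∧
      (∀ w, w ∈ outputs τ ↔ w ∈ lift x s) ∧
      DelayLE τ (p.eval (x.length + (ker x).length + P.κ x + P.κ (ker x)))
  /-- The sets `lift x s`, for the solutions `s` to `ker x`, form a partition of `Sol x`. -/
  lift_nonempty : ∀ x, ∀ s ∈ P.Sol (ker x), (lift x s).Nonempty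
  lift_disjoint : ∀ x, (P.Sol (ker x)).PairwiseDisjoint (lift x)
  lift_cover : ∀ x, ⋃ s ∈ P.Sol (ker x), lift x s = P.Sol x

/-! ## Matching cuts and the feedback edge number -/

/-- `E_G(A, Aᶜ)` -/
def cutEdges {V : Type*} (G : SimpleGraph V) (A : Set V) : Set (Sym2 V) :=
  {e | ∃ u ∈ A, ∃ v ∉ A, G.Adj u v ∧ e = s(u, v)}

/-- A set of edges no two of which have a common end-vertex. -/
def IsMatchingSet {V : Type*} (M : Set (Sym2 V)) : Prop :=
  ∀ e ∈ M, ∀ f ∈ M, ∀ v, v ∈ e → v ∈ f → e = f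

/-- A matching cut: a (possibly empty) set of edges that is a matching and equals `E_G(A, B)` for a
partition of the vertex set into nonempty sets `A` and `B`. -/
def IsMatchingCut {V : Type*} (G : SimpleGraph V) (M : Set (Sym2 V)) : Prop :=
  IsMatchingSet M ∧ ∃ A : Set V, A.Nonempty ∧ Aᶜ.Nonempty ∧ M = cutEdges G A

/-- The feedback edge number: the least size of a set of edges whose deletion leaves a forest. -/
noncomputable def feedbackEdgeNumber {V : Type*} (G : SimpleGraph V) : ℕ :=
  sInf {k | ∃ S : Finset (Sym2 V), (S : Set (Sym2 V)) ⊆ G.edgeSet ∧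
    (G.deleteEdges (S : Set (Sym2 V))).IsAcyclic ∧ S.card = k}

/-! ## The problem Enum MC, parameterized by the feedback edge number

The string `1ⁿ 0 a`, where `a` is the list of the rows of an adjacency matrix, stands for a graph on
`n` vertices. So that every string is an instance, missing bits are read as `0`, an edge is present
if one of its two bits is `1`, and further bits (and the diagonal) are ignored. -/

/-- Number of vertices of the graph encoded by `x`. -/
def numVertices (x : List Bool) : ℕ := (x.takeWhile id).length

/-- The graph encoded by `x`. -/
def graphOf (x : List Bool) : SimpleGraph (Fin (numVertices x)) :=
  SimpleGraph.fromRel fun i j =>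
    x.getD (numVertices x + 1 + (i * numVertices x + j)) false = true

open Classical in
/-- A set of pairs of vertices is written as the `n × n` matrix of its indicator, row by row. -/
noncomputable def encodeEdges {n : ℕ} (M : Set (Sym2 (Fin n))) : List Bool :=
  List.ofFn fun p : Fin (n * n) => decide (s(p.divNat, p.modNat) ∈ M)

/-- The standard encoding of a graph. -/
noncomputable def encodeGraph {n : ℕ} (G : SimpleGraph (Fin n)) : List Bool :=
  List.replicate n true ++ false :: encodeEdges G.edgeSet

theorem encodeEdges_getD {n : ℕ} (M : Set (Sym2 (Fin n))) (i j : Fin n) :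
    (encodeEdges M).getD (i * n + j) false = true ↔ s(i, j) ∈ M := by
  classical
  have hlt : (i : ℕ) * n + j < n * n := by
    have := i.isLt
    have := j.isLt
    nlinarith
  have hn : 0 < n := i.pos
  have h1 : (⟨i * n + j, hlt⟩ : Fin (n * n)).divNat = i := by
    ext
    simp only [Fin.divNat]
    rw [Nat.add_comm, Nat.add_mul_div_right _ _ hn, Nat.div_eq_of_lt j.isLt, Nat.zero_add]
  have h2 : (⟨i * n + j, hlt⟩ : Fin (n * n)).modNat = j := by
    ext
    simp only [Fin.modNat]
    rw [Nat.add_comm, Nat.add_mul_mod_self_right, Nat.mod_eq_of_lt j.isLt]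
  have hlen : (i : ℕ) * n + j < (encodeEdges M).length := by simpa [encodeEdges] using hlt
  rw [List.getD_eq_getElem _ _ hlen]
  simp only [encodeEdges, List.getElem_ofFn, decide_eq_true_eq]
  rw [h1, h2]

/-- Distinct sets of edges have distinct encodings. -/
theorem encodeEdges_injective {n : ℕ} :
    Function.Injective (encodeEdges : Set (Sym2 (Fin n)) → List Bool) := by
  intro M N h
  ext e
  induction e with
  | _ i j => rw [← encodeEdges_getD, ← encodeEdges_getD, h]

theorem numVertices_encodeGraph {n : ℕ} (G : SimpleGraph (Fin n)) :
    numVertices (encodeGraph G) = n := by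
  have : ∀ (n : ℕ) (l : List Bool),
      ((List.replicate n true ++ false :: l).takeWhile id).length = n := by
    intro n l
    induction n with
    | zero => simp
    | succ k ih => simp [List.replicate_succ]
  exact this n _

/-- Every graph on `n` vertices is the graph of its standard encoding. -/
theorem graphOf_encodeGraph {n : ℕ} (G : SimpleGraph (Fin n)) (i j : Fin n) :
    (graphOf (encodeGraph G)).Adj (Fin.cast (numVertices_encodeGraph G).symm i)
      (Fin.cast (numVertices_encodeGraph G).symm j) ↔ G.Adj i j := by
  have key : ∀ i j : Fin n, (encodeGraph G).getD (n + 1 + (i * n + j)) false = true ↔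
      G.Adj i j := by
    intro i j
    have : (encodeGraph G).getD (n + 1 + (i * n + j)) false
        = (encodeEdges G.edgeSet).getD (i * n + j) false := by
      rw [encodeGraph, List.getD_append_right _ _ _ _ (by simp; omega)]
      have : n + 1 + ((i : ℕ) * n + j) - (List.replicate n true).length = (i * n + j) + 1 := by
        simp; omega
      rw [this, List.getD_cons_succ]
    rw [this, encodeEdges_getD, SimpleGraph.mem_edgeSet]
  simp only [graphOf, SimpleGraph.fromRel_adj, Fin.val_cast, numVertices_encodeGraph]
  rw [key, key]
  constructor
  · rintro ⟨_, h | h⟩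
    · exact h
    · exact h.symm
  · intro h
    exact ⟨fun e => h.ne (by simpa using e), Or.inl h⟩

/-- Enum MC parameterized by the feedback edge number: the solutions to (an encoding of) `G` are
(the encodings of) the matching cuts of `G`. -/
noncomputable def enumMC : EnumProblem where
  Sol x := encodeEdges '' {M | IsMatchingCut (graphOf x) M}
  finite_sol x := (Set.toFinite {M | IsMatchingCut (graphOf x) M}).image _
  κ x := feedbackEdgeNumber (graphOf x)

end EnumKernel

namespace EnumKernel

open Polynomial

/-! ## Traces -/

/-! A matching cut is a matching that consists of the bichromatic edges of a nonconstant colouring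
with values in `ZMod 2`. Only the 2-core restricts which edge sets arise from colourings: an edge
with an end outside the core lies on no cycle and may be prescribed freely. In the core, vertices of
core degree two away from the branch vertices are suppressed (`Supp`) and the others are kept
(`Keep`). A kept vertex has at most one suppressed neighbour (`IsGraph.keep_unique`), so each
component of suppressed vertices, with the core edges at it (its class), is a path between two
distinct kept vertices or a cycle without kept vertices (`IsGraph.bdry_cases`), and different
classes share no vertex. By handshaking modulo two (`IsGraph.sum_cls`), the number of cut edges in a
class has the parity of the sum of the colours of its boundary. Conversely, a colouring of the kept
vertices extends to one with prescribed cut edges as soon as these parities are right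
(`IsGraph.exists_coloring`).

In the kernel every kept vertex becomes a triangle, which no matching cut can split. Edges between
kept vertices join the first vertices of triangles; each path is replaced by a virtual edge between
second vertices. Virtual edges thus meet no other edge that can be cut: they impose no matching
condition and only record a parity. A kernel solution therefore says which kept edges are cut and
which classes contain an odd number of cut edges, and its fibre consists of the matching cuts of the
graph with these data. Two isolated vertices are added where the empty cut of the kernel has to be a
solution, to account for cuts that are constant on the kept vertices. That the fibres partition the
solutions is the content of `Fibre.isCut`, `Fibre.unique`, `IsCut.exists_fibre` and
`IsCut.fibre_nonempty`. For nonemptiness it matters that suppressed vertices come in adjacent pairs: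
each class has an edge without kept ends, which can correct a parity without touching other cut
edges. The linear bound `kerSize_le` comes from the degree sum of the core.

A fibre is listed through the sets of its edges that are not between kept vertices (`Good`), in
lexicographic order. Whether a prefix extends to a good set is decided by `extends_iff`: each class
of wrong parity needs one later edge disjoint from the prefix, and the classes do not interfere. The
successor of a set is found by a greedy completion after the last possible branching
(`Decides.next`). The only good set that may have to be passed over is the empty one, which can only
come first, so the delay is a bounded number of rounds (`runs_liftLoop`).

The predicates are computed on the machine as tables of expressions with bounded sums and as least
fixed points. `XE.runs_code` and `FP.runs_code` translate such programs to the machine with explicit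
polynomial time bounds in the common loop bound. -/

theorem outputs_append (a b : List Event) : outputs (a ++ b) = outputs a ++ outputs b := by
  simp [outputs]

theorem runTime_append (a b : List Event) : runTime (a ++ b) = runTime a + runTime b := by
  induction a with
  | nil => simp [runTime]
  | cons e a ih => cases e <;> (simp [runTime, ih]; try omega)

theorem outputs_ticks (n : ℕ) : outputs (ticks n) = [] := by
  simp [outputs, ticks]

theorem runTime_ticks (n : ℕ) : runTime (ticks n) = n := by
  induction n with
  | zero => rfl
  | succ n ih => simpa [ticks, List.replicate_succ, runTime] using ih

/-- A trace without outputs and with at most `T` steps. -/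
def Silent (τ : List Event) (T : ℕ) : Prop := outputs τ = [] ∧ runTime τ ≤ T

theorem Silent.append {a b : List Event} {S T : ℕ} (ha : Silent a S) (hb : Silent b T) :
    Silent (a ++ b) (S + T) := by
  refine ⟨by rw [outputs_append, ha.1, hb.1]; rfl, ?_⟩
  rw [runTime_append]
  exact Nat.add_le_add ha.2 hb.2

theorem Silent.mono {a : List Event} {S T : ℕ} (ha : Silent a S) (h : S ≤ T) : Silent a T :=
  ⟨ha.1, ha.2.trans h⟩

theorem silent_ticks (n : ℕ) : Silent (ticks n) n := ⟨outputs_ticks n, (runTime_ticks n).le⟩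

/-- `p` runs silently from `s` to some state satisfying `Q`, in at most `T` steps. -/
def Runs (p : Program) (s : State) (T : ℕ) (Q : State → Prop) : Prop :=
  ∃ τ s', Exec p s τ s' ∧ Silent τ T ∧ Q s'

theorem Runs.mono {p s T T' Q Q'} (h : Runs p s T Q) (hT : T ≤ T') (hQ : ∀ s, Q s → Q' s) :
    Runs p s T' Q' := by
  obtain ⟨τ, s', h1, h2, h3⟩ := h
  exact ⟨τ, s', h1, h2.mono hT, hQ _ h3⟩

theorem Runs.seq {p q s S T Q Q'} (h : Runs p s S Q) (h' : ∀ s, Q s → Runs q s T Q') :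
    Runs (.seq p q) s (S + T) Q' := by
  obtain ⟨τ, s', h1, h2, h3⟩ := h
  obtain ⟨τ', s'', h1', h2', h3'⟩ := h' s' h3
  exact ⟨_, s'', .seq h1 h1', h2.append h2', h3'⟩

theorem Runs.assign {v e s T} {Q : State → Prop} (hT : e.cost + 1 ≤ T)
    (h : Q (s.setVar v (e.eval s))) : Runs (.assign v e) s T Q :=
  ⟨_, _, .assign v e s, (silent_ticks _).mono hT, h⟩

theorem Runs.write {a i e s T} {Q : State → Prop} (hT : i.cost + e.cost + 1 ≤ T)
    (h : Q (s.setArr a (i.eval s) (e.eval s))) : Runs (.write a i e) s T Q :=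
  ⟨_, _, .write a i e s, (silent_ticks _).mono hT, h⟩

theorem Runs.ite {e p q s T Q} (h : e.eval s ≠ 0 → Runs p s T Q)
    (h' : e.eval s = 0 → Runs q s T Q) : Runs (.ite e p q) s (e.cost + 1 + T) Q := by
  by_cases he : e.eval s = 0
  · obtain ⟨τ, s', h1, h2, h3⟩ := h' he
    exact ⟨_, s', .ite_false he h1, (silent_ticks _).append h2, h3⟩
  · obtain ⟨τ, s', h1, h2, h3⟩ := h he
    exact ⟨_, s', .ite_true he h1, (silent_ticks _).append h2, h3⟩

/-- Rule for counting loops `while j < L`, the bound `L` being kept in the variable `0`. -/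
theorem Runs.loop_lt {body : Program} {j L T : ℕ} (Inv : ℕ → State → Prop)
    (h : ∀ k < L, ∀ s, Inv k s → s.var j = k → s.var 0 = L →
      Runs body s T fun s' => s'.var j = k + 1 ∧ s'.var 0 = L ∧ Inv (k + 1) s') :
    ∀ d k s, k + d = L → Inv k s → s.var j = k → s.var 0 = L →
      Runs (.loop (.lt (.var j) (.var 0)) body) s (d * (T + 4) + 4)
        fun s' => s'.var j = L ∧ s'.var 0 = L ∧ Inv L s' := by
  intro d
  induction d with
  | zero =>
    intro k s hk hI hj h0
    have hk' : k = L := by omega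
    subst hk'
    refine ⟨_, s, .loop_false ?_, (silent_ticks _).mono ?_, hj, h0, hI⟩
    · simp [RExpr.eval, hj, h0]
    -- Comparing two variables costs three operations and the test itself one more: this is the `4`
    -- paid in every iteration and once at the end.
    · simp [RExpr.cost]
  | succ d ih =>
    intro k s hk hI hj h0
    obtain ⟨τ, s', h1, h2, h3, h4, h5⟩ := h k (by omega) s hI hj h0
    obtain ⟨τ', s'', h1', h2', h3'⟩ := ih (k + 1) s' (by omega) h5 h3 h4
    refine ⟨_, s'', .loop_true ?_ h1 h1', ((silent_ticks _).append (h2.append h2')).mono ?_, h3'⟩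
    · simp only [RExpr.eval, hj, h0]
      rw [if_pos (by omega)]
      exact one_ne_zero
    · simp only [RExpr.cost]
      ring_nf
      omega

/-! ## Updates -/

@[simp] theorem setVar_var (s : State) (v k u : ℕ) :
    (s.setVar v k).var u = if u = v then k else s.var u := by
  simp [State.setVar, Function.update_apply]

@[simp] theorem setVar_arr (s : State) (v k : ℕ) : (s.setVar v k).arr = s.arr := rfl

@[simp] theorem setArr_arr (s : State) (a i k b j : ℕ) :
    (s.setArr a i k).arr b j = if b = a ∧ j = i then k else s.arr b j := by
  by_cases h : b = a
  · subst h
    by_cases h' : j = i <;> simp [State.setArr, h']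
  · simp [State.setArr, h]

/-- The states agree on the arrays and on the variables below `100`. The remaining variables are
scratch space. -/
def Agree (s t : State) : Prop := s.arr = t.arr ∧ ∀ v < 100, s.var v = t.var v

theorem Agree.refl (s : State) : Agree s s := ⟨rfl, fun _ _ => rfl⟩

theorem Agree.trans {s t u : State} (h : Agree s t) (h' : Agree t u) : Agree s u :=
  ⟨h.1.trans h'.1, fun v hv => (h.2 v hv).trans (h'.2 v hv)⟩

theorem Agree.setVar {s t : State} (h : Agree s t) (v k : ℕ) :
    Agree (s.setVar v k) (t.setVar v k) := by
  refine ⟨h.1, fun u hu => ?_⟩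
  simp [h.2 u hu]

theorem Agree.setArr {s t : State} (h : Agree s t) (a i k : ℕ) :
    Agree (s.setArr a i k) (t.setArr a i k) := by
  refine ⟨?_, fun u hu => h.2 u hu⟩
  funext b j
  simp [h.1]

/-! ## Expressions with conditionals and bounded sums -/

/-- Expressions with conditionals and sums over `j < L`, `L` being kept in the variable `0`. -/
inductive XE where
  | const (c : ℕ)
  | var (v : ℕ)
  | read (a : ℕ) (i : XE)
  | add (e₁ e₂ : XE)
  | sub (e₁ e₂ : XE)
  | lt (e₁ e₂ : XE)
  | eq (e₁ e₂ : XE)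
  | cond (c e₁ e₂ : XE)
  | sum (j : ℕ) (e : XE)

/-- Value of an expression; sums run over `k < L`. -/
def XE.eval (L : ℕ) : XE → State → ℕ
  | .const c, _ => c
  | .var v, s => s.var v
  | .read a i, s => s.arr a (i.eval L s)
  | .add e₁ e₂, s => e₁.eval L s + e₂.eval L s
  | .sub e₁ e₂, s => e₁.eval L s - e₂.eval L s
  | .lt e₁ e₂, s => if e₁.eval L s < e₂.eval L s then 1 else 0
  | .eq e₁ e₂, s => if e₁.eval L s = e₂.eval L s then 1 else 0
  | .cond c e₁ e₂, s => if c.eval L s ≠ 0 then e₁.eval L s else e₂.eval L s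
  | .sum j e, s => ∑ k ∈ Finset.range L, e.eval L (s.setVar j k)

/-- Only variables below `100` occur, and the variable `0` is not bound. -/
def XE.wf : XE → Bool
  | .const _ => true
  | .var v => v.blt 100
  | .read _ i => i.wf
  | .add e₁ e₂ => e₁.wf && e₂.wf
  | .sub e₁ e₂ => e₁.wf && e₂.wf
  | .lt e₁ e₂ => e₁.wf && e₂.wf
  | .eq e₁ e₂ => e₁.wf && e₂.wf
  | .cond c e₁ e₂ => c.wf && e₁.wf && e₂.wf
  | .sum j e => Nat.blt 0 j && j.blt 100 && e.wf

/-- A program that stores the value of the expression in the variable `r`, using the variables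
from `r` on as scratch space. -/
def XE.code : XE → ℕ → Program
  | .const c, r => .assign r (.const c)
  | .var v, r => .assign r (.var v)
  | .read a i, r => .seq (i.code r) (.assign r (.read a (.var r)))
  | .add e₁ e₂, r => .seq (e₁.code r) (.seq (e₂.code (r + 1))
      (.assign r (.add (.var r) (.var (r + 1)))))
  | .sub e₁ e₂, r => .seq (e₁.code r) (.seq (e₂.code (r + 1))
      (.assign r (.sub (.var r) (.var (r + 1)))))
  | .lt e₁ e₂, r => .seq (e₁.code r) (.seq (e₂.code (r + 1))
      (.assign r (.lt (.var r) (.var (r + 1)))))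
  | .eq e₁ e₂, r => .seq (e₁.code r) (.seq (e₂.code (r + 1))
      (.assign r (.eq (.var r) (.var (r + 1)))))
  | .cond c e₁ e₂, r => .seq (c.code r) (.ite (.var r) (e₁.code r) (e₂.code r))
  | .sum j e, r => .seq (.assign r (.var j)) (.seq (.assign (r + 1) (.const 0))
      (.seq (.assign j (.const 0)) (.seq (.loop (.lt (.var j) (.var 0))
        (.seq (e.code (r + 2)) (.seq (.assign (r + 1) (.add (.var (r + 1)) (.var (r + 2))))
          (.assign j (.add (.var j) (.const 1))))))
      (.seq (.assign j (.var r)) (.assign r (.var (r + 1)))))))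

/-- A bound for the running time of `XE.code`. -/
noncomputable def XE.time : XE → ℕ[X]
  | .const _ => 2
  | .var _ => 2
  | .read _ i => i.time + 3
  | .add e₁ e₂ => e₁.time + (e₂.time + 4)
  | .sub e₁ e₂ => e₁.time + (e₂.time + 4)
  | .lt e₁ e₂ => e₁.time + (e₂.time + 4)
  | .eq e₁ e₂ => e₁.time + (e₂.time + 4)
  | .cond c e₁ e₂ => c.time + (2 + (e₁.time + e₂.time))
  | .sum _ e => X * (e.time + 12) + 20

/-- Well-formed expressions do not see the scratch variables, so evaluating one operand does not
change the value of the next. -/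
theorem XE.eval_congr {L : ℕ} (e : XE) (hw : e.wf) {s t : State} (h : Agree s t) :
    e.eval L s = e.eval L t := by
  induction e generalizing s t with
  | const c => rfl
  | var v => exact h.2 v (by simpa [wf] using hw)
  | read a i ih => simp only [eval, ih hw h, h.1]
  | add e₁ e₂ ih₁ ih₂ | sub e₁ e₂ ih₁ ih₂ | lt e₁ e₂ ih₁ ih₂ | eq e₁ e₂ ih₁ ih₂ =>
    simp only [wf, Bool.and_eq_true] at hw
    simp only [eval, ih₁ hw.1 h, ih₂ hw.2 h]
  | cond c e₁ e₂ ih ih₁ ih₂ =>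
    simp only [wf, Bool.and_eq_true] at hw
    simp only [eval, ih hw.1.1 h, ih₁ hw.1.2 h, ih₂ hw.2 h]
  | sum j e ih =>
    simp only [wf, Bool.and_eq_true] at hw
    simp only [eval]
    exact Finset.sum_congr rfl fun k _ => ih hw.2 (h.setVar j k)

/-- The scratch space is a stack: code with base `r` preserves every variable below `r`, so a first
operand stored in `r` survives the evaluation of the second one from `r + 1` on. The bound variable
of a sum lies below `100` and has to be saved and restored. -/
theorem XE.runs_code {L : ℕ} (e : XE) (hw : e.wf) (r : ℕ) (hr : 100 ≤ r) (s : State)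
    (h0 : s.var 0 = L) :
    Runs (e.code r) s (e.time.eval L) fun s' =>
      s'.arr = s.arr ∧ s'.var r = e.eval L s ∧ ∀ v < r, s'.var v = s.var v := by
  -- The four binary operations are compiled by the same scheme; `o` is the machine operation and
  -- `f` its meaning.
  have bin : ∀ (e₁ e₂ : XE) (o : RExpr → RExpr → RExpr) (f : ℕ → ℕ → ℕ)
      (_ : ∀ a b, (o a b).cost = a.cost + b.cost + 1)
      (_ : ∀ a b s, (o a b).eval s = f (a.eval s) (b.eval s))
      (_ : e₁.wf) (_ : e₂.wf)
      (_ : ∀ (r : ℕ) (_ : 100 ≤ r) (s : State) (_ : s.var 0 = L),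
        Runs (e₁.code r) s (e₁.time.eval L) fun s' =>
        s'.arr = s.arr ∧ s'.var r = e₁.eval L s ∧ ∀ v < r, s'.var v = s.var v)
      (_ : ∀ (r : ℕ) (_ : 100 ≤ r) (s : State) (_ : s.var 0 = L),
        Runs (e₂.code r) s (e₂.time.eval L) fun s' =>
        s'.arr = s.arr ∧ s'.var r = e₂.eval L s ∧ ∀ v < r, s'.var v = s.var v)
      (r : ℕ) (_ : 100 ≤ r) (s : State) (_ : s.var 0 = L),
      Runs (.seq (e₁.code r) (.seq (e₂.code (r + 1)) (.assign r (o (.var r) (.var (r + 1))))))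
        s ((e₁.time + (e₂.time + 4)).eval L) fun s' =>
        s'.arr = s.arr ∧ s'.var r = f (e₁.eval L s) (e₂.eval L s) ∧ ∀ v < r, s'.var v = s.var v := by
    intro e₁ e₂ o f hc hf hw₁ hw₂ h₁ h₂ r hr s h0
    rw [eval_add, eval_add]
    refine (h₁ r hr s h0).seq fun s₁ ⟨ha, hv, hu⟩ => ?_
    refine (h₂ (r + 1) (by omega) s₁ (by rw [hu 0 (by omega), h0])).seq fun s₂ ⟨ha', hv', hu'⟩ => ?_
    refine Runs.assign ?_ ?_
    · simp [hc, RExpr.cost]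
    · have he : e₂.eval L s₁ = e₂.eval L s :=
        e₂.eval_congr hw₂ ⟨ha, fun v hv => hu v (by omega)⟩
      refine ⟨by rw [setVar_arr, ha', ha], ?_, fun v hv => ?_⟩
      · simp only [setVar_var, if_true, hf, RExpr.eval, hv', he]
        rw [hu' r (by omega), hv]
      · rw [setVar_var, if_neg (by omega), hu' v (by omega), hu v hv]
  induction e generalizing r s with
  | const c =>
    refine Runs.assign (by simp [RExpr.cost, time]) ⟨rfl, by simp [RExpr.eval, eval], fun v hv => ?_⟩
    simp [Nat.ne_of_lt hv]
  | var v =>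
    refine Runs.assign (by simp [RExpr.cost, time]) ⟨rfl, by simp [RExpr.eval, eval], fun v hv => ?_⟩
    simp [Nat.ne_of_lt hv]
  | read a i ih =>
    rw [time, eval_add]
    refine (ih hw r hr s h0).seq fun s₁ ⟨ha, hv, hu⟩ => ?_
    refine Runs.assign (by simp [RExpr.cost]) ⟨by rw [setVar_arr, ha], ?_, fun v hv => ?_⟩
    · simp [RExpr.eval, hv, ha, eval]
    · rw [setVar_var, if_neg (by omega), hu v hv]
  | add e₁ e₂ ih₁ ih₂ =>
    simp only [wf, Bool.and_eq_true] at hw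
    exact bin e₁ e₂ .add (· + ·) (fun _ _ => rfl) (fun _ _ _ => rfl) hw.1 hw.2 (ih₁ hw.1)
      (ih₂ hw.2) r hr s h0
  | sub e₁ e₂ ih₁ ih₂ =>
    simp only [wf, Bool.and_eq_true] at hw
    exact bin e₁ e₂ .sub (· - ·) (fun _ _ => rfl) (fun _ _ _ => rfl) hw.1 hw.2 (ih₁ hw.1)
      (ih₂ hw.2) r hr s h0
  | lt e₁ e₂ ih₁ ih₂ =>
    simp only [wf, Bool.and_eq_true] at hw
    exact bin e₁ e₂ .lt (fun a b => if a < b then 1 else 0) (fun _ _ => rfl) (fun _ _ _ => rfl)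
      hw.1 hw.2 (ih₁ hw.1) (ih₂ hw.2) r hr s h0
  | eq e₁ e₂ ih₁ ih₂ =>
    simp only [wf, Bool.and_eq_true] at hw
    exact bin e₁ e₂ .eq (fun a b => if a = b then 1 else 0) (fun _ _ => rfl) (fun _ _ _ => rfl)
      hw.1 hw.2 (ih₁ hw.1) (ih₂ hw.2) r hr s h0
  | cond c e₁ e₂ ih ih₁ ih₂ =>
    simp only [wf, Bool.and_eq_true] at hw
    rw [time, eval_add, eval_add, eval_add]
    refine (ih hw.1.1 r hr s h0).seq fun s₁ ⟨ha, hv, hu⟩ => ?_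
    have hag : Agree s₁ s := ⟨ha, fun v hv => hu v (by omega)⟩
    have h0' : s₁.var 0 = L := by rw [hu 0 (by omega), h0]
    rw [Polynomial.eval_ofNat]
    refine Runs.ite (e := RExpr.var r) (fun hc => ?_) (fun hc => ?_)
    -- The time bound charges both branches, which avoids a maximum of polynomials.
    · refine (ih₁ hw.1.2 r hr s₁ h0').mono (Nat.le_add_right _ _) fun s₂ ⟨ha', hv', hu'⟩ => ?_
      refine ⟨ha'.trans ha, ?_, fun v hv => (hu' v hv).trans (hu v hv)⟩
      have : c.eval L s ≠ 0 := by simpa [RExpr.eval, hv] using hc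
      rw [hv', XE.eval, if_pos this, e₁.eval_congr hw.1.2 hag]
    · refine (ih₂ hw.2 r hr s₁ h0').mono (Nat.le_add_left _ _) fun s₂ ⟨ha', hv', hu'⟩ => ?_
      refine ⟨ha'.trans ha, ?_, fun v hv => (hu' v hv).trans (hu v hv)⟩
      have : c.eval L s = 0 := by simpa [RExpr.eval, hv] using hc
      rw [hv', XE.eval, if_neg (by simpa using this), e₂.eval_congr hw.2 hag]
  | sum j e ih =>
    simp only [wf, Bool.and_eq_true, Nat.blt_eq] at hw
    obtain ⟨⟨hj0, hj⟩, hwe⟩ := hw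
    have hT : (XE.time (.sum j e)).eval L =
        2 + (2 + (2 + ((L * ((e.time.eval L + (4 + 4)) + 4) + 4) + (2 + 8)))) := by
      simp [time]; ring
    rw [hT]
    refine Runs.seq (Q := fun t => t = s.setVar r (s.var j))
      (.assign (by simp [RExpr.cost]) (by simp [RExpr.eval])) ?_
    rintro _ rfl
    refine Runs.seq (Q := fun t => t = (s.setVar r (s.var j)).setVar (r + 1) 0)
      (.assign (by simp [RExpr.cost]) (by simp [RExpr.eval])) ?_
    rintro _ rfl
    refine Runs.seq (Q := fun t => t = ((s.setVar r (s.var j)).setVar (r + 1) 0).setVar j 0)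
      (.assign (by simp [RExpr.cost]) (by simp [RExpr.eval])) ?_
    rintro _ rfl
    -- Cell `r` keeps the outer value of `j` and cell `r + 1` the partial sum; `j` is exempt from
    -- preservation until it is restored after the loop.
    let Inv : ℕ → State → Prop := fun k t => t.arr = s.arr ∧ t.var r = s.var j ∧
      t.var (r + 1) = ∑ i ∈ Finset.range k, e.eval L (s.setVar j i) ∧
      ∀ v < r, v ≠ j → t.var v = s.var v
    refine Runs.seq (Runs.loop_lt (L := L) Inv ?_ L 0 _ (by omega) ?_ ?_ ?_) ?_
    · rintro k hk t ⟨ha, hr1, hr2, hv⟩ htj ht0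
      refine (ih hwe (r + 2) (by omega) t ht0).seq fun t₁ ⟨ha₁, hv₁, hu₁⟩ => ?_
      have h1 : Runs (.assign (r + 1) (.add (.var (r + 1)) (.var (r + 2)))) t₁ 4
          fun u => u = t₁.setVar (r + 1) (t₁.var (r + 1) + t₁.var (r + 2)) :=
        .assign (by simp [RExpr.cost]) (by simp [RExpr.eval])
      refine Runs.seq (S := 4) (T := 4) h1 ?_
      rintro _ rfl
      refine Runs.assign (by simp [RExpr.cost]) ?_
      have hag : Agree t (s.setVar j k) := by
        refine ⟨ha, fun v hv' => ?_⟩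
        rw [setVar_var]
        split_ifs with h
        · rw [h, htj]
        · exact hv v (by omega) h
      refine ⟨?_, ?_, by simp only [setVar_arr, ha₁, ha], ?_, ?_, fun v hv' hvj => ?_⟩
      · simp only [RExpr.eval, setVar_var, if_true]
        rw [if_neg (by omega), hu₁ j (by omega), htj]
      · simp only [setVar_var]
        rw [if_neg (by omega), if_neg (by omega), hu₁ 0 (by omega), ht0]
      · simp only [setVar_var]
        rw [if_neg (by omega), if_neg (by omega), hu₁ r (by omega), hr1]
      · simp only [setVar_var, if_true]
        rw [if_neg (by omega), hu₁ (r + 1) (by omega), hr2, hv₁, Finset.sum_range_succ,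
          e.eval_congr hwe hag]
      · simp only [setVar_var]
        rw [if_neg (by omega), if_neg (by omega), hu₁ v (by omega), hv v hv' hvj]
    · refine ⟨rfl, ?_, ?_, fun v hv hvj => ?_⟩ <;> simp only [setVar_var]
      · simp [show r ≠ j by omega]
      · simp [show r + 1 ≠ j by omega]
      · rw [if_neg (by omega), if_neg (by omega), if_neg (by omega)]
    · simp
    · simp only [setVar_var]
      rw [if_neg (by omega), if_neg (by omega), if_neg (by omega), h0]
    · rintro t ⟨htj, ht0, ha, hr1, hr2, hv⟩
      refine Runs.seq (Q := fun t' => t' = t.setVar j (t.var r))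
        (.assign (by simp [RExpr.cost]) (by simp [RExpr.eval])) ?_
      rintro _ rfl
      refine Runs.assign (by simp [RExpr.cost]) ⟨ha, ?_, fun v hv' => ?_⟩
      · simp [RExpr.eval, XE.eval, show r + 1 ≠ j by omega, hr2]
      · simp only [setVar_var]
        rw [if_neg (by omega)]
        split_ifs with h
        · rw [h, hr1]
        · exact hv v hv' h

/-! ## Programs with counting loops only -/

/-- Programs whose only loops are `for j < L`, `L` being kept in the variable `0`. -/
inductive FP where
  | skip
  | assign (v : ℕ) (e : XE)
  | write (a : ℕ) (i e : XE)
  | seq (p q : FP)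
  | ite (e : XE) (p q : FP)
  | rep (j : ℕ) (p : FP)

/-- Iteration with a counter. -/
def iter (f : ℕ → State → State) : ℕ → State → State
  | 0, s => s
  | k + 1, s => f k (iter f k s)

/-- The final state of a program. -/
def FP.run (L : ℕ) : FP → State → State
  | .skip, s => s
  | .assign v e, s => s.setVar v (e.eval L s)
  | .write a i e, s => s.setArr a (i.eval L s) (e.eval L s)
  | .seq p q, s => q.run L (p.run L s)
  | .ite e p q, s => if e.eval L s ≠ 0 then p.run L s else q.run L s
  | .rep j p, s => (iter (fun k t => p.run L (t.setVar j k)) L s).setVar j L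

/-- The program does not assign the variable `j`. -/
def FP.keeps (j : ℕ) : FP → Bool
  | .skip => true
  | .assign v _ => v != j
  | .write _ _ _ => true
  | .seq p q => p.keeps j && q.keeps j
  | .ite _ p q => p.keeps j && q.keeps j
  | .rep i p => i != j && p.keeps j

/-- Only variables below `100` occur, and neither the variable `0` nor the counter of a loop is
assigned. -/
def FP.wf : FP → Bool
  | .skip => true
  | .assign v e => Nat.blt 0 v && v.blt 100 && e.wf
  | .write _ i e => i.wf && e.wf
  | .seq p q => p.wf && q.wf
  | .ite e p q => e.wf && p.wf && q.wf
  | .rep j p => Nat.blt 0 j && j.blt 100 && p.keeps j && p.wf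

/-- Translation to the machine. -/
def FP.code : FP → Program
  | .skip => .skip
  | .assign v e => .seq (e.code 100) (.assign v (.var 100))
  | .write a i e => .seq (i.code 100) (.seq (e.code 101) (.write a (.var 100) (.var 101)))
  | .seq p q => .seq p.code q.code
  | .ite e p q => .seq (e.code 100) (.ite (.var 100) p.code q.code)
  | .rep j p => .seq (.assign j (.const 0)) (.loop (.lt (.var j) (.var 0))
      (.seq p.code (.assign j (.add (.var j) (.const 1)))))

/-- A bound for the running time. -/
noncomputable def FP.time : FP → ℕ[X]
  | .skip => 1
  | .assign _ e => e.time + 2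
  | .write _ i e => i.time + (e.time + 3)
  | .seq p q => p.time + q.time
  | .ite e p q => e.time + (2 + (p.time + q.time))
  | .rep _ p => 2 + (X * ((p.time + 4) + 4) + 4)

theorem iter_keeps {f : ℕ → State → State} {j : ℕ} (h : ∀ k s, (f k s).var j = s.var j) (n : ℕ)
    (s : State) : (iter f n s).var j = s.var j := by
  induction n with
  | zero => rfl
  | succ n ih => rw [iter, h, ih]

theorem FP.run_keeps {L : ℕ} (p : FP) {j : ℕ} (h : p.keeps j) (s : State) :
    (p.run L s).var j = s.var j := by
  induction p generalizing s with
  | skip => rfl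
  | assign v e =>
    simp only [keeps, bne_iff_ne] at h
    simp [run, Ne.symm h]
  | write a i e => rfl
  | seq p q ihp ihq =>
    simp only [keeps, Bool.and_eq_true] at h
    rw [run, ihq h.2, ihp h.1]
  | ite e p q ihp ihq =>
    simp only [keeps, Bool.and_eq_true] at h
    rw [run]
    split_ifs
    · exact ihp h.1 s
    · exact ihq h.2 s
  | rep i p ih =>
    simp only [keeps, Bool.and_eq_true, bne_iff_ne] at h
    have : ∀ k (t : State), (p.run L (t.setVar i k)).var j = t.var j := by
      intro k t
      rw [ih h.2, setVar_var, if_neg (Ne.symm h.1)]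
    rw [run, setVar_var, if_neg (Ne.symm h.1), iter_keeps this]

/-- Loops reread their bound from the variable `0` at every test, so no program may assign it. -/
theorem FP.keeps_zero (p : FP) (hw : p.wf) : p.keeps 0 := by
  induction p with
  | skip => rfl
  | assign v e =>
    simp only [wf, Bool.and_eq_true, Nat.blt_eq] at hw
    simp [keeps]; omega
  | write a i e => rfl
  | seq p q ihp ihq =>
    simp only [wf, Bool.and_eq_true] at hw
    simp [keeps, ihp hw.1, ihq hw.2]
  | ite e p q ihp ihq =>
    simp only [wf, Bool.and_eq_true] at hw
    simp [keeps, ihp hw.1.2, ihq hw.2]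
  | rep i p ih =>
    simp only [wf, Bool.and_eq_true, Nat.blt_eq] at hw
    simp only [keeps, Bool.and_eq_true, ih hw.2, bne_iff_ne, and_true]
    omega

/-- The translation behaves as `FP.run`, within the time `FP.time`. -/
theorem FP.runs_code {L : ℕ} (p : FP) (hw : p.wf) {s t : State} (h : Agree s t)
    (h0 : t.var 0 = L) : Runs p.code s (p.time.eval L) fun s' => Agree s' (p.run L t) := by
  induction p generalizing s t with
  | skip => exact ⟨_, s, .skip s, (silent_ticks 1).mono (by simp [time]), h⟩
  | assign v e =>
    simp only [wf, Bool.and_eq_true, Nat.blt_eq] at hw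
    rw [time, eval_add]
    refine (e.runs_code hw.2 100 le_rfl s ((h.2 0 (by omega)).trans h0)).seq
      fun s₁ ⟨ha, hv, hu⟩ => ?_
    refine Runs.assign (by simp [RExpr.cost]) ?_
    have hag : Agree s₁ t := Agree.trans ⟨ha, fun v hv => hu v hv⟩ h
    have : (RExpr.var 100).eval s₁ = e.eval L t := by
      rw [RExpr.eval, hv, e.eval_congr hw.2 h]
    rw [this]
    exact hag.setVar _ _
  | write a i e =>
    simp only [wf, Bool.and_eq_true] at hw
    rw [time, eval_add, eval_add]
    have hs0 := (h.2 0 (by omega)).trans h0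
    refine (i.runs_code hw.1 100 le_rfl s hs0).seq fun s₁ ⟨ha, hv, hu⟩ => ?_
    refine (e.runs_code hw.2 101 (by omega) s₁ ((hu 0 (by omega)).trans hs0)).seq
      fun s₂ ⟨ha', hv', hu'⟩ => ?_
    refine Runs.write (by simp [RExpr.cost]) ?_
    have hag₁ : Agree s₁ t := Agree.trans ⟨ha, fun v hv => hu v hv⟩ h
    have hag : Agree s₂ t := Agree.trans ⟨ha', fun v hv => hu' v (by omega)⟩ hag₁
    have h1 : (RExpr.var 100).eval s₂ = i.eval L t := by
      rw [RExpr.eval, hu' 100 (by omega), hv, i.eval_congr hw.1 h]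
    have h2 : (RExpr.var 101).eval s₂ = e.eval L t := by
      rw [RExpr.eval, hv', e.eval_congr hw.2 hag₁]
    rw [h1, h2]
    exact hag.setArr _ _ _
  | seq p q ihp ihq =>
    simp only [wf, Bool.and_eq_true] at hw
    rw [time, eval_add]
    refine (ihp hw.1 h h0).seq fun s₁ h₁ => ihq hw.2 h₁ ?_
    rw [run_keeps _ (keeps_zero _ hw.1), h0]
  | ite e p q ihp ihq =>
    simp only [wf, Bool.and_eq_true] at hw
    rw [time, eval_add, eval_add, eval_add, Polynomial.eval_ofNat]
    refine (e.runs_code hw.1.1 100 le_rfl s ((h.2 0 (by omega)).trans h0)).seq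
      fun s₁ ⟨ha, hv, hu⟩ => ?_
    have hag : Agree s₁ t := Agree.trans ⟨ha, fun v hv => hu v hv⟩ h
    rw [e.eval_congr hw.1.1 h] at hv
    refine Runs.ite (e := RExpr.var 100) (fun hc => ?_) (fun hc => ?_)
    · refine (ihp hw.1.2 hag h0).mono (Nat.le_add_right _ _) fun s₂ h₂ => ?_
      rw [run, if_pos (by simpa [RExpr.eval, hv] using hc)]
      exact h₂
    · refine (ihq hw.2 hag h0).mono (Nat.le_add_left _ _) fun s₂ h₂ => ?_
      rw [run, if_neg (by simpa [RExpr.eval, hv] using hc)]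
      exact h₂
  | rep j p ih =>
    simp only [wf, Bool.and_eq_true, Nat.blt_eq] at hw
    obtain ⟨⟨⟨hj0, hj⟩, hk⟩, hwp⟩ := hw
    have hs0 := (h.2 0 (by omega)).trans h0
    have hT : (FP.time (.rep j p)).eval L = 2 + (L * ((p.time.eval L + 4) + 4) + 4) := by
      simp [time]
    rw [hT]
    refine Runs.seq (Q := fun t => t = s.setVar j 0)
      (.assign (by simp [RExpr.cost]) (by simp [RExpr.eval])) fun s₀ hs₀ => ?_
    subst hs₀
    set f : ℕ → State → State := fun k t => p.run L (t.setVar j k) with hf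
    have hf0 : ∀ k s, (f k s).var 0 = s.var 0 := by
      intro k s
      rw [hf]
      simp only
      rw [run_keeps _ (keeps_zero _ hwp), setVar_var, if_neg (by omega)]
    -- The machine increments the counter at the end of the body, while `iter` sets it at the
    -- beginning; the states are therefore compared after setting `j` to `k`.
    let Inv : ℕ → State → Prop := fun k u => Agree u ((iter f k t).setVar j k)
    refine (Runs.loop_lt (L := L) Inv ?_ L 0 _ (by omega) (h.setVar j 0) (by simp) ?_).mono le_rfl ?_
    · intro k hkL u hu huj hu0
      refine (ih hwp hu ?_).seq (Q' := _) fun u₁ hu₁ => ?_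
      · rw [setVar_var, if_neg (by omega), iter_keeps hf0, h0]
      · have hj1 : u₁.var j = k := by
          rw [hu₁.2 j hj, run_keeps _ hk]; simp
        refine Runs.assign (by simp [RExpr.cost]) ⟨by simp [RExpr.eval, hj1], ?_, ?_⟩
        · rw [setVar_var, if_neg (by omega), hu₁.2 0 (by omega), run_keeps _ (keeps_zero _ hwp),
            setVar_var, if_neg (by omega), iter_keeps hf0, h0]
        · have : (RExpr.add (.var j) (.const 1)).eval u₁ = k + 1 := by simp [RExpr.eval, hj1]
          rw [this]
          exact hu₁.setVar _ _
    · rw [setVar_var, if_neg (by omega), hs0]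
    · rintro u ⟨_, _, hu⟩
      exact hu

end EnumKernel

namespace EnumKernel

/-! ## Truth values of expressions -/

/-- The value of the expression is nonzero. -/
def XE.holds (L : ℕ) (e : XE) (s : State) : Prop := e.eval L s ≠ 0

/-- Conjunction. -/
def XE.and (a b : XE) : XE := .cond a b (.const 0)

/-- Disjunction. -/
def XE.or (a b : XE) : XE := .add a b

/-- Negation. -/
def XE.not (a : XE) : XE := .eq a (.const 0)

/-- Implication. -/
def XE.imp (a b : XE) : XE := a.not.or b

/-- Bounded existential quantification. -/
def XE.ex (j : ℕ) (a : XE) : XE := .sum j a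

/-- Bounded universal quantification. -/
def XE.all (j : ℕ) (a : XE) : XE := (XE.ex j a.not).not

/-- The number of `j < L` for which `a` holds. -/
def XE.count (j : ℕ) (a : XE) : XE := .sum j (.cond a (.const 1) (.const 0))

section
variable {L : ℕ} {s : State} {a b : XE} {j : ℕ}

theorem XE.holds_and : (a.and b).holds L s ↔ a.holds L s ∧ b.holds L s := by
  by_cases h : a.eval L s = 0 <;> simp [holds, XE.and, eval, h]

theorem XE.holds_or : (a.or b).holds L s ↔ a.holds L s ∨ b.holds L s := by
  simp only [holds, XE.or, eval]; omega

theorem XE.holds_not : a.not.holds L s ↔ ¬ a.holds L s := by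
  by_cases h : a.eval L s = 0 <;> simp [holds, XE.not, eval, h]

theorem XE.holds_imp : (a.imp b).holds L s ↔ (a.holds L s → b.holds L s) := by
  rw [imp, holds_or, holds_not, imp_iff_not_or]

/-- A sum of natural numbers is nonzero exactly if one of its terms is. -/
theorem XE.holds_ex : (XE.ex j a).holds L s ↔ ∃ k < L, a.holds L (s.setVar j k) := by
  simp only [holds, ex, eval, ne_eq, Finset.sum_eq_zero_iff, Finset.mem_range, not_forall,
    exists_prop]

theorem XE.holds_all : (XE.all j a).holds L s ↔ ∀ k < L, a.holds L (s.setVar j k) := by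
  simp only [all, holds_not, holds_ex, not_exists, not_and, not_not]

theorem XE.holds_lt : (XE.lt a b).holds L s ↔ a.eval L s < b.eval L s := by
  simp [holds, eval]

theorem XE.holds_eq : (XE.eq a b).holds L s ↔ a.eval L s = b.eval L s := by
  simp [holds, eval]

theorem XE.holds_read {c : ℕ} : (XE.read c a).holds L s ↔ s.arr c (a.eval L s) ≠ 0 := Iff.rfl

open Classical in
theorem XE.eval_count : (XE.count j a).eval L s =
    ((Finset.range L).filter fun k => a.holds L (s.setVar j k)).card := by
  rw [Finset.card_filter]
  simp only [count, eval, holds]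
  refine Finset.sum_congr rfl fun i _ => ?_
  by_cases h : a.eval L (s.setVar j i) = 0 <;> simp [h]

end

/-! ## Tables and closures -/

/-- The states agree on the variable `0` and on all arrays but `a`. -/
def Same (a : ℕ) (s t : State) : Prop := t.var 0 = s.var 0 ∧ ∀ b, b ≠ a → t.arr b = s.arr b

theorem Same.refl (a : ℕ) (s : State) : Same a s s := ⟨rfl, fun _ _ => rfl⟩

theorem Same.trans {a : ℕ} {s t u : State} (h : Same a s t) (h' : Same a t u) : Same a s u :=
  ⟨h'.1.trans h.1, fun b hb => (h'.2 b hb).trans (h.2 b hb)⟩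

theorem same_setVar {a j k : ℕ} (hj : j ≠ 0) (s : State) : Same a s (s.setVar j k) :=
  ⟨by simp [Ne.symm hj], fun _ _ => rfl⟩

theorem same_setArr (a i k : ℕ) (s : State) : Same a s (s.setArr a i k) :=
  ⟨rfl, fun b hb => by funext j; simp [hb]⟩

/-- `for j < L: a[j] := e` -/
def FP.table (j a : ℕ) (e : XE) : FP := .rep j (.write a (.var j) e)

/-- The value of `e` is required on every state that agrees with `s` on the variable `0` and outside
the array `a`. It thus cannot depend on the cells already written, which makes the order of writing
irrelevant. -/
theorem FP.run_table {L j a : ℕ} {e : XE} {s : State} {f : ℕ → ℕ} (hj : j ≠ 0)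
    (h : ∀ i < L, ∀ t, Same a s t → t.var j = i → e.eval L t = f i) :
    Same a s ((FP.table j a e).run L s) ∧
      ∀ i, ((FP.table j a e).run L s).arr a i = if i < L then f i else s.arr a i := by
  have key : ∀ k ≤ L, Same a s (iter (fun k t => (FP.write a (.var j) e).run L (t.setVar j k)) k s) ∧
      ∀ i, (iter (fun k t => (FP.write a (.var j) e).run L (t.setVar j k)) k s).arr a i =
        if i < k then f i else s.arr a i := by
    intro k hk
    induction k with
    | zero => exact ⟨Same.refl _ _, fun i => by simp [iter]⟩
    | succ k ih =>
      obtain ⟨h1, h2⟩ := ih (by omega)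
      set t := iter (fun k t => (FP.write a (.var j) e).run L (t.setVar j k)) k s with ht
      have hs : Same a s (t.setVar j k) := h1.trans (same_setVar hj t)
      rw [iter, ← ht, run]
      refine ⟨hs.trans (same_setArr _ _ _ _), fun i => ?_⟩
      rw [setArr_arr, h k hk _ hs (by simp), setVar_arr, h2]
      simp only [XE.eval, setVar_var, if_true, true_and]
      by_cases h3 : i = k
      · simp [h3]
      · rw [if_neg h3]
        by_cases h4 : i < k
        · rw [if_pos h4, if_pos (by omega)]
        · rw [if_neg h4, if_neg (by omega)]
  obtain ⟨h1, h2⟩ := key L le_rfl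
  rw [table, run]
  exact ⟨h1.trans (same_setVar hj _), h2⟩

theorem FP.run_table_holds {L j a : ℕ} {e : XE} {s : State} {P : ℕ → Prop} (hj : j ≠ 0)
    (h : ∀ i < L, ∀ t, Same a s t → t.var j = i → (e.holds L t ↔ P i)) :
    Same a s ((FP.table j a e).run L s) ∧
      ∀ i, ((FP.table j a e).run L s).arr a i ≠ 0 ↔ if i < L then P i else s.arr a i ≠ 0 := by
  have key : ∀ k ≤ L, Same a s (iter (fun k t => (FP.write a (.var j) e).run L (t.setVar j k)) k s) ∧
      ∀ i, (iter (fun k t => (FP.write a (.var j) e).run L (t.setVar j k)) k s).arr a i ≠ 0 ↔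
        if i < k then P i else s.arr a i ≠ 0 := by
    intro k hk
    induction k with
    | zero => exact ⟨Same.refl _ _, fun i => by simp [iter]⟩
    | succ k ih =>
      obtain ⟨h1, h2⟩ := ih (by omega)
      set t := iter (fun k t => (FP.write a (.var j) e).run L (t.setVar j k)) k s with ht
      have hs : Same a s (t.setVar j k) := h1.trans (same_setVar hj t)
      rw [iter, ← ht, run]
      refine ⟨hs.trans (same_setArr _ _ _ _), fun i => ?_⟩
      have h5 := h k hk _ hs (by simp)
      rw [setArr_arr, setVar_arr]
      simp only [XE.eval, setVar_var, if_true, true_and]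
      by_cases h3 : i = k
      · simp only [h3, if_true, Nat.lt_succ_self]
        exact h5
      · rw [if_neg h3, h2]
        by_cases h4 : i < k
        · rw [if_pos h4, if_pos (by omega)]
        · rw [if_neg h4, if_neg (by omega)]
  obtain ⟨h1, h2⟩ := key L le_rfl
  rw [table, run]
  exact ⟨h1.trans (same_setVar hj _), h2⟩

/-- `for j < L: if c then a[j] := 1` -/
def FP.pass (j a : ℕ) (c : XE) : FP := .rep j (.ite c (.write a (.var j) (.const 1)) .skip)

/-- The set obtained from `S` by one pass over `0, …, k - 1`, adding those `i` for which `F` holds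
of the current set. -/
def passSet (F : Set ℕ → ℕ → Prop) (S : Set ℕ) : ℕ → Set ℕ
  | 0 => S
  | k + 1 => passSet F S k ∪ {i | i = k ∧ F (passSet F S k) k}

/-- The set of cells of `a` that are nonzero. -/
def State.supp (s : State) (a : ℕ) : Set ℕ := {i | s.arr a i ≠ 0}

theorem mem_supp {s : State} {a i : ℕ} : i ∈ s.supp a ↔ s.arr a i ≠ 0 := Iff.rfl

/-- In contrast to a table, the condition may read the array that is being written, and the rule `F`
is applied to the current set. Cells from `L` on are recorded as unchanged because quantifiers below
`L` cannot inspect them. -/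
theorem FP.run_pass {L j a : ℕ} {c : XE} {s : State} {F : Set ℕ → ℕ → Prop} (hj : j ≠ 0)
    (h : ∀ i < L, ∀ t, Same a s t → (∀ k ≥ L, t.arr a k = s.arr a k) → t.var j = i →
      (c.holds L t ↔ F (t.supp a) i)) :
    Same a s ((FP.pass j a c).run L s) ∧
      (∀ k ≥ L, ((FP.pass j a c).run L s).arr a k = s.arr a k) ∧
      ((FP.pass j a c).run L s).supp a = passSet F (s.supp a) L := by
  set g : ℕ → State → State :=
    fun k t => (FP.ite c (.write a (.var j) (.const 1)) .skip).run L (t.setVar j k) with hg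
  have key : ∀ k ≤ L, Same a s (iter g k s) ∧ (∀ l ≥ L, (iter g k s).arr a l = s.arr a l) ∧
      (iter g k s).supp a = passSet F (s.supp a) k := by
    intro k hk
    induction k with
    | zero => exact ⟨Same.refl _ _, fun _ _ => rfl, rfl⟩
    | succ k ih =>
      obtain ⟨h1, h7, h2⟩ := ih (by omega)
      set t := iter g k s with ht
      have hs : Same a s (t.setVar j k) := h1.trans (same_setVar hj t)
      have h5 := h k hk _ hs h7 (by simp)
      have hsup : (t.setVar j k).supp a = t.supp a := rfl
      rw [hsup, h2] at h5
      rw [iter, ← ht, hg]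
      simp only [run]
      by_cases hc : XE.holds L c (t.setVar j k)
      · rw [if_pos (show XE.eval L c (t.setVar j k) ≠ 0 from hc)]
        refine ⟨hs.trans (same_setArr _ _ _ _), fun l hl => ?_, ?_⟩
        · rw [setArr_arr, if_neg, setVar_arr, h7 l hl]
          simp only [XE.eval, setVar_var, if_true, true_and]
          omega
        ext i
        have h6 : t.arr a i ≠ 0 ↔ i ∈ passSet F (s.supp a) k := by rw [← h2]; rfl
        simp only [mem_supp, setArr_arr, setVar_arr, XE.eval, setVar_var,
          if_true, true_and, passSet, Set.mem_union, Set.mem_ofPred_eq]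
        by_cases h3 : i = k
        · simp only [h3, if_true, ne_eq, one_ne_zero, not_false_eq_true, true_iff]
          exact Or.inr ⟨trivial, h5.1 hc⟩
        · simp only [h3, if_false, false_and, or_false]
          exact h6
      · rw [if_neg (show ¬ XE.eval L c (t.setVar j k) ≠ 0 from hc)]
        refine ⟨hs, h7, ?_⟩
        rw [hsup, h2, passSet]
        ext i
        simp only [Set.mem_union, Set.mem_ofPred_eq]
        constructor
        · exact Or.inl
        · rintro (h | ⟨rfl, h⟩)
          · exact h
          · exact absurd (h5.2 h) hc
  obtain ⟨h1, h7, h2⟩ := key L le_rfl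
  rw [pass, run]
  exact ⟨h1.trans (same_setVar hj _), h7, h2⟩

theorem subset_passSet (F : Set ℕ → ℕ → Prop) (S : Set ℕ) (k : ℕ) : S ⊆ passSet F S k := by
  induction k with
  | zero => exact subset_rfl
  | succ k ih => exact ih.trans Set.subset_union_left

theorem passSet_mono (F : Set ℕ → ℕ → Prop) (S : Set ℕ) {k l : ℕ} (h : k ≤ l) :
    passSet F S k ⊆ passSet F S l := by
  induction h with
  | refl => exact subset_rfl
  | step _ ih => exact ih.trans Set.subset_union_left

/-- The leastness half of the closure computation: a set closed under the rule for all its subsets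
is never left. -/
theorem passSet_subset {F : Set ℕ → ℕ → Prop} {S T : Set ℕ} {L : ℕ} (hST : S ⊆ T)
    (hF : ∀ U ⊆ T, ∀ i < L, F U i → i ∈ T) : ∀ k ≤ L, passSet F S k ⊆ T := by
  intro k hk
  induction k with
  | zero => exact hST
  | succ k ih =>
    have := ih (by omega)
    refine Set.union_subset this ?_
    rintro i ⟨rfl, hi⟩
    exact hF _ this i hk hi

/-- `L` passes. -/
def FP.closure (m j a : ℕ) (c : XE) : FP := .rep m (FP.pass j a c)

/-- Iterated passes compute the least set that is closed under a monotone rule. -/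
theorem FP.run_closure {L m j a : ℕ} {c : XE} {s : State} {F : Set ℕ → ℕ → Prop} (hj : j ≠ 0)
    (hm : m ≠ 0)
    (h : ∀ i < L, ∀ t, Same a s t → t.var j = i → (c.holds L t ↔ F (t.supp a) i)) :
    Same a s ((FP.closure m j a c).run L s) ∧
      (∀ i < L, F (((FP.closure m j a c).run L s).supp a) i →
        i ∈ ((FP.closure m j a c).run L s).supp a) ∧
      ∀ T, s.supp a ⊆ T → (∀ U ⊆ T, ∀ i < L, F U i → i ∈ T) →
        ((FP.closure m j a c).run L s).supp a ⊆ T := by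
  set g : ℕ → State → State := fun k t => (FP.pass j a c).run L (t.setVar m k) with hg
  have step : ∀ k t, Same a s t → Same a s (g k t) ∧ (g k t).supp a = passSet F (t.supp a) L := by
    intro k t ht
    have hs : Same a s (t.setVar m k) := ht.trans (same_setVar hm t)
    obtain ⟨h1, -, h2⟩ := FP.run_pass (s := t.setVar m k) (F := F) hj
      fun i hi u hu _ hui => h i hi u (hs.trans hu) hui
    exact ⟨hs.trans h1, h2⟩
  -- A pass leaves a closed set unchanged and adds an element below `L` to any other one. So after
  -- `k` passes the set is closed or has at least `k` elements below `L`.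
  have key : ∀ k, Same a s (iter g k s) ∧
      (∀ T, s.supp a ⊆ T → (∀ U ⊆ T, ∀ i < L, F U i → i ∈ T) → (iter g k s).supp a ⊆ T) ∧
      ((∀ i < L, F ((iter g k s).supp a) i → i ∈ (iter g k s).supp a) ∨
        k ≤ ((iter g k s).supp a ∩ Set.Iio L).ncard) := by
    intro k
    induction k with
    | zero => exact ⟨Same.refl _ _, fun T h _ => h, Or.inr (Nat.zero_le _)⟩
    | succ k ih =>
      obtain ⟨h1, h2, h3⟩ := ih
      obtain ⟨h4, h5⟩ := step k _ h1
      rw [iter]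
      refine ⟨h4, fun T hT hF => ?_, ?_⟩
      · rw [h5]
        exact passSet_subset (h2 T hT hF) hF L le_rfl
      · by_cases hcl : ∀ i < L, F ((iter g k s).supp a) i → i ∈ (iter g k s).supp a
        · left
          have : passSet F ((iter g k s).supp a) L = (iter g k s).supp a := by
            refine Set.Subset.antisymm ?_ (subset_passSet _ _ _)
            have : ∀ k' ≤ L, passSet F ((iter g k s).supp a) k' = (iter g k s).supp a := by
              intro k' hk'
              induction k' with
              | zero => rfl
              | succ k' ih' =>
                rw [passSet, ih' (by omega), Set.union_eq_left]
                rintro i ⟨rfl, hi⟩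
                exact hcl i hk' hi
            exact (this L le_rfl).subset
          rw [h5, this]
          exact hcl
        · right
          have h3' := h3.resolve_left hcl
          rw [h5]
          set S := (iter g k s).supp a with hS
          have hfin : ∀ T : Set ℕ, (T ∩ Set.Iio L).Finite :=
            fun T => (Set.finite_Iio L).subset Set.inter_subset_right
          have hne : ∃ i < L, i ∈ passSet F S L ∧ i ∉ S := by
            by_contra hcon
            push Not at hcon
            apply hcl
            have : ∀ k' ≤ L, passSet F S k' = S := by
              intro k' hk'
              induction k' with
              | zero => rfl
              | succ k' ih' =>
                rw [passSet, ih' (by omega), Set.union_eq_left]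
                rintro i ⟨rfl, hi⟩
                refine hcon i hk' (passSet_mono F S hk' ?_)
                rw [passSet, ih' (by omega)]
                exact Or.inr ⟨rfl, hi⟩
            intro i hi hFi
            refine hcon i hi (passSet_mono F S hi ?_)
            rw [passSet, this i hi.le]
            exact Or.inr ⟨rfl, hFi⟩
          obtain ⟨i, hiL, hi1, hi2⟩ := hne
          have : S ∩ Set.Iio L ⊂ passSet F S L ∩ Set.Iio L := by
            refine ⟨Set.inter_subset_inter_left _ (subset_passSet _ _ _), fun hsub => ?_⟩
            exact hi2 (hsub ⟨hi1, hiL⟩).1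
          have := Set.ncard_lt_ncard this (hfin _)
          omega
  obtain ⟨h1, h2, h3⟩ := key L
  rw [closure, run]
  refine ⟨h1.trans (same_setVar hm _), ?_, h2⟩
  change ∀ i < L, F ((iter g L s).supp a) i → i ∈ (iter g L s).supp a
  rcases h3 with h3 | h3
  · exact h3
  -- A set with `L` elements below `L` contains all of them and is closed for this trivial reason.
  · intro i hi _
    have hsub : (iter g L s).supp a ∩ Set.Iio L = Set.Iio L := by
      refine Set.eq_of_subset_of_ncard_le Set.inter_subset_right ?_ (Set.finite_Iio L)
      rw [← Finset.coe_Iio, Set.ncard_coe_finset, Nat.card_Iio, Finset.coe_Iio]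
      exact h3
    exact (hsub.symm.subset hi).1

end EnumKernel

namespace EnumKernel

/-! ## Graphs on initial segments of `ℕ` -/

/-- `adj` is the adjacency relation of a graph with vertices `0, …, n - 1`. -/
structure IsGraph (n : ℕ) (adj : ℕ → ℕ → Prop) : Prop where
  symm : ∀ {i j}, adj i j → adj j i
  irrefl : ∀ i, ¬ adj i i
  lt : ∀ {i j}, adj i j → i < n

theorem IsGraph.ne {n : ℕ} {adj : ℕ → ℕ → Prop} (hG : IsGraph n adj) {i j : ℕ} (h : adj i j) :
    i ≠ j := fun e => hG.irrefl j (e ▸ h)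

theorem IsGraph.lt' {n : ℕ} {adj : ℕ → ℕ → Prop} (hG : IsGraph n adj) {i j : ℕ} (h : adj i j) :
    j < n := hG.lt (hG.symm h)

section Defs

variable (adj : ℕ → ℕ → Prop)

/-- Vertices of the 2-core. -/
def Core (v : ℕ) : Prop :=
  ∃ S : Set ℕ, v ∈ S ∧ ∀ u ∈ S, ∃ a ∈ S, ∃ b ∈ S, adj u a ∧ adj u b ∧ a ≠ b

/-- Vertices of degree at least `3` in the 2-core. -/
def Branch (v : ℕ) : Prop :=
  Core adj v ∧ ∃ a b c, (Core adj a ∧ adj v a) ∧ (Core adj b ∧ adj v b) ∧ (Core adj c ∧ adj v c) ∧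
    a ≠ b ∧ a ≠ c ∧ b ≠ c

/-- Vertices of degree `2` in the 2-core without branch vertices as neighbours. -/
def Inner (v : ℕ) : Prop :=
  Core adj v ∧ ¬ Branch adj v ∧ ∀ u, adj v u → ¬ Branch adj u

/-- Inner vertices with an inner neighbour. They are suppressed in the kernel. -/
def Supp (v : ℕ) : Prop := Inner adj v ∧ ∃ u, adj v u ∧ Inner adj u

/-- The vertices of the 2-core that are kept. -/
def Keep (v : ℕ) : Prop := Core adj v ∧ ¬ Supp adj v

/-- Suppressed vertices in the same component of the subgraph of suppressed vertices. -/
inductive Link : ℕ → ℕ → Prop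
  | refl {v} : Supp adj v → Link v v
  | step {u v w} : Link u v → adj v w → Supp adj w → Link u w

/-- Kept vertices adjacent to the component of `q`. -/
def Bdry (q w : ℕ) : Prop := Keep adj w ∧ ∃ v, Link adj q v ∧ adj w v

/-- Edges of the 2-core with an end in the component of `q`. -/
def Cls (q i j : ℕ) : Prop :=
  adj i j ∧ Core adj i ∧ Core adj j ∧ (Link adj q i ∨ Link adj q j)

end Defs

/-! ### Structure of the components of suppressed vertices -/

section Graph

variable {n : ℕ} {adj : ℕ → ℕ → Prop}

/-- The set that witnesses membership of `v` in the core witnesses it for all its elements. -/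
theorem Core.two {v : ℕ} (h : Core adj v) :
    ∃ a b, Core adj a ∧ Core adj b ∧ adj v a ∧ adj v b ∧ a ≠ b := by
  obtain ⟨S, hv, hS⟩ := h
  obtain ⟨a, ha, b, hb, h1, h2, h3⟩ := hS v hv
  exact ⟨a, b, ⟨S, ha, hS⟩, ⟨S, hb, hS⟩, h1, h2, h3⟩

theorem Supp.core {v : ℕ} (h : Supp adj v) : Core adj v := h.1.1

theorem core_nbrs_of_not_branch {v : ℕ} (hc : Core adj v) (hb : ¬ Branch adj v) :
    ∃ a b, Core adj a ∧ Core adj b ∧ adj v a ∧ adj v b ∧ a ≠ b ∧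
      ∀ c, Core adj c → adj v c → c = a ∨ c = b := by
  obtain ⟨a, b, ha, hb', h1, h2, h3⟩ := hc.two
  refine ⟨a, b, ha, hb', h1, h2, h3, fun c hcc hvc => ?_⟩
  by_contra hcon
  push Not at hcon
  exact hb ⟨hc, a, b, c, ⟨ha, h1⟩, ⟨hb', h2⟩, ⟨hcc, hvc⟩, h3, hcon.1.symm, hcon.2.symm⟩

theorem Core.keep_or_supp {v : ℕ} (h : Core adj v) : Keep adj v ∨ Supp adj v := by
  by_cases hs : Supp adj v
  · exact Or.inr hs
  · exact Or.inl ⟨h, hs⟩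

theorem Link.left {u v : ℕ} (h : Link adj u v) : Supp adj u := by
  induction h with
  | refl h => exact h
  | step _ _ _ ih => exact ih

theorem Link.right {u v : ℕ} (h : Link adj u v) : Supp adj v := by
  cases h with
  | refl h => exact h
  | step _ _ h => exact h

theorem Link.trans {u v w : ℕ} (h : Link adj u v) (h' : Link adj v w) : Link adj u w := by
  induction h' with
  | refl _ => exact h
  | step _ h1 h2 ih => exact .step ih h1 h2

theorem IsGraph.link_symm (hG : IsGraph n adj) {u v : ℕ} (h : Link adj u v) : Link adj v u := by
  induction h with
  | refl h => exact .refl h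
  | step h1 h2 h3 ih => exact (Link.step (.refl h3) (hG.symm h2) h1.right).trans ih

/-- A kept vertex has at most one suppressed neighbour. -/
theorem IsGraph.keep_unique (hG : IsGraph n adj) {w v v' : ℕ} (hw : Keep adj w) (hv : Supp adj v)
    (hv' : Supp adj v') (h : adj w v) (h' : adj w v') : v = v' := by
  -- A suppressed vertex has no branch neighbour, so `w` is no branch vertex. But `w` must have a
  -- branch neighbour, since otherwise it would be inner next to the inner vertex `v` and hence
  -- suppressed. That neighbour and two suppressed ones would give `w` core degree three.
  have hnb : ¬ Branch adj w := hv.1.2.2 w (hG.symm h)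
  have : ∃ u, adj w u ∧ Branch adj u := by
    by_contra hcon
    push Not at hcon
    exact hw.2 ⟨⟨hw.1, hnb, hcon⟩, v, h, hv.1⟩
  obtain ⟨u, hu, hbu⟩ := this
  by_contra hne
  refine hnb ⟨hw.1, u, v, v', ⟨hbu.1, hu⟩, ⟨hv.core, h⟩, ⟨hv'.core, h'⟩, ?_, ?_, hne⟩
  · rintro rfl; exact hv.1.2.1 hbu
  · rintro rfl; exact hv'.1.2.1 hbu

theorem IsGraph.cls_symm (hG : IsGraph n adj) {q i j : ℕ} (h : Cls adj q i j) : Cls adj q j i :=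
  ⟨hG.symm h.1, h.2.2.1, h.2.1, h.2.2.2.symm⟩

theorem cls_of_link {q i j : ℕ} (h : Link adj q i) (hc : Core adj j) (ha : adj i j) :
    Cls adj q i j := ⟨ha, h.right.core, hc, Or.inl h⟩

theorem Cls.of_link {p q i j : ℕ} (h : Link adj p q) (h' : Cls adj q i j) : Cls adj p i j :=
  ⟨h'.1, h'.2.1, h'.2.2.1, h'.2.2.2.imp h.trans h.trans⟩

/-- The ends of a class edge are in the component or on its boundary. -/
theorem IsGraph.cls_ends (hG : IsGraph n adj) {q i j : ℕ} (h : Cls adj q i j) :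
    Link adj q i ∨ (Bdry adj q i ∧ Link adj q j) := by
  rcases h.2.2.2 with h1 | h1
  · exact Or.inl h1
  · rcases h.2.1.keep_or_supp with h2 | h2
    · exact Or.inr ⟨⟨h2, j, h1, h.1⟩, h1⟩
    · exact Or.inl (.step h1 (hG.symm h.1) h2)

open Classical in
/-- The class edges at a vertex. -/
theorem IsGraph.cls_card (hG : IsGraph n adj) (q i : ℕ) :
    (Link adj q i → ((Finset.range n).filter (Cls adj q i)).card = 2) ∧
    (Bdry adj q i → ((Finset.range n).filter (Cls adj q i)).card = 1) ∧
    (¬ Link adj q i → ¬ Bdry adj q i → ((Finset.range n).filter (Cls adj q i)).card = 0) := by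
  refine ⟨fun h => ?_, fun h => ?_, fun h h' => ?_⟩
  · obtain ⟨a, b, ha, hb, h1, h2, h3, h4⟩ :=
      core_nbrs_of_not_branch h.right.core h.right.1.2.1
    have : (Finset.range n).filter (Cls adj q i) = {a, b} := by
      ext j
      simp only [Finset.mem_filter, Finset.mem_range, Finset.mem_insert, Finset.mem_singleton]
      constructor
      · rintro ⟨_, hj⟩
        exact h4 j hj.2.2.1 hj.1
      · rintro (rfl | rfl)
        · exact ⟨hG.lt' h1, cls_of_link h ha h1⟩
        · exact ⟨hG.lt' h2, cls_of_link h hb h2⟩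
    rw [this, Finset.card_pair h3]
  · obtain ⟨hk, v, hv, hiv⟩ := h
    have : (Finset.range n).filter (Cls adj q i) = {v} := by
      ext j
      simp only [Finset.mem_filter, Finset.mem_range, Finset.mem_singleton]
      constructor
      · rintro ⟨_, hj⟩
        rcases hG.cls_ends hj with h1 | ⟨_, h1⟩
        · exact absurd h1.right hk.2
        · exact hG.keep_unique hk h1.right hv.right hj.1 hiv
      · rintro rfl
        exact ⟨hG.lt' hiv, hG.cls_symm (cls_of_link hv hk.1 (hG.symm hiv))⟩
    rw [this, Finset.card_singleton]
  · rw [Finset.card_eq_zero, Finset.filter_eq_empty_iff]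
    intro j _ hj
    rcases hG.cls_ends hj with h1 | ⟨h1, _⟩
    · exact h h1
    · exact h' h1

open Classical in
/-- The boundary as a finite set. -/
noncomputable def bdry (n : ℕ) (adj : ℕ → ℕ → Prop) (q : ℕ) : Finset ℕ :=
  (Finset.range n).filter (Bdry adj q)

open Classical in
/-- The component of `q` as a finite set. -/
noncomputable def linkSet (n : ℕ) (adj : ℕ → ℕ → Prop) (q : ℕ) : Finset ℕ :=
  (Finset.range n).filter (Link adj q)

open Classical in
/-- The edges of a class as a finite set of increasing pairs. -/
noncomputable def clsPairs (n : ℕ) (adj : ℕ → ℕ → Prop) (q : ℕ) : Finset (ℕ × ℕ) :=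
  (Finset.range n ×ˢ Finset.range n).filter fun p => p.1 < p.2 ∧ Cls adj q p.1 p.2

theorem IsGraph.mem_bdry (hG : IsGraph n adj) {q w : ℕ} : w ∈ bdry n adj q ↔ Bdry adj q w := by
  simp only [bdry, Finset.mem_filter, Finset.mem_range, and_iff_right_iff_imp]
  rintro ⟨_, v, _, h⟩
  exact hG.lt h

theorem IsGraph.mem_linkSet (hG : IsGraph n adj) {q v : ℕ} :
    v ∈ linkSet n adj q ↔ Link adj q v := by
  simp only [linkSet, Finset.mem_filter, Finset.mem_range, and_iff_right_iff_imp]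
  intro h
  obtain ⟨u, hu, _⟩ := h.right.2
  exact hG.lt hu

theorem IsGraph.mem_clsPairs (hG : IsGraph n adj) {q : ℕ} {p : ℕ × ℕ} :
    p ∈ clsPairs n adj q ↔ p.1 < p.2 ∧ Cls adj q p.1 p.2 := by
  simp only [clsPairs, Finset.mem_filter, Finset.mem_product, Finset.mem_range,
    and_iff_right_iff_imp]
  rintro ⟨_, h⟩
  exact ⟨hG.lt h.1, hG.lt' h.1⟩

/-- Handshaking for the edges of a class. -/
theorem IsGraph.handshake {M : Type*} [AddCommMonoid M] (hG : IsGraph n adj) (q : ℕ) (c : ℕ → M) :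
    ∑ p ∈ clsPairs n adj q, (c p.1 + c p.2) =
      ∑ w ∈ bdry n adj q, c w + ∑ v ∈ linkSet n adj q, (c v + c v) := by
  classical
  -- Both ends of increasing pairs are the first ends of ordered pairs, so the sum becomes one over
  -- vertices weighted by their class degree, which `IsGraph.cls_card` provides.
  have h1 : ∑ p ∈ clsPairs n adj q, (c p.1 + c p.2) =
      ∑ i ∈ Finset.range n, ∑ j ∈ Finset.range n, if Cls adj q i j then c i else 0 := by
    rw [Finset.sum_add_distrib]
    have e1 : ∑ p ∈ clsPairs n adj q, c p.1 = ∑ i ∈ Finset.range n, ∑ j ∈ Finset.range n,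
        if i < j ∧ Cls adj q i j then c i else 0 := by
      rw [clsPairs, Finset.sum_filter, Finset.sum_product]
    have e2 : ∑ p ∈ clsPairs n adj q, c p.2 = ∑ i ∈ Finset.range n, ∑ j ∈ Finset.range n,
        if j < i ∧ Cls adj q i j then c i else 0 := by
      rw [clsPairs, Finset.sum_filter, Finset.sum_product, Finset.sum_comm]
      refine Finset.sum_congr rfl fun i _ => Finset.sum_congr rfl fun j _ => ?_
      have : (j < i ∧ Cls adj q j i) ↔ (j < i ∧ Cls adj q i j) :=
        and_congr_right fun _ => ⟨hG.cls_symm, hG.cls_symm⟩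
      simp only [this]
    rw [e1, e2, ← Finset.sum_add_distrib]
    refine Finset.sum_congr rfl fun i _ => ?_
    rw [← Finset.sum_add_distrib]
    refine Finset.sum_congr rfl fun j _ => ?_
    by_cases h : Cls adj q i j
    · rcases lt_trichotomy i j with h2 | h2 | h2
      · simp [h, h2, h2.not_gt]
      · exact absurd h2 (hG.ne h.1)
      · simp [h, h2, h2.not_gt]
    · simp [h]
  rw [h1, bdry, linkSet, Finset.sum_filter, Finset.sum_filter, ← Finset.sum_add_distrib]
  refine Finset.sum_congr rfl fun i _ => ?_
  rw [← Finset.sum_filter, Finset.sum_const]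
  obtain ⟨c1, c2, c3⟩ := hG.cls_card q i
  by_cases hl : Link adj q i
  · have hb : ¬ Bdry adj q i := fun h => h.1.2 hl.right
    have := c1 hl
    simp only [hl, hb, if_false, zero_add, if_true]
    convert two_nsmul (c i) using 2
  · by_cases hb : Bdry adj q i
    · have := c2 hb
      simp only [hl, hb, if_true, if_false, add_zero]
      convert one_nsmul (c i) using 2
    · have := c3 hl hb
      simp only [hl, hb, if_false, add_zero]
      convert zero_nsmul (c i) using 2

/-- Vertices of the component occur in two class edges and cancel modulo two: the parity of the
number of cut edges in a class depends only on the boundary colours. -/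
theorem IsGraph.sum_cls (hG : IsGraph n adj) (q : ℕ) (c : ℕ → ZMod 2) :
    ∑ p ∈ clsPairs n adj q, (c p.1 + c p.2) = ∑ w ∈ bdry n adj q, c w := by
  rw [hG.handshake, add_eq_left]
  exact Finset.sum_eq_zero fun v _ => CharTwo.add_self_eq_zero _

/-- Handshaking with constant weight one: the boundary and twice the component together count every
class edge twice. -/
theorem IsGraph.even_card_bdry (hG : IsGraph n adj) (q : ℕ) : Even (bdry n adj q).card := by
  have h := hG.handshake q fun _ => 1
  simp only [Finset.sum_const, smul_eq_mul, mul_one] at h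
  refine ⟨(clsPairs n adj q).card - (linkSet n adj q).card, ?_⟩
  omega

/-- A connected graph on `ℓ` vertices has at least `ℓ - 1` edges. The core degrees in the component
add up to `2ℓ`, so at most two edge ends are left for edges to the boundary, and each boundary
vertex uses one of them. -/
theorem IsGraph.card_bdry_le (hG : IsGraph n adj) {q : ℕ} (hq : Supp adj q) :
    (bdry n adj q).card ≤ 2 := by
  classical
  let G : SimpleGraph (linkSet n adj q) :=
    { Adj := fun u v => adj u v
      symm := ⟨fun _ _ h => hG.symm h⟩
      loopless := ⟨fun u h => hG.irrefl u h⟩ }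
  have hq0 : q ∈ linkSet n adj q := hG.mem_linkSet.2 (.refl hq)
  have hreach : ∀ v, Link adj q v → ∀ hv : v ∈ linkSet n adj q, G.Reachable ⟨q, hq0⟩ ⟨v, hv⟩ := by
    intro v h
    induction h with
    | refl _ => exact fun _ => SimpleGraph.Reachable.refl _
    | step h1 h2 h3 ih =>
      intro hv
      have hm := hG.mem_linkSet.2 h1
      exact (ih hm).trans (SimpleGraph.Adj.reachable (G := G) h2)
  have hconn : G.Connected := by
    refine (SimpleGraph.connected_iff_exists_forall_reachable G).2 ⟨⟨q, hq0⟩, fun v => ?_⟩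
    exact hreach v (hG.mem_linkSet.1 v.2) v.2
  have hE := hconn.card_vert_le_card_edgeSet_add_one
  rw [Nat.card_eq_fintype_card, Nat.card_eq_fintype_card, Fintype.card_coe,
    ← SimpleGraph.edgeFinset_card] at hE
  have hS := G.sum_degrees_eq_twice_card_edges
  have hdeg : ∀ v : linkSet n adj q, G.degree v + ((bdry n adj q).filter (adj v)).card = 2 := by
    intro v
    have hv := hG.mem_linkSet.1 v.2
    have h2 := (hG.cls_card q v).1 hv
    have : (Finset.range n).filter (Cls adj q v) =
        ((G.neighborFinset v).map (Function.Embedding.subtype _)) ∪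
          (bdry n adj q).filter (adj v) := by
      ext j
      simp only [Finset.mem_filter, Finset.mem_range, Finset.mem_union, Finset.mem_map,
        SimpleGraph.mem_neighborFinset, Function.Embedding.subtype_apply, hG.mem_bdry]
      constructor
      · rintro ⟨_, hj⟩
        rcases hG.cls_ends (hG.cls_symm hj) with h | ⟨h, _⟩
        · exact Or.inl ⟨⟨j, hG.mem_linkSet.2 h⟩, hj.1, rfl⟩
        · exact Or.inr ⟨h, hj.1⟩
      · rintro (⟨a, ha, rfl⟩ | ⟨h, hj⟩)
        · exact ⟨hG.lt' ha, cls_of_link hv (hG.mem_linkSet.1 a.2).right.core ha⟩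
        · exact ⟨hG.lt' hj, cls_of_link hv h.1.1 hj⟩
    rw [this, Finset.card_union_of_disjoint, Finset.card_map, SimpleGraph.card_neighborFinset_eq_degree] at h2
    · exact h2
    · rw [Finset.disjoint_left]
      intro j hj hj'
      obtain ⟨a, _, rfl⟩ := Finset.mem_map.1 hj
      exact (hG.mem_bdry.1 (Finset.mem_filter.1 hj').1).1.2 (hG.mem_linkSet.1 a.2).right
  have hsum : ∑ v : linkSet n adj q, (G.degree v + ((bdry n adj q).filter (adj v)).card) =
      (linkSet n adj q).card * 2 := by
    rw [Finset.sum_congr rfl fun v _ => hdeg v, Finset.sum_const, Finset.card_univ,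
      Fintype.card_coe, smul_eq_mul]
  rw [Finset.sum_add_distrib, hS] at hsum
  have hb : ∑ v : linkSet n adj q, ((bdry n adj q).filter (adj v)).card = (bdry n adj q).card := by
    rw [Finset.sum_coe_sort (linkSet n adj q) fun v => ((bdry n adj q).filter (adj v)).card]
    simp only [Finset.card_filter]
    rw [Finset.sum_comm, Finset.card_eq_sum_ones]
    refine Finset.sum_congr rfl fun w hw => ?_
    obtain ⟨hk, v, hv, hwv⟩ := hG.mem_bdry.1 hw
    rw [Finset.sum_eq_single_of_mem v (hG.mem_linkSet.2 hv), if_pos (hG.symm hwv)]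
    intro u hu huv
    rw [if_neg]
    intro huw
    exact huv (hG.keep_unique hk (hG.mem_linkSet.1 hu).right hv.right (hG.symm huw) hwv)
  omega

/-- The component of `q` has no boundary, or exactly two boundary vertices. -/
theorem IsGraph.bdry_cases (hG : IsGraph n adj) {q : ℕ} (hq : Supp adj q) :
    bdry n adj q = ∅ ∨ ∃ w w', w ≠ w' ∧ bdry n adj q = {w, w'} := by
  have h1 := hG.even_card_bdry q
  have h2 := hG.card_bdry_le hq
  have : (bdry n adj q).card = 0 ∨ (bdry n adj q).card = 2 := by
    obtain ⟨r, hr⟩ := h1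
    omega
  rcases this with h | h
  · exact Or.inl (Finset.card_eq_zero.1 h)
  · obtain ⟨w, w', hne, h⟩ := Finset.card_eq_two.1 h
    exact Or.inr ⟨w, w', hne, h⟩

/-! ## Extending colourings -/

/-- If vertices outside `X` can be removed one after the other, each having at most one neighbour
when it is removed, then a colouring of `X` extends. -/
theorem exists_coloring_of_peel {r : ℕ → ℕ → Prop} (hr : IsGraph n r) {X : Set ℕ}
    (hpeel : ∀ U : Set ℕ, X ⊆ U → (∃ u ∈ U, u ∉ X) →
      ∃ v ∈ U, v ∉ X ∧ ∀ a ∈ U, ∀ b ∈ U, r v a → r v b → a = b)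
    {μ : ℕ → ℕ → ZMod 2} (hμ : ∀ i j, μ i j = μ j i) {d : ℕ → ZMod 2}
    (hd : ∀ a ∈ X, ∀ b ∈ X, r a b → μ a b = d a + d b) :
    ∃ c : ℕ → ZMod 2, (∀ a ∈ X, c a = d a) ∧ ∀ a b, r a b → μ a b = c a + c b := by
  classical
  have key : ∀ (k : ℕ) (F : Finset ℕ), F.card = k → (∀ v ∈ F, v ∉ X) →
      ∃ c : ℕ → ZMod 2, (∀ a ∈ X, c a = d a) ∧
        ∀ a ∈ X ∪ F, ∀ b ∈ X ∪ F, r a b → μ a b = c a + c b := by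
    intro k
    induction k with
    | zero =>
      intro F hF _
      rw [Finset.card_eq_zero.1 hF]
      exact ⟨d, fun _ _ => rfl, by simpa using hd⟩
    | succ k ih =>
      intro F hF hFX
      obtain ⟨f, hf⟩ := Finset.card_pos.1 (by omega : 0 < F.card)
      obtain ⟨v, hv, hvX, huniq⟩ := hpeel (X ∪ F) Set.subset_union_left ⟨f, Or.inr hf, hFX f hf⟩
      have hvF : v ∈ F := hv.resolve_left hvX
      obtain ⟨c, hc1, hc2⟩ := ih (F.erase v) (by rw [Finset.card_erase_of_mem hvF]; omega)
        fun u hu => hFX u (Finset.mem_of_mem_erase hu)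
      -- The vertex removed first is coloured last. Its colour is forced by its only neighbour among
      -- the coloured vertices; without a neighbour any colour will do.
      let z : ZMod 2 := if h : ∃ a ∈ X ∪ F, r v a then c h.choose + μ v h.choose else 0
      have hz : ∀ a ∈ X ∪ F, r v a → μ v a = z + c a := by
        intro a ha hva
        have h : ∃ a ∈ X ∪ (F : Set ℕ), r v a := ⟨a, ha, hva⟩
        have : h.choose = a := huniq _ h.choose_spec.1 _ ha h.choose_spec.2 hva
        simp only [z, dif_pos h, this]
        rw [add_comm (c a), add_assoc, CharTwo.add_self_eq_zero, add_zero]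
      have hmem : ∀ a ∈ X ∪ (F : Set ℕ), a ≠ v → a ∈ X ∪ ((F.erase v : Finset ℕ) : Set ℕ) := by
        rintro a (ha | ha) hav
        · exact Or.inl ha
        · exact Or.inr (Finset.mem_erase.2 ⟨hav, ha⟩)
      refine ⟨Function.update c v z, fun a ha => ?_, fun a ha b hb hab => ?_⟩
      · rw [Function.update_of_ne, hc1 a ha]
        rintro rfl
        exact hvX ha
      · by_cases h1 : a = v
        · subst h1
          have h2 : b ≠ a := (hr.ne hab).symm
          rw [Function.update_self, Function.update_of_ne h2]
          exact hz b hb hab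
        · by_cases h2 : b = v
          · subst h2
            rw [Function.update_self, Function.update_of_ne h1, hμ, add_comm]
            exact hz a ha (hr.symm hab)
          · rw [Function.update_of_ne h1, Function.update_of_ne h2]
            exact hc2 a (hmem a ha h1) b (hmem b hb h2) hab
  obtain ⟨c, h1, h2⟩ := key _ ((Finset.range n).filter (· ∉ X)) rfl fun v hv =>
    (Finset.mem_filter.1 hv).2
  refine ⟨c, h1, fun a b hab => h2 a ?_ b ?_ hab⟩
  · by_cases h : a ∈ X
    · exact Or.inl h
    · exact Or.inr (by simpa using ⟨hr.lt hab, h⟩)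
  · by_cases h : b ∈ X
    · exact Or.inl h
    · exact Or.inr (by simpa using ⟨hr.lt' hab, h⟩)

/-- A colouring of the kept vertices extends to a colouring with prescribed cut edges, provided
that in every class the parity of the number of prescribed edges is right. -/
theorem IsGraph.exists_coloring (hG : IsGraph n adj) {μ : ℕ → ℕ → ZMod 2}
    (hμ : ∀ i j, μ i j = μ j i) {d : ℕ → ZMod 2}
    (hd : ∀ a b, Keep adj a → Keep adj b → adj a b → μ a b = d a + d b)
    (hpar : ∀ q, Supp adj q →
      ∑ p ∈ clsPairs n adj q, μ p.1 p.2 = ∑ w ∈ bdry n adj q, d w) :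
    ∃ c : ℕ → ZMod 2, (∀ a, Keep adj a → c a = d a) ∧ ∀ a b, adj a b → μ a b = c a + c b := by
  classical
  -- One edge of every class is set aside, from the least vertex `ρ q` of the component to a core
  -- neighbour `α q`. Both are made to depend on the component only. Without these edges the
  -- vertices that are not kept can be peeled off.
  let ρ : ℕ → ℕ := fun q => sInf {v | Link adj q v}
  have hρ : ∀ q, Supp adj q → Link adj q (ρ q) := fun q hq => Nat.sInf_mem ⟨q, .refl hq⟩
  have hρeq : ∀ p q, Link adj p q → ρ p = ρ q := by
    intro p q h
    have : {v | Link adj p v} = {v | Link adj q v} := by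
      ext v
      exact ⟨fun h' => (hG.link_symm h).trans h', fun h' => h.trans h'⟩
    simp only [ρ, this]
  have hα : ∀ q, ∃ a, Supp adj q → adj (ρ q) a ∧ Core adj a := by
    intro q
    by_cases hq : Supp adj q
    · obtain ⟨a, _, ha, _, h, _⟩ := (hρ q hq).right.core.two
      exact ⟨a, fun _ => ⟨h, ha⟩⟩
    · exact ⟨0, fun h => absurd h hq⟩
  choose α₀ hα₀ using hα
  let α : ℕ → ℕ := fun q => α₀ (ρ q)
  have hα : ∀ q, Supp adj q → adj (ρ q) (α q) ∧ Core adj (α q) := by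
    intro q hq
    have h1 := hα₀ (ρ q) (hρ q hq).right
    rwa [← hρeq q (ρ q) (hρ q hq)] at h1
  have hαeq : ∀ p q, Link adj p q → α p = α q := fun p q h => by simp only [α, hρeq p q h]
  let sp : ℕ → ℕ → Prop := fun i j => ∃ q, Supp adj q ∧ ((i = ρ q ∧ j = α q) ∨ (j = ρ q ∧ i = α q))
  have hr : IsGraph n fun i j => adj i j ∧ ¬ sp i j :=
    ⟨fun {i j} h => ⟨hG.symm h.1, fun ⟨q, hq, hs⟩ => h.2 ⟨q, hq, hs.symm⟩⟩,
      fun i h => hG.irrefl i h.1, fun h => hG.lt h.1⟩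
  have hpeel : ∀ U : Set ℕ, {v | Keep adj v} ⊆ U → (∃ u ∈ U, u ∉ {v | Keep adj v}) →
      ∃ v ∈ U, v ∉ {v | Keep adj v} ∧
        ∀ a ∈ U, ∀ b ∈ U, adj v a ∧ ¬ sp v a → adj v b ∧ ¬ sp v b → a = b := by
    intro U hXU ⟨u, huU, huX⟩
    by_contra hcon
    push Not at hcon
    have htwo : ∀ v ∈ U, ¬ Keep adj v → ∃ a ∈ U, ∃ b ∈ U, (adj v a ∧ ¬ sp v a) ∧
        (adj v b ∧ ¬ sp v b) ∧ a ≠ b := by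
      intro v hv hvX
      obtain ⟨a, ha, b, hb, h1, h2, h3⟩ := hcon v hv hvX
      exact ⟨a, ha, b, hb, h1, h2, h3⟩
    -- If nothing can be peeled, every vertex of `U` that is not kept has two neighbours in `U`. So
    -- `U` together with the core has minimum degree two and is contained in the core.
    have hUC : ∀ v ∈ U, Core adj v := by
      intro v hv
      refine ⟨U ∪ {v | Core adj v}, Or.inl hv, ?_⟩
      have hcore : ∀ w, Core adj w → ∃ a ∈ U ∪ {v | Core adj v}, ∃ b ∈ U ∪ {v | Core adj v},
          adj w a ∧ adj w b ∧ a ≠ b := by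
        intro w hw
        obtain ⟨a, b, ha, hb, h⟩ := hw.two
        exact ⟨a, Or.inr ha, b, Or.inr hb, h⟩
      rintro w (hw | hw)
      · by_cases hk : Keep adj w
        · exact hcore w hk.1
        · obtain ⟨a, ha, b, hb, h1, h2, h3⟩ := htwo w hw hk
          exact ⟨a, Or.inl ha, b, Or.inl hb, h1.1, h2.1, h3⟩
      · exact hcore w hw
    have hus : Supp adj u := ((hUC u huU).keep_or_supp).resolve_left huX
    -- A suppressed vertex has only two core neighbours, so these are the two found in `U`, along
    -- edges that were not set aside. Hence `U` absorbs the whole component, including `ρ u`,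
    -- although the edge from `ρ u` to `α u` was set aside.
    have hnb : ∀ v ∈ U, Supp adj v → ∀ x, Core adj x → adj v x → x ∈ U ∧ ¬ sp v x := by
      intro v hv hvs x hx hvx
      obtain ⟨a, ha, b, hb, h1, h2, h3⟩ := htwo v hv fun h => h.2 hvs
      obtain ⟨a', b', _, _, _, _, _, h4⟩ := core_nbrs_of_not_branch hvs.core hvs.1.2.1
      have e1 := h4 a (hUC a ha) h1.1
      have e2 := h4 b (hUC b hb) h2.1
      have e3 := h4 x hx hvx
      have : x = a ∨ x = b := by omega
      rcases this with rfl | rfl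
      · exact ⟨ha, h1.2⟩
      · exact ⟨hb, h2.2⟩
    have hall : ∀ v, Link adj u v → v ∈ U := by
      intro v h
      induction h with
      | refl _ => exact huU
      | step h1 h2 h3 ih => exact (hnb _ ih h1.right _ h3.core h2).1
    have := hnb (ρ u) (hall _ (hρ u hus)) (hρ u hus).right (α u) (hα u hus).2 (hα u hus).1
    exact this.2 ⟨u, hus, Or.inl ⟨rfl, rfl⟩⟩
  obtain ⟨c, hc1, hc2⟩ := exists_coloring_of_peel hr (X := {v | Keep adj v}) hpeel hμ
    (fun a ha b hb hab => hd a b ha hb hab.1)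
  refine ⟨c, hc1, fun a b hab => ?_⟩
  -- All other edges of the class already have the right colours at their ends, so the parity of the
  -- class settles the edge that was set aside.
  have main : ∀ q, Supp adj q → ∀ p : ℕ × ℕ, p ∈ clsPairs n adj q →
      ((p.1 = ρ q ∧ p.2 = α q) ∨ (p.2 = ρ q ∧ p.1 = α q)) → μ p.1 p.2 = c p.1 + c p.2 := by
    intro q hq p hp hpq
    have h0 : ∑ p ∈ clsPairs n adj q, (μ p.1 p.2 + (c p.1 + c p.2)) = 0 := by
      rw [Finset.sum_add_distrib, hpar q hq, hG.sum_cls]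
      have : ∑ w ∈ bdry n adj q, c w = ∑ w ∈ bdry n adj q, d w :=
        Finset.sum_congr rfl fun w hw => hc1 w (hG.mem_bdry.1 hw).1
      rw [this, CharTwo.add_self_eq_zero]
    rw [Finset.sum_eq_single_of_mem p hp] at h0
    · exact CharTwo.add_eq_zero.1 h0
    · intro p' hp' hne
      obtain ⟨hlt', hcls'⟩ := hG.mem_clsPairs.1 hp'
      obtain ⟨hlt, _⟩ := hG.mem_clsPairs.1 hp
      by_cases hs : sp p'.1 p'.2
      · exfalso
        obtain ⟨q', hq', hs⟩ := hs
        have hl : Link adj q (ρ q') := by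
          have : Cls adj q (ρ q') (α q') := by
            rcases hs with ⟨h1, h2⟩ | ⟨h1, h2⟩
            · rw [← h1, ← h2]; exact hcls'
            · rw [← h1, ← h2]; exact hG.cls_symm hcls'
          rcases hG.cls_ends this with h | ⟨h, _⟩
          · exact h
          · exact absurd (hρ q' hq').right h.1.2
        have hl' : Link adj q q' := hl.trans (hG.link_symm (hρ q' hq'))
        rw [← hρeq q q' hl', ← hαeq q q' hl'] at hs
        apply hne
        rcases hs with ⟨h1, h2⟩ | ⟨h1, h2⟩ <;> rcases hpq with ⟨h3, h4⟩ | ⟨h3, h4⟩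
        · exact Prod.ext (h1.trans h3.symm) (h2.trans h4.symm)
        · omega
        · omega
        · exact Prod.ext (h2.trans h4.symm) (h1.trans h3.symm)
      · rw [hc2 _ _ ⟨hcls'.1, hs⟩, CharTwo.add_self_eq_zero]
  by_cases hs : sp a b
  · obtain ⟨q, hq, hs⟩ := hs
    have hcls : Cls adj q a b := by
      rcases hs with ⟨rfl, rfl⟩ | ⟨rfl, rfl⟩
      · exact cls_of_link (hρ q hq) (hα q hq).2 hab
      · exact hG.cls_symm (cls_of_link (hρ q hq) (hα q hq).2 (hG.symm hab))
    rcases lt_or_gt_of_ne (hG.ne hab) with hlt | hlt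
    · exact main q hq (a, b) (hG.mem_clsPairs.2 ⟨hlt, hcls⟩) hs
    · rw [hμ, add_comm]
      exact main q hq (b, a) (hG.mem_clsPairs.2 ⟨hlt, hG.cls_symm hcls⟩) hs.symm
  · exact hc2 a b ⟨hab, hs⟩

end Graph
end EnumKernel

namespace EnumKernel

/-! ## The kernel graph and the fibres of its solutions -/

/-- `m` is the edge set of a matching cut, as a symmetric relation. -/
def IsCut (n : ℕ) (adj m : ℕ → ℕ → Prop) : Prop :=
  (∀ i j k, m i j → m i k → j = k) ∧
    ∃ c : ℕ → ZMod 2, (∃ i < n, ∃ j < n, c i ≠ c j) ∧ ∀ i j, m i j ↔ adj i j ∧ c i ≠ c j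

/-- The graph is not connected. -/
def Disc (n : ℕ) (adj : ℕ → ℕ → Prop) : Prop := ∃ v < n, ¬ Relation.ReflTransGen adj 0 v

open Classical in
/-- Number of the first of the three kernel vertices for a kept vertex. -/
noncomputable def rk (adj : ℕ → ℕ → Prop) (w : ℕ) : ℕ :=
  3 * ((Finset.range w).filter (Keep adj)).card

/-- The kernel gets two additional isolated vertices. -/
def AddTwo (n : ℕ) (adj : ℕ → ℕ → Prop) : Prop :=
  2 ≤ n ∧ ∃ v < n, ¬ Keep adj v ∧ (¬ Core adj v ∨ n ≠ 3)

open Classical in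
/-- Number of vertices of the kernel. -/
noncomputable def kerSize (n : ℕ) (adj : ℕ → ℕ → Prop) : ℕ :=
  rk adj n + if AddTwo n adj then 2 else 0

/-- The two boundary vertices of a component. -/
def Virt (adj : ℕ → ℕ → Prop) (w w' : ℕ) : Prop :=
  w ≠ w' ∧ ∃ q, Bdry adj q w ∧ Bdry adj q w'

/-- Adjacency in the kernel: every kept vertex becomes a triangle, the edges between kept vertices
join the first vertices of the triangles, and the two boundary vertices of a component are joined
by their second vertices. -/
def KerAdj (adj : ℕ → ℕ → Prop) (h h' : ℕ) : Prop :=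
  (h ≠ h' ∧ ∃ w, Keep adj w ∧ (rk adj w ≤ h ∧ h < rk adj w + 3) ∧ rk adj w ≤ h' ∧
      h' < rk adj w + 3) ∨
    (∃ w w', Keep adj w ∧ Keep adj w' ∧ adj w w' ∧ h = rk adj w ∧ h' = rk adj w') ∨
    ∃ w w', Virt adj w w' ∧ h = rk adj w + 1 ∧ h' = rk adj w' + 1

/-- The kernel solution `ms` cuts the virtual edge of the component of `q`. -/
def Target (adj ms : ℕ → ℕ → Prop) (q : ℕ) : Prop :=
  ∃ w w', w ≠ w' ∧ Bdry adj q w ∧ Bdry adj q w' ∧ ms (rk adj w + 1) (rk adj w' + 1)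

/-- The edge sets `m` that are listed for the kernel solution `ms`. -/
structure Fibre (n : ℕ) (adj ms m : ℕ → ℕ → Prop) : Prop where
  symm : ∀ i j, m i j → m j i
  sub : ∀ i j, m i j → adj i j
  matching : ∀ i j k, m i j → m i k → j = k
  keep : ∀ w w', Keep adj w → Keep adj w' → adj w w' → (m w w' ↔ ms (rk adj w) (rk adj w'))
  odd : ∀ q, Supp adj q → (Odd {p | p ∈ clsPairs n adj q ∧ m p.1 p.2}.ncard ↔ Target adj ms q)
  nontrivial : (∃ i j, m i j) ∨ Disc n adj

/-! ### Kernel colourings and the partition of the solutions into fibres -/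

section

variable {n : ℕ} {adj m ms : ℕ → ℕ → Prop}

theorem IsCut.symm (hG : IsGraph n adj) (h : IsCut n adj m) {i j : ℕ} (hm : m i j) : m j i := by
  obtain ⟨_, c, _, hc⟩ := h
  exact (hc j i).2 ⟨hG.symm ((hc i j).1 hm).1, ((hc i j).1 hm).2.symm⟩

theorem zmod_two_eq {a b c : ZMod 2} (h : a ≠ b) (h' : a ≠ c) : b = c := by
  revert a b c; decide

/-- The vertices of a triangle have the same colour. -/
theorem color_triangle (hm : ∀ i j k, m i j → m i k → j = k) {c : ℕ → ZMod 2}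
    (hc : ∀ i j, m i j ↔ adj i j ∧ c i ≠ c j) {u v w : ℕ} (huv : adj u v) (huw : adj u w)
    (hvw : adj v w) (hvu : adj v u) (hne : v ≠ w) (hne' : u ≠ w) : c u = c v := by
  by_contra h
  by_cases h' : c u = c w
  · have h1 : c v ≠ c w := fun e => h (h'.trans e.symm)
    exact hne' (hm v u w ((hc _ _).2 ⟨hvu, fun e => h e.symm⟩) ((hc _ _).2 ⟨hvw, h1⟩))
  · exact hne (hm u v w ((hc _ _).2 ⟨huv, h⟩) ((hc _ _).2 ⟨huw, h'⟩))

/-- The blocks of three numbers given to different kept vertices are disjoint and ordered like these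
vertices. -/
theorem rk_add_le {w w' : ℕ} (hw : Keep adj w) (h : w < w') : rk adj w + 3 ≤ rk adj w' := by
  classical
  have : (insert w ((Finset.range w).filter (Keep adj))) ⊆ (Finset.range w').filter (Keep adj) := by
    intro u hu
    rcases Finset.mem_insert.1 hu with rfl | hu
    · simpa using ⟨h, hw⟩
    · have := Finset.mem_filter.1 hu
      simp only [Finset.mem_range] at this
      simpa using ⟨this.1.trans h, this.2⟩
  have h2 := Finset.card_le_card this
  rw [Finset.card_insert_of_notMem (by simp)] at h2
  have : rk adj w = 3 * ((Finset.range w).filter (Keep adj)).card := by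
    rw [rk]
  have : rk adj w' = 3 * ((Finset.range w').filter (Keep adj)).card := by
    rw [rk]
  omega

theorem rk_decode {w w' h : ℕ} (hw : Keep adj w) (hw' : Keep adj w')
    (h1 : rk adj w ≤ h ∧ h < rk adj w + 3) (h2 : rk adj w' ≤ h ∧ h < rk adj w' + 3) : w = w' := by
  rcases lt_trichotomy w w' with h3 | h3 | h3
  · have := rk_add_le hw h3; omega
  · exact h3
  · have := rk_add_le hw' h3; omega

theorem rk_inj {w w' : ℕ} (hw : Keep adj w) (hw' : Keep adj w') (h : rk adj w = rk adj w') :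
    w = w' := rk_decode hw hw' ⟨le_rfl, by omega⟩ ⟨h.ge, by omega⟩

/-- The blocks leave no gaps, so every kernel vertex other than the two extra ones belongs to a
triangle. -/
theorem exists_rk {k h : ℕ} (hh : h < rk adj k) :
    ∃ w < k, Keep adj w ∧ rk adj w ≤ h ∧ h < rk adj w + 3 := by
  induction k with
  | zero => simp [rk] at hh
  | succ k ih =>
    by_cases h1 : h < rk adj k
    · obtain ⟨w, hw, h2⟩ := ih h1
      exact ⟨w, by omega, h2⟩
    · by_cases hk : Keep adj k
      · refine ⟨k, by omega, hk, by omega, ?_⟩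
        simp only [rk, Finset.range_add_one, Finset.filter_insert, hk, if_true] at hh ⊢
        rw [Finset.card_insert_of_notMem (by simp)] at hh
        omega
      · exfalso
        apply h1
        simpa only [rk, Finset.range_add_one, Finset.filter_insert, hk, if_false] using hh

theorem Core.lt (hG : IsGraph n adj) {v : ℕ} (h : Core adj v) : v < n := by
  obtain ⟨a, _, _, _, ha, _⟩ := h.two
  exact hG.lt ha

theorem rk_add_le_size (hG : IsGraph n adj) {w : ℕ} (hw : Keep adj w) :
    rk adj w + 3 ≤ rk adj n := rk_add_le hw (hw.1.lt hG)

theorem rk_le_kerSize : rk adj n ≤ kerSize n adj := Nat.le_add_right _ _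

/-- The only suppressed neighbour of `w` belongs to both components. -/
theorem IsGraph.link_of_bdry (hG : IsGraph n adj) {q q' w : ℕ} (h : Bdry adj q w)
    (h' : Bdry adj q' w) : Link adj q q' := by
  obtain ⟨hk, v, hv, hwv⟩ := h
  obtain ⟨_, v', hv', hwv'⟩ := h'
  rw [hG.keep_unique hk hv'.right hv.right hwv' hwv] at hv'
  exact hv.trans (hG.link_symm hv')

theorem Bdry.of_link {p q w : ℕ} (h : Link adj p q) (h' : Bdry adj q w) : Bdry adj p w :=
  ⟨h'.1, h'.2.imp fun _ hv => ⟨h.trans hv.1, hv.2⟩⟩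

theorem Bdry.supp {q w : ℕ} (h : Bdry adj q w) : Supp adj q := by
  obtain ⟨_, v, hv, _⟩ := h
  exact hv.left

theorem IsGraph.bdry_pair (hG : IsGraph n adj) {q a b x y : ℕ} (ha : Bdry adj q a)
    (hb : Bdry adj q b) (hab : a ≠ b) (hx : Bdry adj q x) (hy : Bdry adj q y) (hxy : x ≠ y) :
    (x = a ∧ y = b) ∨ (x = b ∧ y = a) := by
  rcases hG.bdry_cases ha.supp with h | ⟨w, w', _, h⟩
  · have := hG.mem_bdry.2 ha
    simp [h] at this
  · have h1 := hG.mem_bdry.2 ha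
    have h2 := hG.mem_bdry.2 hb
    have h3 := hG.mem_bdry.2 hx
    have h4 := hG.mem_bdry.2 hy
    simp only [h, Finset.mem_insert, Finset.mem_singleton] at h1 h2 h3 h4
    omega

/-- A kept vertex is on the boundary of at most one component, and that boundary has only one other
vertex. So the virtual edges form a matching in the kernel. -/
theorem IsGraph.virt_unique (hG : IsGraph n adj) {w a b : ℕ} (ha : Virt adj w a)
    (hb : Virt adj w b) : a = b := by
  obtain ⟨h1, q, h2, h3⟩ := ha
  obtain ⟨h4, q', h5, h6⟩ := hb
  have hl := hG.link_of_bdry h2 h5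
  rcases hG.bdry_pair h2 h3 h1 h2 (h6.of_link hl) h4 with h | h
  · exact h.2.symm
  · exact absurd h.2.symm h4

theorem IsGraph.kerAdj (hG : IsGraph n adj) : IsGraph (kerSize n adj) (KerAdj adj) where
  symm := by
    rintro i j (⟨h1, w, h2, h3, h4⟩ | ⟨w, w', h1, h2, h3, h4, h5⟩ | ⟨w, w', ⟨h1, q, h2, h3⟩, h4, h5⟩)
    · exact Or.inl ⟨h1.symm, w, h2, h4, h3⟩
    · exact Or.inr (Or.inl ⟨w', w, h2, h1, hG.symm h3, h5, h4⟩)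
    · exact Or.inr (Or.inr ⟨w', w, ⟨h1.symm, q, h3, h2⟩, h5, h4⟩)
  irrefl := by
    rintro i (⟨h1, _⟩ | ⟨w, w', h1, h2, h3, h4, h5⟩ | ⟨w, w', ⟨h1, q, h2, h3⟩, h4, h5⟩)
    · exact h1 rfl
    · exact hG.ne h3 (rk_inj h1 h2 (h4.symm.trans h5))
    · exact h1 (rk_inj h2.1 h3.1 (by omega))
  lt := by
    rintro i j (⟨h1, w, h2, h3, h4⟩ | ⟨w, w', h1, h2, h3, h4, h5⟩ | ⟨w, w', ⟨h1, q, h2, h3⟩, h4, h5⟩)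
    · have := rk_add_le_size hG h2
      have := rk_le_kerSize (n := n) (adj := adj)
      omega
    · have := rk_add_le_size hG h1
      have := rk_le_kerSize (n := n) (adj := adj)
      omega
    · have := rk_add_le_size hG h2.1
      have := rk_le_kerSize (n := n) (adj := adj)
      omega

theorem kerAdj_triangle {w a b : ℕ} (hw : Keep adj w) (ha : a < 3) (hb : b < 3) (hab : a ≠ b) :
    KerAdj adj (rk adj w + a) (rk adj w + b) :=
  Or.inl ⟨by omega, w, hw, ⟨by omega, by omega⟩, by omega, by omega⟩

/-- A triangle has no matching cut. A kernel solution therefore amounts to a colouring of the kept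
vertices, together with the colours of the extra vertices. -/
theorem color_triangle_ker {c : ℕ → ZMod 2} (hm : ∀ i j k, ms i j → ms i k → j = k)
    (hc : ∀ i j, ms i j ↔ KerAdj adj i j ∧ c i ≠ c j) {w a : ℕ} (hw : Keep adj w) (ha : a < 3) :
    c (rk adj w + a) = c (rk adj w) := by
  have key : ∀ x y z, x < 3 → y < 3 → z < 3 → x ≠ y → y ≠ z → x ≠ z →
      c (rk adj w + x) = c (rk adj w + y) := fun x y z hx hy hz h1 h2 h3 =>
    color_triangle hm hc (kerAdj_triangle hw hx hy h1) (kerAdj_triangle hw hx hz h3)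
      (kerAdj_triangle hw hy hz h2) (kerAdj_triangle hw hy hx h1.symm) (by omega) (by omega)
  have : a = 0 ∨ a = 1 ∨ a = 2 := by omega
  rcases this with rfl | rfl | rfl
  · rfl
  · exact key 1 0 2 (by omega) (by omega) (by omega) (by omega) (by omega) (by omega)
  · exact key 2 0 1 (by omega) (by omega) (by omega) (by omega) (by omega) (by omega)

open Classical in
theorem ncard_filter_odd (F : Finset (ℕ × ℕ)) :
    Odd {p | p ∈ F ∧ m p.1 p.2}.ncard ↔ ∑ p ∈ F, (if m p.1 p.2 then (1 : ZMod 2) else 0) ≠ 0 := by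
  have h1 : {p | p ∈ F ∧ m p.1 p.2} = (F.filter fun p => m p.1 p.2 : Finset (ℕ × ℕ)) := by
    ext p; simp
  rw [h1, Set.ncard_coe_finset, Finset.sum_boole, ← Nat.not_even_iff_odd, ne_eq,
    ZMod.natCast_eq_zero_iff_even]

/-- For a boundary of two vertices the sum is nonzero exactly if their colours differ, that is, if
the virtual edge is cut. A component without boundary has no virtual edge, and the sum is empty. -/
theorem IsGraph.target_iff (hG : IsGraph n adj) (hms : IsCut (kerSize n adj) (KerAdj adj) ms)
    {d : ℕ → ZMod 2} (hd : ∀ w w', Virt adj w w' →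
      (ms (rk adj w + 1) (rk adj w' + 1) ↔ d w ≠ d w')) {q : ℕ} (hq : Supp adj q) :
    Target adj ms q ↔ ∑ w ∈ bdry n adj q, d w ≠ 0 := by
  rcases hG.bdry_cases hq with h | ⟨w, w', hne, h⟩
  · rw [h]
    simp only [Finset.sum_empty, ne_eq, not_true_eq_false, iff_false]
    rintro ⟨w, _, _, hw, _⟩
    have := hG.mem_bdry.2 hw
    simp [h] at this
  · have hw : Bdry adj q w := hG.mem_bdry.1 (by simp [h])
    have hw' : Bdry adj q w' := hG.mem_bdry.1 (by simp [h])
    rw [h, Finset.sum_pair hne, ne_eq, CharTwo.add_eq_zero, ← ne_eq,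
      ← hd w w' ⟨hne, q, hw, hw'⟩]
    constructor
    · rintro ⟨x, y, hxy, hx, hy, hs⟩
      rcases hG.bdry_pair hw hw' hne hx hy hxy with ⟨rfl, rfl⟩ | ⟨rfl, rfl⟩
      · exact hs
      · exact hms.symm hG.kerAdj hs
    · exact fun hs => ⟨w, w', hne, hw, hw', hs⟩

/-- The fibres consist of matching cuts. -/
theorem Fibre.isCut (hG : IsGraph n adj) (hms : IsCut (kerSize n adj) (KerAdj adj) ms)
    (h : Fibre n adj ms m) : IsCut n adj m := by
  classical
  refine ⟨h.matching, ?_⟩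
  by_cases hne : ∃ i j, m i j
  -- For nonempty `m` the kernel colours of the kept vertices are extended by
  -- `IsGraph.exists_coloring`, with the indicator of `m` as prescribed cut; a cut edge shows that
  -- the colouring is not constant.
  · have hms' := hms
    obtain ⟨hmat, cs, _, hcs⟩ := hms'
    let μ : ℕ → ℕ → ZMod 2 := fun i j => if m i j then 1 else 0
    have hμ : ∀ i j, μ i j = μ j i := by
      intro i j
      have : m i j ↔ m j i := ⟨h.symm i j, h.symm j i⟩
      simp only [μ, this]
    have hind : ∀ {P : Prop} [Decidable P] (a b : ZMod 2), (P ↔ a ≠ b) →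
        (if P then (1 : ZMod 2) else 0) = a + b := by
      intro P _ a b hP
      simp only [hP]
      clear hP
      revert a b
      decide
    have hd : ∀ a b, Keep adj a → Keep adj b → adj a b →
        μ a b = cs (rk adj a) + cs (rk adj b) := by
      intro a b ha hb hab
      apply hind
      rw [h.keep a b ha hb hab, hcs]
      exact and_iff_right (Or.inr (Or.inl ⟨a, b, ha, hb, hab, rfl, rfl⟩))
    have hpar : ∀ q, Supp adj q →
        ∑ p ∈ clsPairs n adj q, μ p.1 p.2 = ∑ w ∈ bdry n adj q, cs (rk adj w) := by
      intro q hq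
      have h1 := h.odd q hq
      rw [ncard_filter_odd, hG.target_iff hms (d := fun w => cs (rk adj w)) ?_ hq] at h1
      · have h2 : ∀ a b : ZMod 2, (a ≠ 0 ↔ b ≠ 0) → a = b := by decide
        exact h2 _ _ h1
      · intro w w' hv
        obtain ⟨_, q, hw, hw'⟩ := id hv
        rw [hcs, color_triangle_ker hmat hcs hw.1 (by omega),
          color_triangle_ker hmat hcs hw'.1 (by omega)]
        exact and_iff_right (Or.inr (Or.inr ⟨w, w', hv, rfl, rfl⟩))
    obtain ⟨c, _, hc⟩ := hG.exists_coloring hμ hd hpar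
    have hmc : ∀ i j, m i j ↔ adj i j ∧ c i ≠ c j := by
      intro i j
      constructor
      · intro hm
        have h1 := hc i j (h.sub i j hm)
        simp only [μ, hm, if_true] at h1
        refine ⟨h.sub i j hm, fun e => ?_⟩
        rw [e, CharTwo.add_self_eq_zero] at h1
        exact one_ne_zero h1
      · rintro ⟨ha, hne⟩
        have h1 := hc i j ha
        by_contra hm
        simp only [μ, hm, if_false] at h1
        exact hne (CharTwo.add_eq_zero.1 h1.symm)
    obtain ⟨i, j, hij⟩ := hne
    have h1 := (hmc i j).1 hij
    exact ⟨c, ⟨i, hG.lt h1.1, j, hG.lt' h1.1, h1.2⟩, hmc⟩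
  -- The empty set is a matching cut of a disconnected graph: one side is the component of the
  -- vertex `0`.
  · obtain ⟨v, hv, hvr⟩ := h.nontrivial.resolve_left hne
    refine ⟨fun i => if Relation.ReflTransGen adj 0 i then 1 else 0, ⟨0, by omega, v, hv, ?_⟩, ?_⟩
    · simp [hvr, Relation.ReflTransGen.refl]
    · intro i j
      constructor
      · exact fun hm => absurd ⟨i, j, hm⟩ hne
      · rintro ⟨hij, hc⟩
        exfalso
        apply hc
        have : Relation.ReflTransGen adj 0 i ↔ Relation.ReflTransGen adj 0 j :=
          ⟨fun h => h.tail hij, fun h => h.tail (hG.symm hij)⟩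
        simp only [this]

/-- Fibres of different solutions are disjoint. -/
theorem Fibre.unique (hG : IsGraph n adj) {ms' : ℕ → ℕ → Prop}
    (hms : IsCut (kerSize n adj) (KerAdj adj) ms) (hms' : IsCut (kerSize n adj) (KerAdj adj) ms')
    (h : Fibre n adj ms m) (h' : Fibre n adj ms' m) : ms = ms' := by
  have key : ∀ {ms ms' : ℕ → ℕ → Prop}, IsCut (kerSize n adj) (KerAdj adj) ms →
      IsCut (kerSize n adj) (KerAdj adj) ms' → Fibre n adj ms m → Fibre n adj ms' m →
      ∀ i j, ms i j → ms' i j := by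
    intro ms ms' hms hms' h h' i j hij
    obtain ⟨hmat, c, _, hc⟩ := hms
    obtain ⟨hadj, hne⟩ := (hc i j).1 hij
    -- Triangle edges are never cut, edges between first vertices are determined by `Fibre.keep`,
    -- and virtual edges by the parities in `Fibre.odd`.
    rcases hadj with ⟨h1, w, h2, h3, h4⟩ | ⟨w, w', h1, h2, h3, rfl, rfl⟩ |
      ⟨w, w', ⟨h1, q, h2, h3⟩, rfl, rfl⟩
    · exfalso
      apply hne
      have h5 := color_triangle_ker hmat hc h2 (show i - rk adj w < 3 by omega)
      have h6 := color_triangle_ker hmat hc h2 (show j - rk adj w < 3 by omega)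
      rw [Nat.add_sub_cancel' h3.1] at h5
      rw [Nat.add_sub_cancel' h4.1] at h6
      rw [h5, h6]
    · rw [← h'.keep w w' h1 h2 h3, h.keep w w' h1 h2 h3]
      exact hij
    · have h4 : Target adj ms' q := by
        rw [← h'.odd q h2.supp, h.odd q h2.supp]
        exact ⟨w, w', h1, h2, h3, hij⟩
      obtain ⟨x, y, hxy, hx, hy, hs⟩ := h4
      rcases hG.bdry_pair h2 h3 h1 hx hy hxy with ⟨rfl, rfl⟩ | ⟨rfl, rfl⟩
      · exact hs
      · exact hms'.symm hG.kerAdj hs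
  funext i j
  exact propext ⟨key hms hms' h h' i j, key hms' hms h' h i j⟩

/-- Suppressed vertices come in adjacent pairs, and on three vertices a kept vertex would be
adjacent to both vertices of such a pair, against `IsGraph.keep_unique`. Hence the graph is a
triangle of suppressed vertices. -/
theorem exists_keep_lt_of_supp (hG : IsGraph n adj) {v : ℕ} (hv : Supp adj v) (h3 : n = 3) :
    ∀ w, ¬ Keep adj w := by
  intro w hw
  obtain ⟨u, hvu, hu⟩ := hv.2
  have hus : Supp adj u := ⟨hu, v, hG.symm hvu, hv.1⟩
  obtain ⟨a, b, ha, hb, h1, h2, h4, h5⟩ := core_nbrs_of_not_branch hv.core hv.1.2.1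
  obtain ⟨a', b', ha', hb', h1', h2', h4', h5'⟩ := core_nbrs_of_not_branch hu.1 hu.2.1
  have e1 := ha.lt hG
  have e2 := hb.lt hG
  have e1' := ha'.lt hG
  have e2' := hb'.lt hG
  have e3 := hv.core.lt hG
  have e4 := hu.1.lt hG
  have e5 := hw.1.lt hG
  have n1 := hG.ne h1
  have n2 := hG.ne h2
  have n1' := hG.ne h1'
  have n2' := hG.ne h2'
  have n3 := hG.ne hvu
  have w1 : w ≠ u := by rintro rfl; exact hw.2 hus
  have w2 : w ≠ v := by rintro rfl; exact hw.2 hv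
  have hvw : adj v w := by
    have : w = a ∨ w = b := by omega
    rcases this with rfl | rfl <;> assumption
  have huw : adj u w := by
    have : w = a' ∨ w = b' := by omega
    rcases this with rfl | rfl <;> assumption
  exact n3 (hG.keep_unique hw hv hus (hG.symm hvw) (hG.symm huw))

/-- Every matching cut is in some fibre. -/
theorem IsCut.exists_fibre (hG : IsGraph n adj) (h : IsCut n adj m) :
    ∃ ms, IsCut (kerSize n adj) (KerAdj adj) ms ∧ Fibre n adj ms m := by
  classical
  have hsymm : ∀ i j, m i j → m j i := fun i j => h.symm hG
  obtain ⟨hmat, c, ⟨x, hx, y, hy, hxy⟩, hc⟩ := h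
  -- Triangles inherit the colour of their kept vertex. The extra vertices, if present, are `rk adj
  -- n` and `rk adj n + 1`; they get different colours, so the kernel colouring is not constant even
  -- if `c` is constant on the kept vertices.
  let cH : ℕ → ZMod 2 := fun h =>
    if hw : ∃ w, Keep adj w ∧ rk adj w ≤ h ∧ h < rk adj w + 3 then c hw.choose
    else if h = rk adj n then 1 else 0
  have hcH : ∀ w a, Keep adj w → a < 3 → cH (rk adj w + a) = c w := by
    intro w a hw ha
    have hex : ∃ w', Keep adj w' ∧ rk adj w' ≤ rk adj w + a ∧ rk adj w + a < rk adj w' + 3 :=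
      ⟨w, hw, by omega, by omega⟩
    have := rk_decode hex.choose_spec.1 hw hex.choose_spec.2 ⟨by omega, by omega⟩
    simp only [cH, dif_pos hex]
    rw [this]
  have hcH0 : ∀ w, Keep adj w → cH (rk adj w) = c w := fun w hw => hcH w 0 hw (by omega)
  let ms : ℕ → ℕ → Prop := fun i j => KerAdj adj i j ∧ cH i ≠ cH j
  have hcut : IsCut (kerSize n adj) (KerAdj adj) ms := by
    refine ⟨?_, cH, ?_, fun i j => Iff.rfl⟩
    -- Cut kernel edges join first vertices, where the matching property of `m` applies, or second
    -- vertices, where `IsGraph.virt_unique` does; edges of the two kinds have no common end.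
    · have hcases : ∀ i j, ms i j → (∃ w w', Keep adj w ∧ Keep adj w' ∧ m w w' ∧ i = rk adj w ∧
          j = rk adj w') ∨ ∃ w w', Virt adj w w' ∧ i = rk adj w + 1 ∧ j = rk adj w' + 1 := by
        rintro i j ⟨⟨h1, w, h2, h3, h4⟩ | ⟨w, w', h1, h2, h3, rfl, rfl⟩ | h, hne⟩
        · exfalso
          apply hne
          have h5 := hcH w (i - rk adj w) h2 (by omega)
          have h6 := hcH w (j - rk adj w) h2 (by omega)
          rw [Nat.add_sub_cancel' h3.1] at h5
          rw [Nat.add_sub_cancel' h4.1] at h6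
          rw [h5, h6]
        · rw [hcH0 w h1, hcH0 w' h2] at hne
          exact Or.inl ⟨w, w', h1, h2, (hc _ _).2 ⟨h3, hne⟩, rfl, rfl⟩
        · exact Or.inr h
      intro i j k hij hik
      rcases hcases i j hij with ⟨w, w', h1, h2, h3, h4, h5⟩ | ⟨w, w', h1, h2, h3⟩ <;>
      rcases hcases i k hik with ⟨z, z', h1', h2', h3', h4', h5'⟩ | ⟨z, z', h1', h2', h3'⟩
      · have := rk_inj h1 h1' (h4.symm.trans h4')
        subst this
        rw [h5, h5', hmat w w' z' h3 h3']
      · exfalso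
        obtain ⟨_, q, hz, _⟩ := h1'
        have : w = z := rk_decode h1 hz.1 (h := i) ⟨by omega, by omega⟩ ⟨by omega, by omega⟩
        subst this
        omega
      · exfalso
        obtain ⟨_, q, hz, _⟩ := h1
        have : w = z := rk_decode hz.1 h1' (h := i) ⟨by omega, by omega⟩ ⟨by omega, by omega⟩
        subst this
        omega
      · obtain ⟨_, q, hz, _⟩ := id h1
        obtain ⟨_, q', hz', _⟩ := id h1'
        have := rk_inj hz.1 hz'.1 (by omega)
        subst this
        rw [h3, h3', hG.virt_unique h1 h1']
    · by_cases hadd : AddTwo n adj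
      · have hsz : kerSize n adj = rk adj n + 2 := by simp [kerSize, hadd]
        have hno : ∀ h, rk adj n ≤ h → ¬ ∃ w, Keep adj w ∧ rk adj w ≤ h ∧ h < rk adj w + 3 := by
          rintro h hh ⟨w, hw, h1, h2⟩
          have := rk_add_le_size hG hw
          omega
        refine ⟨rk adj n, by omega, rk adj n + 1, by omega, ?_⟩
        simp only [cH, dif_neg (hno _ le_rfl), dif_neg (hno _ (Nat.le_succ _))]
        simp
      · by_cases hall : ∀ v < n, Keep adj v
        · have h1 := rk_add_le_size hG (hall x hx)
          have h2 := rk_add_le_size hG (hall y hy)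
          have h3 := rk_le_kerSize (n := n) (adj := adj)
          refine ⟨rk adj x, by omega, rk adj y, by omega, ?_⟩
          rw [hcH0 x (hall x hx), hcH0 y (hall y hy)]
          exact hxy
        -- If the extra vertices are absent and some vertex is not kept, then the graph has three
        -- vertices, one of them in the core: it is a triangle, and its vertices would all have the
        -- same colour.
        · exfalso
          push Not at hall
          obtain ⟨v, hv, hvk⟩ := hall
          have hn2 : 2 ≤ n := by
            by_contra hlt
            have : x = y := by omega
            exact hxy (this ▸ rfl)
          have hvc : Core adj v ∧ n = 3 := by
            by_contra hcon
            refine hadd ⟨hn2, v, hv, hvk, ?_⟩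
            by_contra h'
            push Not at h'
            exact hcon h'
          obtain ⟨a, b, ha, hb, h1, h2, h3⟩ := hvc.1.two
          have e1 := ha.lt hG
          have e2 := hb.lt hG
          have n1 := hG.ne h1
          have n2 := hG.ne h2
          have hab : adj a b := by
            obtain ⟨a', b', ha', hb', h1', h2', h3'⟩ := ha.two
            have e1' := ha'.lt hG
            have e2' := hb'.lt hG
            have n1' := hG.ne h1'
            have n2' := hG.ne h2'
            have : a' = b ∨ b' = b := by omega
            rcases this with rfl | rfl <;> assumption
          have c1 : c v = c a := color_triangle hmat hc h1 h2 hab (hG.symm h1) h3 n2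
          have c2 : c v = c b := color_triangle hmat hc h2 h1 (hG.symm hab) (hG.symm h2) h3.symm n1
          apply hxy
          have ex : x = v ∨ x = a ∨ x = b := by omega
          have ey : y = v ∨ y = a ∨ y = b := by omega
          rcases ex with rfl | rfl | rfl <;> rcases ey with rfl | rfl | rfl <;>
            simp [← c1, ← c2]
  refine ⟨ms, hcut, hsymm, fun i j hm => ((hc i j).1 hm).1, hmat, ?_, ?_, ?_⟩
  · intro w w' hw hw' hww'
    have : KerAdj adj (rk adj w) (rk adj w') := Or.inr (Or.inl ⟨w, w', hw, hw', hww', rfl, rfl⟩)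
    simp only [ms, this, true_and, hcH0 w hw, hcH0 w' hw', hc, hww']
  · intro q hq
    rw [hG.target_iff hcut (d := c) ?_ hq, ncard_filter_odd, ← hG.sum_cls]
    · have : ∑ p ∈ clsPairs n adj q, (if m p.1 p.2 then (1 : ZMod 2) else 0) =
          ∑ p ∈ clsPairs n adj q, (c p.1 + c p.2) := by
        refine Finset.sum_congr rfl fun p hp => ?_
        have hp' := (hG.mem_clsPairs.1 hp).2.1
        have h1 : m p.1 p.2 ↔ c p.1 ≠ c p.2 := by rw [hc]; exact and_iff_right hp'
        simp only [h1]
        generalize c p.1 = a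
        generalize c p.2 = b
        revert a b
        decide
      rw [this]
    · intro w w' hv
      obtain ⟨_, q, hw, hw'⟩ := id hv
      have : KerAdj adj (rk adj w + 1) (rk adj w' + 1) := Or.inr (Or.inr ⟨w, w', hv, rfl, rfl⟩)
      simp only [ms, this, true_and, hcH w 1 hw.1 (by omega), hcH w' 1 hw'.1 (by omega)]
  -- If `m` is empty, then `c` is constant along edges, so in a connected graph it would be
  -- constant.
  · by_contra hcon
    push Not at hcon
    obtain ⟨hno, hd⟩ := hcon
    have hconst : ∀ v, Relation.ReflTransGen adj 0 v → c v = c 0 := by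
      intro v hv
      induction hv with
      | refl => rfl
      | tail _ h2 ih =>
        rw [← ih]
        by_contra hne
        exact hno _ _ ((hc _ _).2 ⟨h2, fun e => hne e.symm⟩)
    have hr : ∀ v < n, Relation.ReflTransGen adj 0 v := by
      intro v hv
      by_contra h'
      exact hd ⟨v, hv, h'⟩
    exact hxy ((hconst x (hr x hx)).trans (hconst y (hr y hy)).symm)

end

end EnumKernel

namespace EnumKernel

/-! ## Edge sets as sets of codes -/

/-- The vertex `v` is an end of a kept edge in the kernel solution. -/
def Touched (adj ms : ℕ → ℕ → Prop) (v : ℕ) : Prop :=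
  Keep adj v ∧ ∃ u, Keep adj u ∧ adj v u ∧ ms (rk adj v) (rk adj u)

/-- The code `e` of a pair is that of an edge that is not kept and that does not meet the kernel
solution. -/
def Avail (n : ℕ) (adj ms : ℕ → ℕ → Prop) (e : ℕ) : Prop :=
  e / n < e % n ∧ adj (e / n) (e % n) ∧ ¬ (Keep adj (e / n) ∧ Keep adj (e % n)) ∧
    ¬ Touched adj ms (e / n) ∧ ¬ Touched adj ms (e % n)

/-- The pairs with the codes `e` and `f` have a common element. -/
def Meet (n e f : ℕ) : Prop := e / n = f / n ∨ e / n = f % n ∨ e % n = f / n ∨ e % n = f % n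

/-- Number of edges of `S` in the class of `q`. -/
noncomputable def clsCount (n : ℕ) (adj : ℕ → ℕ → Prop) (S : Set ℕ) (q : ℕ) : ℕ :=
  {e | e ∈ S ∧ Cls adj q (e / n) (e % n)}.ncard

/-- The sets of codes that stand for the elements of a fibre. -/
structure Good (n : ℕ) (adj ms : ℕ → ℕ → Prop) (S : Set ℕ) : Prop where
  avail : ∀ e ∈ S, Avail n adj ms e
  disj : ∀ e ∈ S, ∀ f ∈ S, Meet n e f → e = f
  odd : ∀ q, Supp adj q → (Odd (clsCount n adj S q) ↔ Target adj ms q)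

/-- The criterion for a set of codes below `t` to extend to a good set by codes from `t` on. -/
def Extends (n : ℕ) (adj ms : ℕ → ℕ → Prop) (S : Set ℕ) (t : ℕ) : Prop :=
  (∀ e ∈ S, Avail n adj ms e) ∧ (∀ e ∈ S, ∀ f ∈ S, Meet n e f → e = f) ∧
    ∀ q, Supp adj q → (Odd (clsCount n adj S q) ↔ Target adj ms q) ∨
      ∃ f, t ≤ f ∧ Avail n adj ms f ∧ Cls adj q (f / n) (f % n) ∧ ∀ e ∈ S, ¬ Meet n e f

/-- The edge set given by a kernel solution and a set of codes. -/
def cutOf (n : ℕ) (adj ms : ℕ → ℕ → Prop) (S : Set ℕ) (i j : ℕ) : Prop :=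
  (Keep adj i ∧ Keep adj j ∧ adj i j ∧ ms (rk adj i) (rk adj j)) ∨
    ∃ e ∈ S, (e / n = i ∧ e % n = j) ∨ (e / n = j ∧ e % n = i)

/-! ### Good sets of codes and the members of a fibre -/

section

variable {n : ℕ} {adj m ms : ℕ → ℕ → Prop} {S : Set ℕ}

theorem code_ext {e f : ℕ} (h : e / n = f / n) (h' : e % n = f % n) : e = f := by
  rw [← Nat.div_add_mod e n, ← Nat.div_add_mod f n, h, h']

theorem code_div {i j : ℕ} (h : j < n) : (i * n + j) / n = i := by
  rw [Nat.add_comm, Nat.add_mul_div_right _ _ (by omega), Nat.div_eq_of_lt h, Nat.zero_add]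

theorem code_mod {i j : ℕ} (h : j < n) : (i * n + j) % n = j := by
  rw [Nat.add_comm, Nat.add_mul_mod_self_right, Nat.mod_eq_of_lt h]

theorem Avail.lt (hG : IsGraph n adj) {e : ℕ} (h : Avail n adj ms e) : e < n * n := by
  have h1 := hG.lt h.2.1
  have h2 := hG.lt' h.2.1
  have := Nat.div_add_mod e n
  nlinarith

/-- A common end of two class edges lies in both components or, being kept, on both boundaries; in
either case the components agree. So the classes are pairwise vertex-disjoint and their parities can
be corrected independently. -/
theorem IsGraph.cls_meet (hG : IsGraph n adj) {q q' x y z : ℕ} (h : Cls adj q x y)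
    (h' : Cls adj q' x z) : Link adj q q' := by
  rcases hG.cls_ends h with h1 | ⟨h1, _⟩ <;> rcases hG.cls_ends h' with h2 | ⟨h2, _⟩
  · exact h1.trans (hG.link_symm h2)
  · exact absurd h1.right h2.1.2
  · exact absurd h2.right h1.1.2
  · exact hG.link_of_bdry h1 h2

theorem IsGraph.cls_meet_code (hG : IsGraph n adj) {q q' e f : ℕ}
    (h : Cls adj q (e / n) (e % n)) (h' : Cls adj q' (f / n) (f % n)) (hm : Meet n e f) :
    Link adj q q' := by
  rcases hm with h1 | h1 | h1 | h1
  · rw [h1] at h; exact hG.cls_meet h h'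
  · rw [h1] at h; exact hG.cls_meet h (hG.cls_symm h')
  · rw [h1] at h; exact hG.cls_meet (hG.cls_symm h) h'
  · rw [h1] at h; exact hG.cls_meet (hG.cls_symm h) (hG.cls_symm h')

theorem IsGraph.cls_link_iff (hG : IsGraph n adj) {q q' i j : ℕ} (h : Link adj q q') :
    Cls adj q i j ↔ Cls adj q' i j := ⟨.of_link (hG.link_symm h), .of_link h⟩

theorem IsGraph.target_link_iff (hG : IsGraph n adj) {q q' : ℕ} (h : Link adj q q') :
    Target adj ms q ↔ Target adj ms q' :=
  ⟨fun ⟨w, w', h1, h2, h3, h4⟩ =>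
      ⟨w, w', h1, h2.of_link (hG.link_symm h), h3.of_link (hG.link_symm h), h4⟩,
    fun ⟨w, w', h1, h2, h3, h4⟩ => ⟨w, w', h1, h2.of_link h, h3.of_link h, h4⟩⟩

/-- One further edge disjoint from `S` repairs a class of wrong parity. The repairs of different
classes do not meet by `IsGraph.cls_meet_code`, and edges outside the classes are subject to no
parity condition. Conversely, a good extension can only change the parity of a class by an edge that
could serve as its repair. -/
theorem extends_iff (hG : IsGraph n adj) {t : ℕ} (hS : ∀ e ∈ S, e < t) :
    Extends n adj ms S t ↔ ∃ S', Good n adj ms S' ∧ ∀ e < t, (e ∈ S' ↔ e ∈ S) := by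
  constructor
  · rintro ⟨h1, h2, h3⟩
    let Bad : ℕ → Prop := fun q => Supp adj q ∧ ¬ (Odd (clsCount n adj S q) ↔ Target adj ms q)
    -- The candidates for the repair of a class. Their set depends only on the component, hence so
    -- does its infimum, and each bad class is repaired by a single edge.
    let F : ℕ → Set ℕ := fun q =>
      {f | t ≤ f ∧ Avail n adj ms f ∧ Cls adj q (f / n) (f % n) ∧ ∀ e ∈ S, ¬ Meet n e f}
    have hF : ∀ q, Bad q → sInf (F q) ∈ F q := fun q hq =>
      Nat.sInf_mem ((h3 q hq.1).resolve_left hq.2)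
    have hFl : ∀ q q', Link adj q q' → F q = F q' := by
      intro q q' h
      ext f
      simp only [F, hG.cls_link_iff h]
    have hcl : ∀ q q', Link adj q q' → clsCount n adj S q = clsCount n adj S q' := by
      intro q q' h
      simp only [clsCount, hG.cls_link_iff h]
    have hBl : ∀ q q', Link adj q q' → Bad q → Bad q' := by
      rintro q q' h ⟨_, hb⟩
      refine ⟨h.right, ?_⟩
      rwa [← hcl q q' h, ← hG.target_link_iff h]
    refine ⟨S ∪ {f | ∃ q, Bad q ∧ f = sInf (F q)}, ⟨?_, ?_, ?_⟩, ?_⟩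
    · rintro e (he | ⟨q, hq, rfl⟩)
      · exact h1 e he
      · exact (hF q hq).2.1
    · rintro e (he | ⟨q, hq, rfl⟩) f (hf | ⟨q', hq', rfl⟩) hm
      · exact h2 e he f hf hm
      · exact absurd hm ((hF q' hq').2.2.2 e he)
      · refine absurd ?_ ((hF q hq).2.2.2 f hf)
        rcases hm with h | h | h | h
        · exact Or.inl h.symm
        · exact Or.inr (Or.inr (Or.inl h.symm))
        · exact Or.inr (Or.inl h.symm)
        · exact Or.inr (Or.inr (Or.inr h.symm))
      · have := hG.cls_meet_code (hF q hq).2.2.1 (hF q' hq').2.2.1 hm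
        rw [hFl q q' this]
    · intro q hq
      by_cases hb : Bad q
      · have hset : {e | e ∈ S ∪ {f | ∃ q, Bad q ∧ f = sInf (F q)} ∧ Cls adj q (e / n) (e % n)} =
            insert (sInf (F q)) {e | e ∈ S ∧ Cls adj q (e / n) (e % n)} := by
          ext e
          constructor
          · rintro ⟨he | ⟨q', hq', rfl⟩, hc⟩
            · exact Or.inr ⟨he, hc⟩
            · left
              have := hG.cls_meet hc (hF q' hq').2.2.1
              rw [hFl q q' this]
          · rintro (rfl | ⟨he, hc⟩)
            · exact ⟨Or.inr ⟨q, hb, rfl⟩, (hF q hb).2.2.1⟩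
            · exact ⟨Or.inl he, hc⟩
        have hfin : {e | e ∈ S ∧ Cls adj q (e / n) (e % n)}.Finite :=
          (Set.finite_Iio t).subset fun e he => hS e he.1
        have hnot : sInf (F q) ∉ {e | e ∈ S ∧ Cls adj q (e / n) (e % n)} := by
          intro h
          have h4 := hS _ h.1
          have h5 := (hF q hb).1
          omega
        have hcount : clsCount n adj (S ∪ {f | ∃ q, Bad q ∧ f = sInf (F q)}) q =
            clsCount n adj S q + 1 := by
          rw [clsCount, hset, Set.ncard_insert_of_notMem hnot hfin, clsCount]
        rw [hcount, Nat.odd_add_one]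
        have := hb.2
        tauto
      · have hset : {e | e ∈ S ∪ {f | ∃ q, Bad q ∧ f = sInf (F q)} ∧ Cls adj q (e / n) (e % n)} =
            {e | e ∈ S ∧ Cls adj q (e / n) (e % n)} := by
          ext e
          constructor
          · rintro ⟨he | ⟨q', hq', rfl⟩, hc⟩
            · exact ⟨he, hc⟩
            · exact absurd (hBl q' q (hG.link_symm (hG.cls_meet hc (hF q' hq').2.2.1)) hq') hb
          · exact fun ⟨he, hc⟩ => ⟨Or.inl he, hc⟩
        rw [clsCount, hset]
        by_contra h
        exact hb ⟨hq, h⟩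
    · intro e he
      refine ⟨?_, Or.inl⟩
      rintro (h | ⟨q, hq, rfl⟩)
      · exact h
      · have := (hF q hq).1
        omega
  · rintro ⟨S', hS', heq⟩
    have hsub : ∀ e ∈ S, e ∈ S' := fun e he => (heq e (hS e he)).2 he
    refine ⟨fun e he => hS'.avail e (hsub e he),
      fun e he f hf => hS'.disj e (hsub e he) f (hsub f hf), fun q hq => ?_⟩
    by_cases hb : Odd (clsCount n adj S q) ↔ Target adj ms q
    · exact Or.inl hb
    · right
      -- If every candidate meets `S`, then each class edge of `S'` from `t` on coincides with the
      -- edge of `S` that it meets. So `S` and `S'` have the same edges in the class, and the parity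
      -- was right.
      by_contra hcon
      push Not at hcon
      apply hb
      rw [← hS'.odd q hq]
      have : {e | e ∈ S ∧ Cls adj q (e / n) (e % n)} = {e | e ∈ S' ∧ Cls adj q (e / n) (e % n)} := by
        ext e
        refine ⟨fun h => ⟨hsub e h.1, h.2⟩, fun ⟨he, hc⟩ => ⟨?_, hc⟩⟩
        by_cases hlt : e < t
        · exact (heq e hlt).1 he
        · obtain ⟨f, hf, hm⟩ := hcon e (by omega) (hS'.avail e he) hc
          rwa [← hS'.disj f (hsub f hf) e he hm]
      rw [clsCount, this, clsCount]

theorem cutOf_symm (hG : IsGraph n adj) (hms : ∀ i j, ms i j → ms j i) {i j : ℕ}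
    (h : cutOf n adj ms S i j) : cutOf n adj ms S j i := by
  rcases h with ⟨h1, h2, h3, h4⟩ | ⟨e, he, h⟩
  · exact Or.inl ⟨h2, h1, hG.symm h3, hms _ _ h4⟩
  · exact Or.inr ⟨e, he, h.symm⟩

/-- An edge of a class has a suppressed end, so the edges taken over from the kernel solution do not
contribute. -/
theorem ncard_cutOf (hG : IsGraph n adj) (hav : ∀ e ∈ S, Avail n adj ms e) (q : ℕ) :
    {p : ℕ × ℕ | p ∈ clsPairs n adj q ∧ cutOf n adj ms S p.1 p.2}.ncard = clsCount n adj S q := by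
  have : {p : ℕ × ℕ | p ∈ clsPairs n adj q ∧ cutOf n adj ms S p.1 p.2} =
      (fun e => (e / n, e % n)) '' {e | e ∈ S ∧ Cls adj q (e / n) (e % n)} := by
    ext ⟨i, j⟩
    constructor
    · rintro ⟨hp, hc⟩
      obtain ⟨hlt, hcls⟩ := hG.mem_clsPairs.1 hp
      simp only at hlt hcls hc
      rcases hc with ⟨h1, h2, _⟩ | ⟨e, he, ⟨rfl, rfl⟩ | ⟨rfl, rfl⟩⟩
      · exfalso
        rcases hcls.2.2.2 with h | h
        · exact h1.2 h.right
        · exact h2.2 h.right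
      · exact ⟨e, ⟨he, hcls⟩, rfl⟩
      · have := (hav e he).1
        omega
    · rintro ⟨e, ⟨he, hcls⟩, h⟩
      obtain ⟨rfl, rfl⟩ := Prod.mk.inj h
      exact ⟨hG.mem_clsPairs.2 ⟨(hav e he).1, hcls⟩, Or.inr ⟨e, he, Or.inl ⟨rfl, rfl⟩⟩⟩
  rw [this, Set.ncard_image_of_injective, clsCount]
  intro e f h
  obtain ⟨h1, h2⟩ := Prod.mk.inj h
  exact code_ext h1 h2

theorem Good.fibre (hG : IsGraph n adj) (hms : IsCut (kerSize n adj) (KerAdj adj) ms)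
    (hS : Good n adj ms S) (h : (∃ i j, cutOf n adj ms S i j) ∨ Disc n adj) :
    Fibre n adj ms (cutOf n adj ms S) := by
  have hmsymm : ∀ i j, ms i j → ms j i := fun i j => hms.symm hG.kerAdj
  refine ⟨fun i j => cutOf_symm hG hmsymm, ?_, ?_, ?_, ?_, h⟩
  · rintro i j (⟨_, _, h, _⟩ | ⟨e, he, ⟨rfl, rfl⟩ | ⟨rfl, rfl⟩⟩)
    · exact h
    · exact (hS.avail e he).2.1
    · exact hG.symm (hS.avail e he).2.1
  -- Available edges avoid the touched vertices, so an edge of `S` has no end in common with a kept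
  -- edge of the solution.
  · have hmix : ∀ i j k e, e ∈ S → (Keep adj i ∧ Keep adj j ∧ adj i j ∧ ms (rk adj i) (rk adj j)) →
        ((e / n = i ∧ e % n = k) ∨ (e / n = k ∧ e % n = i)) → False := by
      rintro i j k e he ⟨h1, h2, h3, h4⟩ h
      have ht : Touched adj ms i := ⟨h1, j, h2, h3, h4⟩
      rcases h with ⟨rfl, rfl⟩ | ⟨rfl, rfl⟩
      · exact (hS.avail e he).2.2.2.1 ht
      · exact (hS.avail e he).2.2.2.2 ht
    rintro i j k (h | ⟨e, he, h⟩) (h' | ⟨f, hf, h'⟩)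
    · exact rk_inj h.2.1 h'.2.1 (hms.1 _ _ _ h.2.2.2 h'.2.2.2)
    · exact (hmix i j k f hf h h').elim
    · exact (hmix i k j e he h' h).elim
    · have hm : Meet n e f := by
        unfold Meet
        omega
      have := hS.disj e he f hf hm
      subst this
      have := (hS.avail e he).1
      omega
  · intro w w' hw hw' hww'
    constructor
    · rintro (h | ⟨e, he, ⟨rfl, rfl⟩ | ⟨rfl, rfl⟩⟩)
      · exact h.2.2.2
      · exact absurd ⟨hw, hw'⟩ (hS.avail e he).2.2.1
      · exact absurd ⟨hw', hw⟩ (hS.avail e he).2.2.1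
    · exact fun h => Or.inl ⟨hw, hw', hww', h⟩
  · intro q hq
    rw [ncard_cutOf hG hS.avail, hS.odd q hq]

/-- `S` can be read off from its edge set: discard the edges between kept vertices and take the
codes of increasing pairs. Hence different good sets yield different outputs. -/
theorem Good.mem_iff (hS : Good n adj ms S) {e : ℕ} : e ∈ S ↔ e / n < e % n ∧
    ¬ (Keep adj (e / n) ∧ Keep adj (e % n)) ∧ cutOf n adj ms S (e / n) (e % n) := by
  constructor
  · intro he
    have h := hS.avail e he
    exact ⟨h.1, h.2.2.1, Or.inr ⟨e, he, Or.inl ⟨rfl, rfl⟩⟩⟩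
  · rintro ⟨h1, h2, h3⟩
    rcases h3 with h | ⟨f, hf, ⟨h4, h5⟩ | ⟨h4, h5⟩⟩
    · exact absurd ⟨h.1, h.2.1⟩ h2
    · rwa [← code_ext h4 h5]
    · have := (hS.avail f hf).1
      omega

theorem Good.cutOf_inj {S' : Set ℕ} (hS : Good n adj ms S) (hS' : Good n adj ms S')
    (h : cutOf n adj ms S = cutOf n adj ms S') : S = S' := by
  ext e
  rw [hS.mem_iff, hS'.mem_iff, h]

/-- With `Good.fibre` and `Good.cutOf_inj` this reduces listing a fibre to listing good sets, apart
from the nontriviality condition. The codes are those of the edges of `m` that do not join two kept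
vertices. -/
theorem Fibre.exists_good (hG : IsGraph n adj) (h : Fibre n adj ms m) :
    ∃ S, Good n adj ms S ∧ m = cutOf n adj ms S := by
  let S : Set ℕ := {e | e / n < e % n ∧ m (e / n) (e % n) ∧
    ¬ (Keep adj (e / n) ∧ Keep adj (e % n))}
  have hm : m = cutOf n adj ms S := by
    funext i j
    refine propext ⟨fun hij => ?_, ?_⟩
    · have hadj := h.sub i j hij
      by_cases hk : Keep adj i ∧ Keep adj j
      · exact Or.inl ⟨hk.1, hk.2, hadj, (h.keep i j hk.1 hk.2 hadj).1 hij⟩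
      · right
        have hi := hG.lt hadj
        have hj := hG.lt' hadj
        rcases lt_or_gt_of_ne (hG.ne hadj) with hlt | hlt
        · refine ⟨i * n + j, ?_, Or.inl ⟨code_div hj, code_mod hj⟩⟩
          simp only [S, Set.mem_ofPred_eq, code_div hj, code_mod hj]
          exact ⟨hlt, hij, hk⟩
        · refine ⟨j * n + i, ?_, Or.inr ⟨code_div hi, code_mod hi⟩⟩
          simp only [S, Set.mem_ofPred_eq, code_div hi, code_mod hi]
          exact ⟨hlt, h.symm _ _ hij, fun h' => hk h'.symm⟩
    · rintro (⟨h1, h2, h3, h4⟩ | ⟨e, he, ⟨rfl, rfl⟩ | ⟨rfl, rfl⟩⟩)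
      · exact (h.keep i j h1 h2 h3).2 h4
      · exact he.2.1
      · exact h.symm _ _ he.2.1
  have hav : ∀ e ∈ S, Avail n adj ms e := by
    rintro e ⟨h1, h2, h3⟩
    refine ⟨h1, h.sub _ _ h2, h3, ?_, ?_⟩
    · rintro ⟨h4, u, h5, h6, h7⟩
      have := h.matching _ _ _ h2 ((h.keep _ _ h4 h5 h6).2 h7)
      subst this
      exact h3 ⟨h4, h5⟩
    · rintro ⟨h4, u, h5, h6, h7⟩
      have := h.matching _ _ _ (h.symm _ _ h2) ((h.keep _ _ h4 h5 h6).2 h7)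
      subst this
      exact h3 ⟨h5, h4⟩
  refine ⟨S, ⟨hav, ?_, ?_⟩, hm⟩
  · rintro e ⟨h1, h2, _⟩ f ⟨h1', h2', _⟩ hmeet
    rcases hmeet with h4 | h4 | h4 | h4
    · rw [h4] at h2
      exact code_ext h4 (h.matching _ _ _ h2 h2')
    · rw [h4] at h2
      have := h.matching _ _ _ h2 (h.symm _ _ h2')
      omega
    · rw [h4] at h2
      have := h.matching _ _ _ (h.symm _ _ h2) h2'
      omega
    · rw [h4] at h2
      exact code_ext (h.matching _ _ _ (h.symm _ _ h2) (h.symm _ _ h2')) h4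
  · intro q hq
    rw [← h.odd q hq, ← ncard_cutOf hG hav, ← hm]

/-- The purpose of asking for an inner neighbour in `Supp`: every class contains an edge with both
ends suppressed. -/
theorem Supp.exists_supp (hG : IsGraph n adj) {v : ℕ} (h : Supp adj v) :
    ∃ u, adj v u ∧ Supp adj u := by
  obtain ⟨u, h1, h2⟩ := h.2
  exact ⟨u, h1, h2, v, hG.symm h1, h.1⟩

/-- The empty prefix extends. An edge between two suppressed vertices is available whatever `ms` is,
since only kept vertices are touched, and it can repair its class. -/
theorem exists_good (hG : IsGraph n adj) : ∃ S, Good n adj ms S := by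
  have : Extends n adj ms ∅ 0 := by
    refine ⟨by simp, by simp, fun q hq => Or.inr ?_⟩
    obtain ⟨u, h1, h2⟩ := hq.exists_supp hG
    have key : ∀ a b, a < b → adj a b → Supp adj a → Supp adj b → Cls adj q a b →
        ∃ f, 0 ≤ f ∧ Avail n adj ms f ∧ Cls adj q (f / n) (f % n) ∧ ∀ e ∈ (∅ : Set ℕ),
          ¬ Meet n e f := by
      intro a b hlt hab ha hb hc
      have hbn := hG.lt' hab
      refine ⟨a * n + b, Nat.zero_le _, ?_, ?_, by simp⟩
      · rw [Avail, code_div hbn, code_mod hbn]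
        exact ⟨hlt, hab, fun h => h.1.2 ha, fun h => h.1.2 ha, fun h => h.1.2 hb⟩
      · rw [code_div hbn, code_mod hbn]
        exact hc
    have hc := cls_of_link (.refl hq) h2.core h1
    rcases lt_or_gt_of_ne (hG.ne h1) with hlt | hlt
    · exact key q u hlt h1 hq h2 hc
    · exact key u q hlt (hG.symm h1) h2 hq (hG.cls_symm hc)
  obtain ⟨S, hS, _⟩ := (extends_iff hG (by simp)).1 this
  exact ⟨S, hS⟩

/-- Every solution of the kernel has a nonempty fibre. -/
theorem IsCut.fibre_nonempty (hG : IsGraph n adj)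
    (hms : IsCut (kerSize n adj) (KerAdj adj) ms) : ∃ m, Fibre n adj ms m := by
  classical
  obtain ⟨S, hS⟩ := exists_good (ms := ms) hG
  by_cases hne : (∃ i j, cutOf n adj ms S i j) ∨ Disc n adj
  · exact ⟨_, hS.fibre hG hms hne⟩
  -- What remains is a connected graph and a good set that gives no edge at all. Then `ms` cuts
  -- neither kept nor virtual edges, and a nonempty member of the fibre has to be constructed.
  push Not at hne
  obtain ⟨hempty, hconn⟩ := hne
  have hr : ∀ v < n, Relation.ReflTransGen adj 0 v := by
    intro v hv
    by_contra h
    exact hconn ⟨v, hv, h⟩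
  have hkeep : ∀ w w', Keep adj w → Keep adj w' → adj w w' → ¬ ms (rk adj w) (rk adj w') :=
    fun w w' h1 h2 h3 h4 => hempty w w' (Or.inl ⟨h1, h2, h3, h4⟩)
  have htar : ∀ q, Supp adj q → ¬ Target adj ms q := by
    intro q hq
    rw [← hS.odd q hq, ← ncard_cutOf hG hS.avail]
    simp [hempty]
  have hsymr : ∀ {u v}, Relation.ReflTransGen adj u v → Relation.ReflTransGen adj v u := by
    intro u v h
    induction h with
    | refl => exact .refl
    | tail _ h2 ih => exact Relation.ReflTransGen.head (hG.symm h2) ih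
  have hrr : ∀ u < n, ∀ v < n, Relation.ReflTransGen adj u v :=
    fun u hu v hv => (hsymr (hr u hu)).trans (hr v hv)
  by_cases hadd : AddTwo n adj
  · obtain ⟨hn, v, hv, hvk, hvc⟩ := hadd
    -- If the whole graph is its 2-core, two adjacent suppressed vertices `v`, `v₂` are cut off; `a`
    -- and `b` are their other neighbours.
    by_cases hall : ∀ u < n, Core adj u
    · have hvs : Supp adj v := ((hall v hv).keep_or_supp).resolve_left hvk
      have hn3 : n ≠ 3 := hvc.resolve_left fun h => h (hall v hv)
      obtain ⟨v₂, hvv, hvs₂⟩ := hvs.exists_supp hG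
      have other : ∀ x y, Supp adj x → adj x y → ∃ a, a ≠ y ∧ adj x a ∧ ∀ c, adj x c → c = a ∨ c = y := by
        intro x y hx hxy
        obtain ⟨a, b, ha, hb, h1, h2, h3, h4⟩ := core_nbrs_of_not_branch hx.core hx.1.2.1
        have h5 : ∀ c, adj x c → c = a ∨ c = b := fun c hc => h4 c (hall c (hG.lt' hc)) hc
        rcases h5 y hxy with rfl | rfl
        · exact ⟨b, h3.symm, h2, fun c hc => (h5 c hc).symm⟩
        · exact ⟨a, h3, h1, h5⟩
      obtain ⟨a, ha1, ha2, ha3⟩ := other v v₂ hvs hvv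
      obtain ⟨b, hb1, hb2, hb3⟩ := other v₂ v hvs₂ (hG.symm hvv)
      -- A common neighbour would be suppressed by `IsGraph.keep_unique` and close a triangle; by
      -- connectedness the triangle would be the whole graph, which `AddTwo` excludes.
      have hab : a ≠ b := by
        rintro rfl
        have has : Supp adj a := by
          refine ((hall a (hG.lt' ha2)).keep_or_supp).resolve_left fun h => ?_
          exact hG.ne hvv (hG.keep_unique h hvs hvs₂ (hG.symm ha2) (hG.symm hb2))
        obtain ⟨x, y, _, _, h1, h2, h3, h4⟩ := core_nbrs_of_not_branch has.core has.1.2.1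
        have h5 := h4 v (hall v hv) (hG.symm ha2)
        have h6 := h4 v₂ hvs₂.core (hG.symm hb2)
        have hne := hG.ne hvv
        have hcl : ∀ u, Relation.ReflTransGen adj v u → u = v ∨ u = v₂ ∨ u = a := by
          intro u hu
          induction hu with
          | refl => exact Or.inl rfl
          | tail _ hstep ih =>
            rcases ih with rfl | rfl | rfl
            · have := ha3 _ hstep; omega
            · have := hb3 _ hstep; omega
            · have := h4 _ (hall _ (hG.lt' hstep)) hstep
              omega
        have h7 : ∀ u < n, u = v ∨ u = v₂ ∨ u = a := fun u hu => hcl u (hrr v hv u hu)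
        have := hG.lt' hvv
        have := hG.lt' ha2
        have := hG.ne ha2
        apply hn3
        have hset : Finset.range n = {v, v₂, a} := by
          ext u
          simp only [Finset.mem_range, Finset.mem_insert, Finset.mem_singleton]
          exact ⟨h7 u, by rintro (rfl | rfl | rfl) <;> assumption⟩
        have := congrArg Finset.card hset
        rw [Finset.card_range, Finset.card_eq_three.2 ⟨v, v₂, a, hne, by omega, by omega, rfl⟩] at this
        exact this
      -- The cut around `v` and `v₂` consists of two disjoint edges. All kept vertices are on the
      -- other side, so no kept edge is cut and every class has an even number of cut edges.
      let c : ℕ → ZMod 2 := fun i => if i = v ∨ i = v₂ then 1 else 0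
      have hc : ∀ i j, c i ≠ c j ↔ ((i = v ∨ i = v₂) ↔ ¬ (j = v ∨ j = v₂)) := by
        intro i j
        simp only [c]
        by_cases h1 : i = v ∨ i = v₂ <;> by_cases h2 : j = v ∨ j = v₂ <;> simp [h1, h2]
      have hck : ∀ w, Keep adj w → c w = 0 := by
        intro w hw
        simp only [c]
        rw [if_neg]
        rintro (rfl | rfl)
        · exact hw.2 hvs
        · exact hw.2 hvs₂
      refine ⟨fun i j => adj i j ∧ c i ≠ c j, ?_, ?_, ?_, ?_, ?_, ?_⟩
      · exact fun i j h => ⟨hG.symm h.1, h.2.symm⟩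
      · exact fun i j h => h.1
      · rintro i j k ⟨h1, h2⟩ ⟨h3, h4⟩
        rw [hc] at h2 h4
        by_cases hi : i = v ∨ i = v₂
        · have hj := h2.1 hi
          have hk := h4.1 hi
          rcases hi with rfl | rfl
          · have := ha3 j h1
            have := ha3 k h3
            omega
          · have := hb3 j h1
            have := hb3 k h3
            omega
        · by_contra hjk
          have hv1 : adj i v ∧ adj i v₂ := by
            have h5 : j = v ∨ j = v₂ := by
              by_contra h
              exact hi (h2.2 h)
            have h6 : k = v ∨ k = v₂ := by
              by_contra h
              exact hi (h4.2 h)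
            rcases h5 with h5 | h5 <;> rcases h6 with h6 | h6
            · exact absurd (h5.trans h6.symm) hjk
            · exact ⟨h5 ▸ h1, h6 ▸ h3⟩
            · exact ⟨h6 ▸ h3, h5 ▸ h1⟩
            · exact absurd (h5.trans h6.symm) hjk
          have h5 := ha3 i (hG.symm hv1.1)
          have h6 := hb3 i (hG.symm hv1.2)
          have h7 : i ≠ v₂ := fun h => hi (Or.inr h)
          have h8 : i ≠ v := fun h => hi (Or.inl h)
          exact hab ((h5.resolve_right h7).symm.trans (h6.resolve_right h8))
      · intro w w' hw hw' hww'
        constructor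
        · rintro ⟨_, h⟩
          exact absurd ((hck w hw).trans (hck w' hw').symm) h
        · exact fun h => absurd h (hkeep w w' hw hw' hww')
      · intro q hq
        have h0 := hG.sum_cls q c
        rw [Finset.sum_eq_zero fun w hw => hck w (hG.mem_bdry.1 hw).1] at h0
        rw [ncard_filter_odd (m := fun i j => adj i j ∧ c i ≠ c j)]
        refine iff_of_false ?_ (htar q hq)
        rw [not_not]
        refine Eq.trans ?_ h0
        refine Finset.sum_congr rfl fun p hp => ?_
        have h1 : (adj p.1 p.2 ∧ c p.1 ≠ c p.2) ↔ c p.1 ≠ c p.2 :=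
          and_iff_right (hG.mem_clsPairs.1 hp).2.1
        simp only [h1]
        generalize c p.1 = x
        generalize c p.2 = y
        revert x y
        decide
      · refine Or.inl ⟨v, a, ha2, ?_⟩
        rw [hc]
        have := hG.ne ha2
        constructor
        · rintro _ (h | h)
          · exact this h.symm
          · exact ha1 h
        · exact fun _ => Or.inl rfl
    -- An edge at a vertex outside the core belongs to no class and does not join kept vertices, so
    -- by itself it is a member of the fibre.
    · push Not at hall
      obtain ⟨x, hx, hxc⟩ := hall
      have hnbr : ∃ u, adj x u := by
        obtain ⟨y, hy, hxy⟩ : ∃ y < n, y ≠ x := by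
          by_cases h : x = 0
          · exact ⟨1, by omega, by omega⟩
          · exact ⟨0, by omega, by omega⟩
        rcases Relation.ReflTransGen.cases_head (hrr x hx y hy) with h | ⟨u, hu, _⟩
        · exact absurd h.symm hxy
        · exact ⟨u, hu⟩
      obtain ⟨u, hu⟩ := hnbr
      refine ⟨fun i j => (i = x ∧ j = u) ∨ (i = u ∧ j = x), ?_, ?_, ?_, ?_, ?_, ?_⟩
      · exact fun i j h => h.elim (fun h => Or.inr ⟨h.2, h.1⟩) fun h => Or.inl ⟨h.2, h.1⟩
      · rintro i j (⟨rfl, rfl⟩ | ⟨rfl, rfl⟩)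
        · exact hu
        · exact hG.symm hu
      · intro i j k h1 h2
        have := hG.ne hu
        omega
      · intro w w' hw hw' hww'
        refine iff_of_false ?_ (hkeep w w' hw hw' hww')
        rintro (⟨rfl, rfl⟩ | ⟨rfl, rfl⟩)
        · exact hxc hw.1
        · exact hxc hw'.1
      · intro q hq
        refine iff_of_false ?_ (htar q hq)
        have : {p : ℕ × ℕ | p ∈ clsPairs n adj q ∧
            ((p.1 = x ∧ p.2 = u) ∨ (p.1 = u ∧ p.2 = x))} = ∅ := by
          rw [Set.eq_empty_iff_forall_notMem]
          rintro ⟨i, j⟩ ⟨hp, h⟩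
          have hcls := (hG.mem_clsPairs.1 hp).2
          rcases h with ⟨rfl, rfl⟩ | ⟨rfl, rfl⟩
          · exact hxc hcls.2.1
          · exact hxc hcls.2.2.1
        rw [this]
        simp
      · exact Or.inl ⟨x, u, Or.inl ⟨rfl, rfl⟩⟩
  -- Without extra vertices, `ms` gives different colours to two kept vertices. If all vertices are
  -- kept, connectedness yields a kept edge that is cut; otherwise there are three vertices, one of
  -- them suppressed, and none is kept.
  · exfalso
    obtain ⟨hmat, c, ⟨h, hh, h', hh', hne⟩, hc⟩ := hms
    have hsz : kerSize n adj = rk adj n := by simp [kerSize, hadd]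
    rw [hsz] at hh hh'
    obtain ⟨w, hwn, hw, h1, h2⟩ := exists_rk hh
    obtain ⟨w', hwn', hw', h1', h2'⟩ := exists_rk hh'
    have e1 := color_triangle_ker hmat hc hw (show h - rk adj w < 3 by omega)
    have e2 := color_triangle_ker hmat hc hw' (show h' - rk adj w' < 3 by omega)
    rw [Nat.add_sub_cancel' h1] at e1
    rw [Nat.add_sub_cancel' h1'] at e2
    rw [e1, e2] at hne
    by_cases hall : ∀ v < n, Keep adj v
    · have : ∀ v, Relation.ReflTransGen adj w v → c (rk adj v) = c (rk adj w) := by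
        intro v hv
        induction hv with
        | refl => rfl
        | tail _ hs ih =>
          rw [← ih]
          by_contra hcon
          refine hkeep _ _ (hall _ (hG.lt hs)) (hall _ (hG.lt' hs)) hs ((hc _ _).2 ⟨?_, fun e => hcon e.symm⟩)
          exact Or.inr (Or.inl ⟨_, _, hall _ (hG.lt hs), hall _ (hG.lt' hs), hs, rfl, rfl⟩)
      exact hne (this w' (hrr w hwn w' hwn')).symm
    · push Not at hall
      obtain ⟨v, hv, hvk⟩ := hall
      have hww : w ≠ w' := by
        rintro rfl
        exact hne rfl
      have hvc : Core adj v ∧ n = 3 := by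
        by_contra hcon
        refine hadd ⟨by omega, v, hv, hvk, ?_⟩
        by_contra h3
        push Not at h3
        exact hcon h3
      exact exists_keep_lt_of_supp hG ((hvc.1.keep_or_supp).resolve_left hvk) hvc.2 w hw

end

end EnumKernel

namespace EnumKernel

/-! ## The size of the kernel -/

/-- The adjacency relation of a graph on `Fin n`, as a relation on `ℕ`. -/
def natAdj {n : ℕ} (G : SimpleGraph (Fin n)) (i j : ℕ) : Prop :=
  ∃ (hi : i < n) (hj : j < n), G.Adj ⟨i, hi⟩ ⟨j, hj⟩

theorem isGraph_natAdj {n : ℕ} (G : SimpleGraph (Fin n)) : IsGraph n (natAdj G) where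
  symm := fun ⟨hi, hj, h⟩ => ⟨hj, hi, h.symm⟩
  irrefl := fun _ ⟨_, _, h⟩ => G.irrefl h
  lt := fun ⟨hi, _, _⟩ => hi

/-- A forest extends to a spanning tree of the complete graph. The bound without the `-1` also
covers the empty vertex set. -/
theorem card_edgeFinset_le_of_isAcyclic {V : Type*} [Fintype V] {H : SimpleGraph V}
    [Fintype H.edgeSet] (h : H.IsAcyclic) : H.edgeFinset.card ≤ Fintype.card V := by
  classical
  cases isEmpty_or_nonempty V
  · have : H.edgeFinset = ∅ := by
      rw [Finset.eq_empty_iff_forall_notMem]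
      intro e _
      induction e with
      | _ a b => exact isEmptyElim a
    simp [this]
  · obtain ⟨F, hle, _, hF⟩ :=
      (SimpleGraph.connected_top (V := V)).exists_isTree_le_of_le_of_isAcyclic le_top h
    have h1 := hF.card_edgeFinset
    have h2 : H.edgeFinset.card ≤ F.edgeFinset.card :=
      Finset.card_le_card (SimpleGraph.edgeFinset_subset_edgeFinset.2 hle)
    omega

/-- Deleting all edges leaves a forest, so the infimum is over a nonempty set and is attained. -/
theorem feedbackEdgeNumber_spec {V : Type*} [Finite V] (G : SimpleGraph V) :
    ∃ S : Finset (Sym2 V), (G.deleteEdges (S : Set (Sym2 V))).IsAcyclic ∧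
      S.card = feedbackEdgeNumber G := by
  classical
  have := Fintype.ofFinite V
  have hne : {k | ∃ S : Finset (Sym2 V), (S : Set (Sym2 V)) ⊆ G.edgeSet ∧
      (G.deleteEdges (S : Set (Sym2 V))).IsAcyclic ∧ S.card = k}.Nonempty := by
    refine ⟨_, G.edgeFinset, by simp, ?_, rfl⟩
    have : G.deleteEdges (G.edgeFinset : Set (Sym2 V)) = ⊥ := by
      ext a b
      simp
    rw [this]
    exact SimpleGraph.isAcyclic_bot
  obtain ⟨S, _, h1, h2⟩ := Nat.sInf_mem hne
  exact ⟨S, h1, h2⟩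

theorem feedbackEdgeNumber_le {n : ℕ} (G : SimpleGraph (Fin n)) :
    feedbackEdgeNumber G ≤ n * n := by
  classical
  have h1 : feedbackEdgeNumber G ≤ G.edgeFinset.card := by
    refine Nat.sInf_le ⟨G.edgeFinset, by simp, ?_, rfl⟩
    have : G.deleteEdges (G.edgeFinset : Set (Sym2 (Fin n))) = ⊥ := by
      ext a b
      simp
    rw [this]
    exact SimpleGraph.isAcyclic_bot
  have h2 := G.sum_degrees_eq_twice_card_edges
  have h3 : ∑ v, G.degree v ≤ ∑ _v : Fin n, n := Finset.sum_le_sum fun v _ => by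
    have := G.degree_lt_card_verts v
    simp only [Fintype.card_fin] at this
    omega
  simp only [Finset.sum_const, Finset.card_univ, Fintype.card_fin, smul_eq_mul] at h3
  omega

open Classical in
/-- The neighbours of `v` in the 2-core. -/
noncomputable def coreNbrs (n : ℕ) (adj : ℕ → ℕ → Prop) (v : ℕ) : Finset ℕ :=
  (Finset.range n).filter fun u => Core adj u ∧ adj v u

theorem mem_coreNbrs {n : ℕ} {adj : ℕ → ℕ → Prop} (hG : IsGraph n adj) {v u : ℕ} :
    u ∈ coreNbrs n adj v ↔ Core adj u ∧ adj v u := by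
  simp only [coreNbrs, Finset.mem_filter, Finset.mem_range, and_iff_right_iff_imp]
  exact fun h => h.1.lt hG

-- Inside the core, a minimum feedback edge set leaves a forest with at most as many edges as
-- vertices, so the number of core edges exceeds that of core vertices by at most the feedback edge
-- number.
open Classical in
theorem sum_coreNbrs_le {n : ℕ} (G : SimpleGraph (Fin n)) :
    ∑ v ∈ (Finset.range n).filter (Core (natAdj G)), (coreNbrs n (natAdj G) v).card ≤
      2 * ((Finset.range n).filter (Core (natAdj G))).card + 2 * feedbackEdgeNumber G := by
  obtain ⟨S, hS, hk⟩ := feedbackEdgeNumber_spec G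
  set C : Finset ℕ := (Finset.range n).filter (Core (natAdj G)) with hC
  have hCn : ∀ v ∈ C, v < n := fun v hv => Finset.mem_range.1 (Finset.mem_filter.1 hv).1
  let f : C → Fin n := fun v => ⟨v, hCn v v.2⟩
  have hf : Function.Injective f := fun a b h => Subtype.ext (congrArg Fin.val h)
  let G' : SimpleGraph C := G.comap f
  let H : SimpleGraph C := (G.deleteEdges (S : Set (Sym2 (Fin n)))).comap f
  have hH : H.IsAcyclic := hS.of_comap ⟨f, hf⟩
  have hHE := card_edgeFinset_le_of_isAcyclic hH
  rw [Fintype.card_coe] at hHE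
  have hsub : G'.edgeFinset ⊆ H.edgeFinset ∪
      (G'.edgeFinset.filter fun e => e.map f ∈ S) := by
    intro e he
    by_cases h : e.map f ∈ S
    · exact Finset.mem_union_right _ (Finset.mem_filter.2 ⟨he, h⟩)
    · refine Finset.mem_union_left _ ?_
      induction e with
      | _ a b =>
        rw [SimpleGraph.mem_edgeFinset] at he ⊢
        exact SimpleGraph.deleteEdges_adj.2 ⟨he, h⟩
  have hS' : (G'.edgeFinset.filter fun e => e.map f ∈ S).card ≤ S.card :=
    Finset.card_le_card_of_injOn (Sym2.map f) (fun e he => (Finset.mem_filter.1 he).2)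
      (Sym2.map.injective hf).injOn
  have h1 := (Finset.card_le_card hsub).trans (Finset.card_union_le _ _)
  have h2 := G'.sum_degrees_eq_twice_card_edges
  have h3 : ∑ v ∈ C, (coreNbrs n (natAdj G) v).card = ∑ v : C, G'.degree v := by
    rw [← Finset.sum_coe_sort C fun v => (coreNbrs n (natAdj G) v).card]
    refine Finset.sum_congr rfl fun v _ => ?_
    rw [← SimpleGraph.card_neighborFinset_eq_degree,
      ← Finset.card_map (Function.Embedding.subtype _)]
    congr 1
    ext u
    rw [mem_coreNbrs (isGraph_natAdj G)]
    simp only [Finset.mem_map, SimpleGraph.mem_neighborFinset, Function.Embedding.subtype_apply]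
    constructor
    · rintro ⟨hu, hi, hj, h⟩
      exact ⟨⟨u, Finset.mem_filter.2 ⟨Finset.mem_range.2 hj, hu⟩⟩, h, rfl⟩
    · rintro ⟨a, ha, rfl⟩
      exact ⟨(Finset.mem_filter.1 a.2).2, hCn v v.2, hCn a a.2, ha⟩
  omega

/-- The number of kept vertices is linear in the feedback edge number. -/
theorem kerSize_le {n : ℕ} (G : SimpleGraph (Fin n)) :
    kerSize n (natAdj G) ≤ 60 * feedbackEdgeNumber G + 2 := by
  classical
  set adj := natAdj G with hadj
  have hG : IsGraph n adj := isGraph_natAdj G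
  have hsum := sum_coreNbrs_le G
  rw [← hadj] at hsum
  set k := feedbackEdgeNumber G
  set C := (Finset.range n).filter (Core adj) with hC
  have hmC : ∀ {v}, v ∈ C ↔ Core adj v := by
    intro v
    simp only [hC, Finset.mem_filter, Finset.mem_range, and_iff_right_iff_imp]
    exact fun h => h.lt hG
  let d : ℕ → ℕ := fun v => (coreNbrs n adj v).card
  have hd2 : ∀ v ∈ C, 2 ≤ d v := by
    intro v hv
    obtain ⟨a, b, ha, hb, h1, h2, h3⟩ := (hmC.1 hv).two
    have : ({a, b} : Finset ℕ) ⊆ coreNbrs n adj v := by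
      intro x hx
      rw [mem_coreNbrs hG]
      rcases Finset.mem_insert.1 hx with rfl | hx
      · exact ⟨ha, h1⟩
      · rw [Finset.mem_singleton.1 hx]
        exact ⟨hb, h2⟩
    have := Finset.card_le_card this
    rwa [Finset.card_pair h3] at this
  set B := C.filter (Branch adj) with hB
  have hd3 : ∀ v ∈ B, 3 ≤ d v := by
    intro v hv
    obtain ⟨_, a, b, c, h1, h2, h3, h4, h5, h6⟩ := (Finset.mem_filter.1 hv).2
    have : ({a, b, c} : Finset ℕ) ⊆ coreNbrs n adj v := by
      intro x hx
      rw [mem_coreNbrs hG]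
      simp only [Finset.mem_insert, Finset.mem_singleton] at hx
      rcases hx with rfl | rfl | rfl <;> assumption
    have h7 := Finset.card_le_card this
    rwa [Finset.card_eq_three.2 ⟨a, b, c, h4, h5, h6, rfl⟩] at h7
  have hnB : ∀ v ∈ C, v ∉ B → d v ≤ 2 := by
    intro v hv hvB
    have hnb : ¬ Branch adj v := fun h => hvB (Finset.mem_filter.2 ⟨hv, h⟩)
    obtain ⟨a, b, _, _, _, _, _, h⟩ := core_nbrs_of_not_branch (hmC.1 hv) hnb
    have : coreNbrs n adj v ⊆ {a, b} := by
      intro x hx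
      obtain ⟨h1, h2⟩ := (mem_coreNbrs hG).1 hx
      simpa using h x h1 h2
    exact (Finset.card_le_card this).trans Finset.card_le_two
  -- All core degrees are at least two and their excess over two adds up to at most `2 k`. Every
  -- branch vertex contributes at least one.
  have hex : ∑ v ∈ C, (d v - 2) ≤ 2 * k := by
    have h1 : ∑ v ∈ C, (d v - 2) + ∑ v ∈ C, 2 = ∑ v ∈ C, d v := by
      rw [← Finset.sum_add_distrib]
      exact Finset.sum_congr rfl fun v hv => Nat.sub_add_cancel (hd2 v hv)
    rw [Finset.sum_const, smul_eq_mul] at h1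
    change ∑ v ∈ C, d v ≤ _ at hsum
    omega
  have hexB : ∑ v ∈ B, (d v - 2) ≤ 2 * k :=
    (Finset.sum_le_sum_of_subset (Finset.filter_subset _ _)).trans hex
  have hcB : B.card ≤ 2 * k := by
    refine le_trans ?_ hexB
    rw [Finset.card_eq_sum_ones]
    exact Finset.sum_le_sum fun v hv => by have := hd3 v hv; omega
  -- Here `d ≤ 3 (d - 2)` is used, which holds from `d = 3` on.
  have hsB : ∑ v ∈ B, d v ≤ 6 * k := by
    have : ∑ v ∈ B, d v ≤ ∑ v ∈ B, 3 * (d v - 2) :=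
      Finset.sum_le_sum fun v hv => by have := hd3 v hv; omega
    rw [← Finset.mul_sum] at this
    omega
  set L₁ := (B.biUnion (coreNbrs n adj)).filter (· ∉ B) with hL₁
  have hcL₁ : L₁.card ≤ 6 * k :=
    ((Finset.card_le_card (Finset.filter_subset _ _)).trans Finset.card_biUnion_le).trans hsB
  set L₂ := L₁.biUnion (coreNbrs n adj) with hL₂
  have hL₁C : ∀ v ∈ L₁, v ∈ C := by
    intro v hv
    obtain ⟨b, _, hb⟩ := Finset.mem_biUnion.1 (Finset.mem_filter.1 hv).1
    exact hmC.2 ((mem_coreNbrs hG).1 hb).1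
  have hcL₂ : L₂.card ≤ 12 * k := by
    have h1 : L₂.card ≤ ∑ v ∈ L₁, d v := Finset.card_biUnion_le
    have h2 : ∑ v ∈ L₁, d v ≤ ∑ v ∈ L₁, 2 :=
      Finset.sum_le_sum fun v hv => hnB v (hL₁C v hv) (Finset.mem_filter.1 hv).2
    rw [Finset.sum_const, smul_eq_mul] at h2
    omega
  have hL₁of : ∀ v, Core adj v → ¬ Branch adj v → ∀ u, adj v u → Branch adj u → v ∈ L₁ := by
    intro v hv hnb u hvu hu
    refine Finset.mem_filter.2 ⟨Finset.mem_biUnion.2 ⟨u, ?_, ?_⟩, ?_⟩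
    · exact Finset.mem_filter.2 ⟨hmC.2 hu.1, hu⟩
    · exact (mem_coreNbrs hG).2 ⟨hv, hG.symm hvu⟩
    · exact fun h => hnb (Finset.mem_filter.1 h).2
  -- A kept vertex is a branch vertex, has a branch neighbour, or is inner without inner neighbours;
  -- in the last case it has a neighbour in `L₁` and so lies in `L₂`. This gives `2k + 6k + 12k =
  -- 20k` kept vertices, each with three kernel vertices.
  have hsub : (Finset.range n).filter (Keep adj) ⊆ (B ∪ L₁) ∪ L₂ := by
    intro v hv
    have hk := (Finset.mem_filter.1 hv).2
    by_cases hb : Branch adj v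
    · exact Finset.mem_union_left _ (Finset.mem_union_left _
        (Finset.mem_filter.2 ⟨hmC.2 hk.1, hb⟩))
    by_cases hi : Inner adj v
    · refine Finset.mem_union_right _ ?_
      obtain ⟨a, _, ha, _, hva, _⟩ := hk.1.two
      have hna : ¬ Branch adj a := hi.2.2 a hva
      have hia : ¬ Inner adj a := fun h => hk.2 ⟨hi, a, hva, h⟩
      have : ∃ u, adj a u ∧ Branch adj u := by
        by_contra hcon
        push Not at hcon
        exact hia ⟨ha, hna, hcon⟩
      obtain ⟨u, hau, hu⟩ := this
      exact Finset.mem_biUnion.2 ⟨a, hL₁of a ha hna u hau hu,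
        (mem_coreNbrs hG).2 ⟨hk.1, hG.symm hva⟩⟩
    · have : ∃ u, adj v u ∧ Branch adj u := by
        by_contra hcon
        push Not at hcon
        exact hi ⟨hk.1, hb, hcon⟩
      obtain ⟨u, hvu, hu⟩ := this
      exact Finset.mem_union_left _ (Finset.mem_union_right _ (hL₁of v hk.1 hb u hvu hu))
  have h1 := Finset.card_le_card hsub
  have h2 := Finset.card_union_le (B ∪ L₁) L₂
  have h3 := Finset.card_union_le B L₁
  have h4 : rk adj n = 3 * ((Finset.range n).filter (Keep adj)).card := by rw [rk]
  have h5 : kerSize n adj ≤ rk adj n + 2 := by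
    rw [kerSize]
    split_ifs <;> omega
  omega

end EnumKernel

namespace EnumKernel

/-! ## Encodings -/

open Classical in
/-- The matrix of a relation, row by row. -/
noncomputable def encRel (n : ℕ) (m : ℕ → ℕ → Prop) : List Bool :=
  (List.range (n * n)).map fun e => decide (m (e / n) (e % n))

theorem encRel_getD {n : ℕ} {m : ℕ → ℕ → Prop} {i j : ℕ} (hi : i < n) (hj : j < n) :
    (encRel n m).getD (i * n + j) false = true ↔ m i j := by
  have hlt : i * n + j < n * n := by nlinarith
  rw [List.getD_eq_getElem _ _ (by simpa [encRel] using hlt)]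
  simp [encRel, code_div hj, code_mod hj]

/-- The matrix determines the relation on pairs of vertices only; containment in `adj` makes it
false elsewhere. -/
theorem encRel_inj {n : ℕ} {adj m m' : ℕ → ℕ → Prop} (hG : IsGraph n adj)
    (hm : ∀ i j, m i j → adj i j) (hm' : ∀ i j, m' i j → adj i j)
    (h : encRel n m = encRel n m') : m = m' := by
  funext i j
  by_cases hij : i < n ∧ j < n
  · refine propext ((encRel_getD (m := m) hij.1 hij.2).symm.trans ?_)
    rw [h]
    exact encRel_getD hij.1 hij.2
  · refine propext ⟨fun h => ?_, fun h => ?_⟩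
    · exact absurd ⟨hG.lt (hm _ _ h), hG.lt' (hm _ _ h)⟩ hij
    · exact absurd ⟨hG.lt (hm' _ _ h), hG.lt' (hm' _ _ h)⟩ hij

theorem encodeEdges_eq_encRel {n : ℕ} {M : Set (Sym2 (Fin n))} {m : ℕ → ℕ → Prop}
    (h : ∀ a b : Fin n, s(a, b) ∈ M ↔ m a b) : encodeEdges M = encRel n m := by
  refine List.ext_getElem (by simp [encodeEdges, encRel]) fun e h1 h2 => ?_
  simp only [encodeEdges, encRel, List.getElem_ofFn, List.getElem_map, List.getElem_range]
  rw [decide_eq_decide, h]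
  simp [Fin.divNat, Fin.modNat]

/-- The bridge between cuts of graphs on `Fin n` and colourings of `ℕ`. With only two colours, the
complement of the colour class of `x` is again a colour class, so the two notions of cut agree. -/
theorem mem_sol_iff {n : ℕ} (G : SimpleGraph (Fin n)) (w : List Bool) :
    w ∈ encodeEdges '' {M | IsMatchingCut G M} ↔ ∃ m, IsCut n (natAdj G) m ∧ w = encRel n m := by
  classical
  constructor
  · rintro ⟨M, ⟨hM, A, ⟨a, ha⟩, ⟨b, hb⟩, hA⟩, rfl⟩
    let m : ℕ → ℕ → Prop := fun i j => ∃ (hi : i < n) (hj : j < n), s(⟨i, hi⟩, ⟨j, hj⟩) ∈ M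
    refine ⟨m, ⟨?_, fun i => if ∃ h : i < n, ⟨i, h⟩ ∈ A then 1 else 0, ?_, ?_⟩, ?_⟩
    · rintro i j k ⟨hi, hj, h1⟩ ⟨_, hk, h2⟩
      have := hM _ h1 _ h2 ⟨i, hi⟩ (by simp) (by simp)
      simp only [Sym2.eq_iff, Fin.mk.injEq] at this
      omega
    · exact ⟨a, a.2, b, b.2, by simpa [ha] using hb⟩
    · intro i j
      constructor
      · rintro ⟨hi, hj, h⟩
        rw [hA] at h
        obtain ⟨u, hu, v, hv, huv, he⟩ := h
        rcases Sym2.eq_iff.1 he with ⟨rfl, rfl⟩ | ⟨rfl, rfl⟩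
        · exact ⟨⟨hi, hj, huv⟩, by simp [hi, hj, hu, hv]⟩
        · exact ⟨⟨hi, hj, huv.symm⟩, by simp [hi, hj, hu, hv]⟩
      · rintro ⟨⟨hi, hj, h⟩, hne⟩
        refine ⟨hi, hj, ?_⟩
        rw [hA]
        by_cases h1 : (⟨i, hi⟩ : Fin n) ∈ A <;> by_cases h2 : (⟨j, hj⟩ : Fin n) ∈ A
        · simp [hi, hj, h1, h2] at hne
        · exact ⟨_, h1, _, h2, h, rfl⟩
        · exact ⟨_, h2, _, h1, h.symm, Sym2.eq_swap⟩
        · simp [hi, hj, h1, h2] at hne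
    · exact encodeEdges_eq_encRel fun a b => ⟨fun h => ⟨a.2, b.2, h⟩, fun ⟨_, _, h⟩ => h⟩
  · rintro ⟨m, ⟨hmat, c, ⟨x, hx, y, hy, hxy⟩, hc⟩, rfl⟩
    have hsymm : ∀ i j, m i j → m j i := fun i j h => by
      rw [hc] at h ⊢
      exact ⟨(isGraph_natAdj G).symm h.1, h.2.symm⟩
    let A : Set (Fin n) := {a | c a = c x}
    let M : Set (Sym2 (Fin n)) := cutEdges G A
    have hM : ∀ a b : Fin n, s(a, b) ∈ M ↔ m a b := by
      intro a b
      constructor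
      · rintro ⟨u, hu, v, hv, huv, he⟩
        have huvm : m u v := by
          rw [hc]
          exact ⟨⟨u.2, v.2, huv⟩, fun e => hv (e.symm.trans hu)⟩
        rcases Sym2.eq_iff.1 he with ⟨rfl, rfl⟩ | ⟨rfl, rfl⟩
        · exact huvm
        · exact hsymm _ _ huvm
      · intro h
        obtain ⟨⟨_, _, hadj⟩, hne⟩ := (hc _ _).1 h
        by_cases h1 : c a = c x
        · exact ⟨a, h1, b, fun h2 => hne (h1.trans h2.symm), hadj, rfl⟩
        · have h2 : c b = c x := zmod_two_eq hne h1
          exact ⟨b, h2, a, h1, hadj.symm, Sym2.eq_swap⟩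
    refine ⟨M, ⟨?_, A, ⟨⟨x, hx⟩, rfl⟩, ⟨⟨y, hy⟩, fun h => hxy h.symm⟩, rfl⟩,
      encodeEdges_eq_encRel hM⟩
    intro e he f hf v hve hvf
    obtain ⟨a, rfl⟩ := hve
    obtain ⟨b, rfl⟩ := hvf
    have h1 := (hM v a).1 he
    have h2 := (hM v b).1 hf
    rw [Fin.ext (hmat _ _ _ h1 h2)]

/-- A first-order description of the leading block of ones, which the machine evaluates with a
bounded quantifier. -/
theorem lt_numVertices_iff (x : List Bool) (i : ℕ) :
    i < numVertices x ↔ ∀ k ≤ i, x.getD k false = true := by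
  induction x generalizing i with
  | nil => simp [numVertices]; exact ⟨i, le_rfl⟩
  | cons b x ih =>
    cases b with
    | false =>
      simp only [numVertices, id, List.takeWhile, List.length_nil, Nat.not_lt_zero, false_iff]
      intro h
      simpa using h 0 (Nat.zero_le _)
    | true =>
      have : numVertices (true :: x) = numVertices x + 1 := by simp [numVertices, List.takeWhile]
      rw [this]
      cases i with
      | zero => simp
      | succ i =>
        rw [Nat.add_lt_add_iff_right, ih]
        constructor
        · intro h k hk
          cases k with
          | zero => rfl
          | succ k => exact h k (by omega)
        · intro h k hk
          exact h (k + 1) (by omega)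

theorem numVertices_le (x : List Bool) : numVertices x ≤ x.length :=
  (List.takeWhile_sublist _).length_le

theorem natAdj_graphOf (x : List Bool) (i j : ℕ) : natAdj (graphOf x) i j ↔
    i < numVertices x ∧ j < numVertices x ∧ i ≠ j ∧
      (x.getD (numVertices x + 1 + (i * numVertices x + j)) false = true ∨
        x.getD (numVertices x + 1 + (j * numVertices x + i)) false = true) := by
  simp only [natAdj, graphOf, SimpleGraph.fromRel_adj, ne_eq, Fin.mk.injEq]
  constructor
  · rintro ⟨hi, hj, h1, h2⟩
    exact ⟨hi, hj, h1, h2⟩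
  · rintro ⟨hi, hj, h1, h2⟩
    exact ⟨hi, hj, h1, h2⟩

open Classical in
/-- The encoding of a graph with vertices `0, …, N - 1`. -/
noncomputable def encGraph (N : ℕ) (r : ℕ → ℕ → Prop) : List Bool :=
  (List.range (N + 1 + N * N)).map fun e =>
    decide (e < N ∨ ∃ h < N, ∃ h' < N, e = N + 1 + (h * N + h') ∧ r h h')

theorem encGraph_length (N : ℕ) (r : ℕ → ℕ → Prop) :
    (encGraph N r).length = N + 1 + N * N := by simp [encGraph]

theorem encGraph_getD (N : ℕ) (r : ℕ → ℕ → Prop) (e : ℕ) :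
    (encGraph N r).getD e false = true ↔
      e < N ∨ ∃ h < N, ∃ h' < N, e = N + 1 + (h * N + h') ∧ r h h' := by
  by_cases he : e < N + 1 + N * N
  · rw [List.getD_eq_getElem _ _ (by rwa [encGraph_length])]
    simp [encGraph]
  · rw [List.getD_eq_default _ _ (by rw [encGraph_length]; omega)]
    simp only [Bool.false_eq_true, false_iff, not_or, not_exists, not_and]
    refine ⟨by omega, fun h hh h' hh' heq => ?_⟩
    exfalso
    have : h * N + h' < N * N := by nlinarith
    omega

theorem numVertices_encGraph (N : ℕ) (r : ℕ → ℕ → Prop) : numVertices (encGraph N r) = N := by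
  refine le_antisymm ?_ ?_
  · by_contra h
    have h1 := (lt_numVertices_iff (encGraph N r) N).1 (by omega) N le_rfl
    rw [encGraph_getD] at h1
    rcases h1 with h1 | ⟨h, _, h', _, h1, _⟩ <;> omega
  · by_contra h
    have h1 : ¬ numVertices (encGraph N r) < numVertices (encGraph N r) := lt_irrefl _
    rw [lt_numVertices_iff] at h1
    refine h1 fun k hk => ?_
    rw [encGraph_getD]
    exact Or.inl (by omega)

theorem natAdj_encGraph {N : ℕ} {r : ℕ → ℕ → Prop} (hr : IsGraph N r) :
    natAdj (graphOf (encGraph N r)) = r := by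
  have key : ∀ i j, i < N → j < N → ((encGraph N r).getD (N + 1 + (i * N + j)) false = true ↔
      r i j) := by
    intro i j hi hj
    rw [encGraph_getD]
    constructor
    · rintro (h | ⟨h, hh, h', hh', heq, hr'⟩)
      · omega
      · have heq : i * N + j = h * N + h' := by omega
        have h1 := congrArg (· / N) heq
        have h2 := congrArg (· % N) heq
        simp only [code_div hj, code_div hh', code_mod hj, code_mod hh'] at h1 h2
        rwa [h1, h2]
    · exact fun h => Or.inr ⟨i, hi, j, hj, rfl, h⟩
  funext i j
  rw [eq_iff_iff, natAdj_graphOf, numVertices_encGraph]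
  constructor
  · rintro ⟨hi, hj, _, h | h⟩
    · exact (key i j hi hj).1 h
    · exact hr.symm ((key j i hj hi).1 h)
  · intro h
    exact ⟨hr.lt h, hr.lt' h, hr.ne h, Or.inl ((key i j (hr.lt h) (hr.lt' h)).2 h)⟩

end EnumKernel

namespace EnumKernel

/-! ## Lexicographic enumeration -/

/-- The lexicographic order: at the first difference, `T` has an element that `S` has not. -/
def LexLT (S T : Set ℕ) : Prop := ∃ b, b ∉ S ∧ b ∈ T ∧ ∀ e < b, e ∈ S ↔ e ∈ T

theorem LexLT.irrefl (S : Set ℕ) : ¬ LexLT S S := fun ⟨_, h, h', _⟩ => h h'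

theorem LexLT.trans {S T U : Set ℕ} (h : LexLT S T) (h' : LexLT T U) : LexLT S U := by
  obtain ⟨a, h1, h2, h3⟩ := h
  obtain ⟨b, h4, h5, h6⟩ := h'
  rcases lt_trichotomy a b with h | rfl | h
  · exact ⟨a, h1, (h6 a h).1 h2, fun e he => (h3 e he).trans (h6 e (he.trans h))⟩
  · exact absurd h2 h4
  · exact ⟨b, fun hb => h4 ((h3 b h).1 hb), h5, fun e he => (h3 e (he.trans h)).trans (h6 e he)⟩

/-- Hence the empty set can only be the first one to be enumerated, which is what bounds the delay.
-/
theorem LexLT.nonempty {S T : Set ℕ} (h : LexLT S T) : T.Nonempty := by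
  obtain ⟨b, _, h, _⟩ := h
  exact ⟨b, h⟩

/-- `E` decides whether a set of numbers below `t` is the part below `t` of an element of `𝒢`. -/
def Decides (E : Set ℕ → ℕ → Prop) (𝒢 : Set (Set ℕ)) : Prop :=
  ∀ S t, (∀ e ∈ S, e < t) → (E S t ↔ ∃ S' ∈ 𝒢, ∀ e < t, e ∈ S' ↔ e ∈ S)

section

variable {E : Set ℕ → ℕ → Prop} {𝒢 : Set (Set ℕ)} {L : ℕ}

/-- The greedy algorithm extends a prefix to the least element of `𝒢` with this prefix. -/
theorem Decides.passSet (hE : Decides E 𝒢) (hL : ∀ S ∈ 𝒢, ∀ e ∈ S, e < L) {T : Set ℕ} {b : ℕ}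
    (hb : b ≤ L) (hT : ∀ e ∈ T, e < b) (hET : E T b) :
    EnumKernel.passSet (fun U t => b ≤ t ∧ ¬ E U (t + 1)) T L ∈ 𝒢 ∧
      (∀ e < b, e ∈ EnumKernel.passSet (fun U t => b ≤ t ∧ ¬ E U (t + 1)) T L ↔ e ∈ T) ∧
      ∀ S ∈ 𝒢, (∀ e < b, e ∈ S ↔ e ∈ T) →
        S = EnumKernel.passSet (fun U t => b ≤ t ∧ ¬ E U (t + 1)) T L ∨
        LexLT (EnumKernel.passSet (fun U t => b ≤ t ∧ ¬ E U (t + 1)) T L) S := by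
  set F : Set ℕ → ℕ → Prop := fun U t => b ≤ t ∧ ¬ E U (t + 1) with hF
  have h0 : ∀ k ≤ b, EnumKernel.passSet F T k = T := by
    intro k hk
    induction k with
    | zero => rfl
    | succ k ih =>
      rw [EnumKernel.passSet, ih (by omega), Set.union_eq_left]
      rintro i ⟨rfl, h, _⟩
      omega
  -- Invariant: the set built so far is a prefix of an element of `𝒢`, and every element with the
  -- prefix `T` either still agrees with it or is already lexicographically larger.
  have key : ∀ d, (∀ e ∈ EnumKernel.passSet F T (b + d), e < b + d) ∧
      E (EnumKernel.passSet F T (b + d)) (b + d) ∧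
      (∀ e < b, e ∈ EnumKernel.passSet F T (b + d) ↔ e ∈ T) ∧
      ∀ S ∈ 𝒢, (∀ e < b, e ∈ S ↔ e ∈ T) →
        (∀ e < b + d, e ∈ S ↔ e ∈ EnumKernel.passSet F T (b + d)) ∨
        ∃ c < b + d, c ∉ EnumKernel.passSet F T (b + d) ∧ c ∈ S ∧
          ∀ e < c, e ∈ EnumKernel.passSet F T (b + d) ↔ e ∈ S := by
    intro d
    induction d with
    | zero =>
      rw [Nat.add_zero, h0 b le_rfl]
      exact ⟨hT, hET, fun _ _ => Iff.rfl, fun S _ h => Or.inl h⟩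
    | succ d ih =>
      obtain ⟨h1, h2, h3, h4⟩ := ih
      rw [← Nat.add_assoc, EnumKernel.passSet]
      set R := EnumKernel.passSet F T (b + d) with hR
      have hmem : ∀ e < b + d, e ∈ R ∪ {i | i = b + d ∧ F R (b + d)} ↔ e ∈ R := by
        intro e he
        constructor
        · rintro (h | ⟨h, _⟩)
          · exact h
          · omega
        · exact Or.inl
      have hself : b + d ∈ R ∪ {i | i = b + d ∧ F R (b + d)} ↔ ¬ E R (b + d + 1) := by
        constructor
        · rintro (h | ⟨_, _, h⟩)
          · exact absurd (h1 _ h) (lt_irrefl _)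
          · exact h
        · exact fun h => Or.inr ⟨rfl, Nat.le_add_right _ _, h⟩
      refine ⟨?_, ?_, fun e he => (hmem e (by omega)).trans (h3 e he), ?_⟩
      · rintro e (h | ⟨rfl, _⟩)
        · have := h1 e h; omega
        · omega
      · have hlt : ∀ e ∈ R ∪ {i | i = b + d ∧ F R (b + d)}, e < b + d + 1 := by
          rintro e (h | ⟨rfl, _⟩)
          · have := h1 e h; omega
          · omega
        rw [hE _ _ hlt]
        by_cases hext : E R (b + d + 1)
        · obtain ⟨S, hS, h⟩ := (hE R _ fun e he => by have := h1 e he; omega).1 hext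
          refine ⟨S, hS, fun e he => (h e he).trans ?_⟩
          rcases Nat.lt_succ_iff_lt_or_eq.1 he with he | rfl
          · exact (hmem e he).symm
          · rw [hself]
            exact ⟨fun h => absurd (h1 _ h) (lt_irrefl _), fun h => absurd hext h⟩
        -- `R` extends to an element of `𝒢`, but not without `b + d`; so every extension contains `b
        -- + d`.
        · obtain ⟨S, hS, h⟩ := (hE R _ h1).1 h2
          refine ⟨S, hS, fun e he => ?_⟩
          rcases Nat.lt_succ_iff_lt_or_eq.1 he with he | rfl
          · exact (h e he).trans (hmem e he).symm
          · rw [hself]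
            refine ⟨fun _ => hext, fun _ => ?_⟩
            by_contra hn
            refine hext ((hE R _ fun e he => by have := h1 e he; omega).2 ⟨S, hS, fun e he => ?_⟩)
            rcases Nat.lt_succ_iff_lt_or_eq.1 he with he | rfl
            · exact h e he
            · exact ⟨fun h => absurd h hn, fun h => absurd (h1 _ h) (lt_irrefl _)⟩
      · intro S hS hST
        rcases h4 S hS hST with h | ⟨c, hc, h5, h6, h7⟩
        · by_cases hext : E R (b + d + 1)
          · have hself' : b + d ∉ R ∪ {i | i = b + d ∧ F R (b + d)} :=
              fun h => hself.1 h hext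
            by_cases hS' : b + d ∈ S
            · exact Or.inr ⟨b + d, by omega, hself', hS', fun e he =>
                (hmem e he).trans (h e he).symm⟩
            · left
              intro e he
              rcases Nat.lt_succ_iff_lt_or_eq.1 he with he | rfl
              · exact (h e he).trans (hmem e he).symm
              · exact ⟨fun h => absurd h hS', fun h => absurd h hself'⟩
          · left
            intro e he
            rcases Nat.lt_succ_iff_lt_or_eq.1 he with he | rfl
            · exact (h e he).trans (hmem e he).symm
            · refine ⟨fun _ => hself.2 hext, fun _ => ?_⟩
              by_contra hn
              refine hext ((hE R _ fun e he => by have := h1 e he; omega).2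
                ⟨S, hS, fun e he => ?_⟩)
              rcases Nat.lt_succ_iff_lt_or_eq.1 he with he | rfl
              · exact h e he
              · exact ⟨fun h => absurd h hn, fun h => absurd (h1 _ h) (lt_irrefl _)⟩
        · exact Or.inr ⟨c, by omega, fun h => h5 ((hmem c hc).1 h), h6, fun e he =>
            (hmem e (he.trans hc)).trans (h7 e he)⟩
  obtain ⟨h1, h2, h3, h4⟩ := key (L - b)
  rw [show b + (L - b) = L by omega] at h1 h2 h3 h4
  refine ⟨?_, h3, fun S hS hST => ?_⟩
  · obtain ⟨S, hS, h⟩ := (hE _ _ h1).1 h2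
    have : EnumKernel.passSet F T L = S := by
      ext e
      by_cases he : e < L
      · exact (h e he).symm
      · exact ⟨fun h => absurd (h1 e h) he, fun h => absurd (hL S hS e h) he⟩
    rw [this]
    exact hS
  · rcases h4 S hS hST with h | ⟨c, _, h5, h6, h7⟩
    · left
      ext e
      by_cases he : e < L
      · exact h e he
      · exact ⟨fun h => absurd (hL S hS e h) he, fun h => absurd (h1 e h) he⟩
    · exact Or.inr ⟨c, h5, h6, h7⟩

/-- The numbers at which a larger element of `𝒢` can differ from `S` for the first time. -/
def Branching (E : Set ℕ → ℕ → Prop) (S : Set ℕ) (t : ℕ) : Prop :=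
  t ∉ S ∧ E {e | e = t ∨ e < t ∧ e ∈ S} (t + 1)

theorem Decides.branching_of_lexLT (hE : Decides E 𝒢) {S S' : Set ℕ} (hS' : S' ∈ 𝒢)
    (h : LexLT S S') : ∃ t, Branching E S t ∧ t ∈ S' ∧ ∀ e < t, e ∈ S ↔ e ∈ S' := by
  obtain ⟨t, h1, h2, h3⟩ := h
  refine ⟨t, ⟨h1, (hE _ _ ?_).2 ⟨S', hS', fun e he => ?_⟩⟩, h2, h3⟩
  · rintro e (rfl | ⟨h, _⟩) <;> omega
  · rcases Nat.lt_succ_iff_lt_or_eq.1 he with he | rfl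
    · rw [← h3 e he]
      exact ⟨fun h => Or.inr ⟨he, h⟩, fun h => h.elim (fun h => by omega) fun h => h.2⟩
    · exact ⟨fun _ => Or.inl rfl, fun _ => h2⟩

/-- Computation of the successor of `S`: the greedy algorithm at the last branching. -/
theorem Decides.next (hE : Decides E 𝒢) (hL : ∀ S ∈ 𝒢, ∀ e ∈ S, e < L) {S : Set ℕ} {b : ℕ}
    (hb : b < L) (hB : Branching E S b) (hmax : ∀ t, b < t → t < L → ¬ Branching E S t) {R : Set ℕ}
    (hR : R = EnumKernel.passSet (fun U t => b + 1 ≤ t ∧ ¬ E U (t + 1))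
      {e | e = b ∨ e < b ∧ e ∈ S} L) :
    R ∈ 𝒢 ∧ {S' ∈ 𝒢 | LexLT S S'} = insert R {S' ∈ 𝒢 | LexLT R S'} := by
  obtain ⟨h1, h2, h3⟩ := hE.passSet hL (b := b + 1) hb (T := {e | e = b ∨ e < b ∧ e ∈ S})
    (by rintro e (rfl | ⟨h, _⟩) <;> omega) hB.2
  rw [← hR] at h1 h2 h3
  have hbR : b ∈ R := (h2 b (by omega)).2 (Or.inl rfl)
  have hlow : ∀ e < b, e ∈ R ↔ e ∈ S := by
    intro e he
    rw [h2 e (by omega)]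
    exact ⟨fun h => h.elim (fun h => by omega) fun h => h.2, fun h => Or.inr ⟨he, h⟩⟩
  have hSR : LexLT S R := ⟨b, hB.1, hbR, fun e he => (hlow e he).symm⟩
  refine ⟨h1, ?_⟩
  ext S'
  constructor
  -- A larger set first differs from `S` at a branching `t ≤ b`. If `t < b`, it is also larger than
  -- `R`, which agrees with `S` below `b`. If `t = b`, it has the prefix from which the greedy
  -- algorithm started, and `R` is the least such set.
  · rintro ⟨hS', hlt⟩
    obtain ⟨t, ht, htS', hlow'⟩ := hE.branching_of_lexLT hS' hlt
    have htL : t < L := hL S' hS' t htS'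
    rcases lt_trichotomy t b with h | rfl | h
    · exact Or.inr ⟨hS', t, fun h' => ht.1 ((hlow t h).1 h'), htS', fun e he =>
        (hlow e (he.trans h)).trans (hlow' e he)⟩
    · have : ∀ e < t + 1, e ∈ S' ↔ e ∈ {e | e = t ∨ e < t ∧ e ∈ S} := by
        intro e he
        rcases Nat.lt_succ_iff_lt_or_eq.1 he with he | rfl
        · rw [← hlow' e he]
          exact ⟨fun h => Or.inr ⟨he, h⟩, fun h => h.elim (fun h => by omega) fun h => h.2⟩
        · exact ⟨fun _ => Or.inl rfl, fun _ => htS'⟩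
      rcases h3 S' hS' this with h | h
      · exact Or.inl h
      · exact Or.inr ⟨hS', h⟩
    · exact absurd ht (hmax t h htL)
  · rintro (rfl | ⟨h, h'⟩)
    · exact ⟨h1, hSR⟩
    · exact ⟨h, hSR.trans h'⟩

theorem Decides.last (hE : Decides E 𝒢) (hL : ∀ S ∈ 𝒢, ∀ e ∈ S, e < L) {S : Set ℕ}
    (h : ∀ t < L, ¬ Branching E S t) : {S' ∈ 𝒢 | LexLT S S'} = ∅ := by
  refine Set.eq_empty_of_forall_notMem fun S' ⟨hS', hlt⟩ => ?_
  obtain ⟨t, ht, htS', _⟩ := hE.branching_of_lexLT hS' hlt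
  exact h t (hL S' hS' t htS') ht

/-- The enumeration starts with the least element of `𝒢`. -/
theorem Decides.first (hE : Decides E 𝒢) (hL : ∀ S ∈ 𝒢, ∀ e ∈ S, e < L) (hne : 𝒢.Nonempty)
    {R : Set ℕ} (hR : R = EnumKernel.passSet (fun U t => ¬ E U (t + 1)) ∅ L) :
    R ∈ 𝒢 ∧ 𝒢 = insert R {S' ∈ 𝒢 | LexLT R S'} := by
  obtain ⟨S₀, hS₀⟩ := hne
  obtain ⟨h1, _, h3⟩ := hE.passSet hL (b := 0) (Nat.zero_le L) (T := ∅) (by simp)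
    ((hE _ _ (by simp)).2 ⟨S₀, hS₀, by simp⟩)
  simp only [Nat.zero_le, true_and] at h1 h3
  rw [← hR] at h1 h3
  refine ⟨h1, ?_⟩
  ext S
  constructor
  · intro hS
    rcases h3 S hS (by simp) with h | h
    · exact Or.inl h
    · exact Or.inr ⟨hS, h⟩
  · rintro (rfl | h)
    · exact h1
    · exact h.1

end

end EnumKernel

namespace EnumKernel

open Relation

/-! ## Computation of the kernel -/

/-- The meaning of the arrays: `X i` says that the bit `i` of the instance is set, and `ms` is a set
of edges of the kernel. -/
def Fact (L n : ℕ) (adj ms : ℕ → ℕ → Prop) (X : ℕ → Prop) : ℕ → (ℕ → ℕ) → Prop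
  | 0, f => ∀ i, f i ≠ 0 ↔ X i
  | 2, f => ∀ i < kerSize n adj, ∀ j < kerSize n adj, f (i * kerSize n adj + j) ≠ 0 ↔ ms i j
  | 3, f => f 0 = n
  | 4, f => ∀ i < L, f i = i * n
  | 5, f => ∀ e < n * n, f e = e / n
  | 6, f => ∀ e < n * n, f e = e % n
  | 7, f => ∀ e, f e ≠ 0 ↔ e < n * n ∧ adj (e / n) (e % n)
  | 8, f => ∀ v, f v ≠ 0 ↔ v < n ∧ ¬ Core adj v
  | 9, f => ∀ v, f v ≠ 0 ↔ Core adj v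
  | 10, f => ∀ v, f v ≠ 0 ↔ Branch adj v
  | 11, f => ∀ v, f v ≠ 0 ↔ Inner adj v
  | 12, f => ∀ v, f v ≠ 0 ↔ Supp adj v
  | 13, f => ∀ v, f v ≠ 0 ↔ Keep adj v
  | 14, f => ∀ e, f e ≠ 0 ↔ e < n * n ∧ Link adj (e / n) (e % n)
  | 15, f => ∀ e, f e ≠ 0 ↔ e < n * n ∧ Bdry adj (e / n) (e % n)
  | 16, f => ∀ w < L, f w = rk adj w
  | 17, f => ∀ v, f v ≠ 0 ↔ ReflTransGen adj 0 v
  | 18, f => f 0 = kerSize n adj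
  | 19, f => ∀ h < L, f h = h * kerSize n adj
  | 20, f => ∀ v, f v ≠ 0 ↔ Touched adj ms v
  | 21, f => ∀ q, f q ≠ 0 ↔ Target adj ms q
  | 22, f => ∀ e, f e ≠ 0 ↔ Avail n adj ms e
  | _, _ => True

/-- The hypotheses on the parameters of `Fact`. -/
structure Setup (L n : ℕ) (adj : ℕ → ℕ → Prop) (X : ℕ → Prop) : Prop where
  graph : IsGraph n adj
  lt_iff : ∀ i, i < n ↔ ∀ k ≤ i, X k
  adj_iff : ∀ i j, adj i j ↔ i < n ∧ j < n ∧ i ≠ j ∧ (X (n + 1 + (i * n + j)) ∨ X (n + 1 + (j * n + i)))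
  le : (3 * n + 3) * (3 * n + 3) ≤ L

theorem arr_setVar (s : State) (v k : ℕ) : (s.setVar v k).arr = s.arr := by
  cases s; exact rfl

/-- The first `k` arrays are as they should be. -/
def Facts (L n : ℕ) (adj ms : ℕ → ℕ → Prop) (X : ℕ → Prop) (k : ℕ) (A : ℕ → ℕ → ℕ) : Prop :=
  ∀ a < k, Fact L n adj ms X a (A a)

/-- The first `k` arrays are as they should be, and the others are empty. -/
structure Ready (L n : ℕ) (adj ms : ℕ → ℕ → Prop) (X : ℕ → Prop) (k : ℕ) (s : State) : Prop where
  facts : Facts L n adj ms X k s.arr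
  zero : ∀ a ≥ k, ∀ i, s.arr a i = 0
  var : s.var 0 = L

section

variable {L n : ℕ} {adj ms : ℕ → ℕ → Prop} {X : ℕ → Prop} {k j : ℕ} {s : State}

theorem Facts.same {l : ℕ} {t : State} (h : Facts L n adj ms X k s.arr) (h' : Same l s t)
    (hk : k ≤ l) : Facts L n adj ms X k t.arr := fun a ha => by
  rw [h'.2 a (by omega)]
  exact h a ha

theorem Ready.same {t : State} (h : Ready L n adj ms X k s) (h' : Same k s t)
    (hF : Fact L n adj ms X k (t.arr k)) : Ready L n adj ms X (k + 1) t where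
  facts a ha := by
    rcases Nat.lt_succ_iff_lt_or_eq.1 ha with ha | rfl
    · exact h.facts.same h' le_rfl a ha
    · exact hF
  zero a ha i := by rw [h'.2 a (by omega), h.zero a (by omega)]
  var := h'.1.trans h.var

/-- The rules `Ready.table`, `Ready.table_val` and `Ready.closure` justify the arrays one at a time:
the expression for the array `k` has to be analysed only under the facts about earlier arrays.
Emptiness of the array beforehand controls the cells from `L` on. -/
theorem Ready.table {e : XE} (hs : Ready L n adj ms X k s) (hj : j ≠ 0) (P : ℕ → Prop)
    (h : ∀ i < L, ∀ t, Facts L n adj ms X k t.arr → t.var j = i → (e.holds L t ↔ P i))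
    (hF : ∀ f : ℕ → ℕ, (∀ i, f i ≠ 0 ↔ i < L ∧ P i) → Fact L n adj ms X k f) :
    Ready L n adj ms X (k + 1) ((FP.table j k e).run L s) := by
  obtain ⟨h1, h2⟩ := FP.run_table_holds (a := k) (s := s) (P := P) hj fun i hi t ht hti =>
    h i hi t (hs.facts.same ht le_rfl) hti
  refine hs.same h1 (hF _ fun i => (h2 i).trans ?_)
  by_cases hi : i < L <;> simp [hi, hs.zero k le_rfl]

theorem Ready.table_val {e : XE} (hs : Ready L n adj ms X k s) (hj : j ≠ 0) (g : ℕ → ℕ)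
    (h : ∀ i < L, ∀ t, Same k s t → Facts L n adj ms X k t.arr → t.var j = i → e.eval L t = g i)
    (hF : ∀ f : ℕ → ℕ, (∀ i < L, f i = g i) → Fact L n adj ms X k f) :
    Ready L n adj ms X (k + 1) ((FP.table j k e).run L s) := by
  obtain ⟨h1, h2⟩ := FP.run_table (a := k) (s := s) (f := g) hj fun i hi t ht hti =>
    h i hi t ht (hs.facts.same ht le_rfl) hti
  exact hs.same h1 (hF _ fun i hi => by rw [h2, if_pos hi])

theorem Ready.closure {m : ℕ} {c : XE} (hs : Ready L n adj ms X k s) (hj : j ≠ 0) (hm : m ≠ 0)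
    (F : Set ℕ → ℕ → Prop)
    (h : ∀ i < L, ∀ t, Facts L n adj ms X k t.arr → t.var j = i → (c.holds L t ↔ F (t.supp k) i))
    (hF : ∀ f : ℕ → ℕ, (∀ i < L, F {i | f i ≠ 0} i → f i ≠ 0) →
      (∀ T : Set ℕ, (∀ U ⊆ T, ∀ i < L, F U i → i ∈ T) → ∀ i, f i ≠ 0 → i ∈ T) →
      Fact L n adj ms X k f) :
    Ready L n adj ms X (k + 1) ((FP.closure m j k c).run L s) := by
  obtain ⟨h1, h2, h3⟩ := FP.run_closure (a := k) (s := s) (F := F) hj hm fun i hi t ht hti =>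
    h i hi t (hs.facts.same ht le_rfl) hti
  refine hs.same h1 (hF _ h2 fun T hT => h3 T ?_ hT)
  intro i hi
  exact absurd (hs.zero k le_rfl i) hi

/-- With at most `n` kept vertices the kernel has `N ≤ 3n + 2` vertices, and `N + 1 + N² ≤ (N +
1)²`. So every index in use, including those of the encoding of the kernel, is below `L`. -/
theorem Setup.bounds (hS : Setup L n adj X) : n < L ∧ n * n < L ∧ kerSize n adj < L ∧
    kerSize n adj + 1 + kerSize n adj * kerSize n adj ≤ L := by
  have h1 := hS.le
  have h2 : kerSize n adj ≤ 3 * n + 2 := by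
    classical
    have : rk adj n ≤ 3 * n := by
      rw [rk]
      have := Finset.card_filter_le (Finset.range n) (Keep adj)
      rw [Finset.card_range] at this
      omega
    rw [kerSize]
    split_ifs <;> omega
  refine ⟨by nlinarith, by nlinarith, by nlinarith, by nlinarith⟩

end

/-! ### Vertices and edges -/

/-- The number of vertices. -/
def XE.nX : XE := .read 3 (.const 0)

/-- The code of a pair of vertices. -/
def XE.codeX (a b : XE) : XE := .add (.read 4 a) b

/-- First vertex of a code. -/
def XE.fstX (e : XE) : XE := .read 5 e

/-- Second vertex of a code. -/
def XE.sndX (e : XE) : XE := .read 6 e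

/-- Reading of a table indexed by codes. -/
def XE.relX (r : ℕ) (a b : XE) : XE := (XE.lt a nX).and ((XE.lt b nX).and (.read r (codeX a b)))

/-- The expression is the code of a pair of vertices. -/
def XE.isCode (e : XE) : XE := .lt e (.read 4 nX)

/-- Expression for: number of vertices. -/
def sizeExpr : XE := .count 20 (.all 21 ((XE.not (.lt (.var 20) (.var 21))).imp (.read 0 (.var 21))))
/-- Expression for: multiples of the number of vertices. -/
def rowExpr : XE := .sum 20 (.cond (.lt (.var 20) (.var 10)) .nX (.const 0))
/-- Expression for: first vertex of the code. -/
def fstExpr : XE := .count 20 (XE.not (.lt (.var 10) (.add (.read 4 (.var 20)) .nX)))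
/-- Expression for: second vertex of the code. -/
def sndExpr : XE := .sub (.var 10) (.read 4 (.read 5 (.var 10)))
/-- Expression for: adjacency. -/
def adjExpr : XE := (XE.var 10).isCode.and ((XE.not (.eq (XE.fstX (.var 10)) (XE.sndX (.var 10)))).and
  ((XE.read 0 (.add (.add .nX (.const 1)) (.var 10))).or
    (XE.read 0 (.add (.add .nX (.const 1)) (.codeX (XE.sndX (.var 10)) (XE.fstX (.var 10)))))))

section

variable {L n : ℕ} {adj ms : ℕ → ℕ → Prop} {X : ℕ → Prop} {k j : ℕ} {s : State} {A : ℕ → ℕ → ℕ}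

theorem ready_size (hS : Setup L n adj X) (hs : Ready L n adj ms X 3 s) :
    Ready L n adj ms X 4 ((FP.table 10 3 sizeExpr).run L s) := by
  classical
  refine hs.table_val (by omega) (fun _ => n) (fun i hi t _ ht _ => ?_) fun f hf => hf 0 ?_
  · have h0 : ∀ i, t.arr 0 i ≠ 0 ↔ X i := ht 0 (by omega)
    rw [sizeExpr, XE.eval_count]
    simp only [XE.holds_all, XE.holds_imp, XE.holds_not, XE.holds_lt, XE.holds_read, arr_setVar, h0,
      XE.eval, setVar_var, Nat.reduceEqDiff, if_true, if_false]
    have : ((Finset.range L).filter fun k => ∀ l < L, ¬ k < l → X l) = Finset.range n := by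
      ext a
      simp only [Finset.mem_filter, Finset.mem_range, hS.lt_iff]
      have := hS.bounds.1
      constructor
      · exact fun ⟨h1, h2⟩ l hl => h2 l (by omega) (by omega)
      · intro h
        have h' := (hS.lt_iff a).2 h
        exact ⟨by omega, fun l _ hl => h l (by omega)⟩
    rw [this, Finset.card_range]
  · have := hS.bounds.1
    omega

theorem eval_nX (hA : Facts L n adj ms X k s.arr) (hk : 4 ≤ k) : XE.nX.eval L s = n :=
  hA 3 (by omega)

theorem ready_row (hs : Ready L n adj ms X 4 s) :
    Ready L n adj ms X 5 ((FP.table 10 4 rowExpr).run L s) := by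
  refine hs.table_val (by omega) (fun i => i * n) (fun i hi t _ ht hti => ?_) fun f hf => hf
  have h3 : t.arr 3 0 = n := ht 3 (by omega)
  simp only [rowExpr, XE.eval, XE.nX, arr_setVar, h3, setVar_var, if_true, hti, Nat.reduceEqDiff,
    if_false]
  have : ∀ k, (if (if k < i then 1 else 0) ≠ 0 then n else 0) = if k < i then n else 0 := by
    intro k; by_cases h : k < i <;> simp [h]
  simp only [this]
  rw [← Finset.sum_filter, Finset.sum_const, smul_eq_mul]
  congr 1
  have : (Finset.range L).filter (· < i) = Finset.range i := by
    ext a; simp only [Finset.mem_filter, Finset.mem_range]; omega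
  rw [this, Finset.card_range]

/-- There is no division on the machine: `e / n` is the number of `k` with `k * n + n ≤ e`. -/
theorem ready_fst (hS : Setup L n adj X) (hs : Ready L n adj ms X 5 s) :
    Ready L n adj ms X 6 ((FP.table 10 5 fstExpr).run L s) := by
  classical
  refine hs.table_val (by omega)
    (fun e => ((Finset.range L).filter fun k => ¬ e < k * n + n).card) (fun i hi t _ ht hti => ?_) ?_
  · have h4 : ∀ i < L, t.arr 4 i = i * n := ht 4 (by omega)
    have h3 : t.arr 3 0 = n := ht 3 (by omega)
    rw [fstExpr, XE.eval_count]
    congr 1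
    refine Finset.filter_congr fun k hk => ?_
    simp only [XE.holds_not, XE.holds_lt, XE.eval, XE.nX, setVar_var, arr_setVar, if_true, hti,
      Nat.reduceEqDiff, if_false, h3, h4 k (Finset.mem_range.1 hk)]
  · intro f hf e he
    have hb := hS.bounds
    have hn : 0 < n := Nat.pos_of_mul_pos_left (by omega : 0 < n * n)
    rw [hf e (by omega)]
    have : ((Finset.range L).filter fun k => ¬ e < k * n + n) = Finset.range (e / n) := by
      ext a
      simp only [Finset.mem_filter, Finset.mem_range, not_lt]
      have h1 : a < e / n ↔ a * n + n ≤ e := by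
        rw [Nat.lt_iff_add_one_le, Nat.le_div_iff_mul_le hn, Nat.succ_mul]
      have h2 : e / n < n := Nat.div_lt_of_lt_mul he
      rw [h1]
      refine ⟨fun h => h.2, fun h => ⟨?_, h⟩⟩
      rw [← h1] at h
      omega
    rw [this, Finset.card_range]

theorem code_lt {e : ℕ} (he : e < n * n) : e / n < n ∧ e % n < n := by
  have hn : 0 < n := Nat.pos_of_mul_pos_left (by omega : 0 < n * n)
  exact ⟨Nat.div_lt_of_lt_mul he, Nat.mod_lt _ hn⟩

theorem pair_lt {i j : ℕ} (hi : i < n) (hj : j < n) : i * n + j < n * n := by nlinarith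

theorem ready_snd (hS : Setup L n adj X) (hs : Ready L n adj ms X 6 s) :
    Ready L n adj ms X 7 ((FP.table 10 6 sndExpr).run L s) := by
  obtain ⟨hb1, hb2, -, -⟩ := hS.bounds
  refine hs.table_val (by omega) (fun e => e - s.arr 4 (s.arr 5 e)) (fun i hi t hst ht hti => ?_) ?_
  · simp only [sndExpr, XE.eval, hti, hst.2 4 (show 4 ≠ 6 by omega),
      hst.2 5 (show 5 ≠ 6 by omega)]
  · intro f hf e he
    have h5 : s.arr 5 e = e / n := hs.facts 5 (by omega) e he
    have h4 : s.arr 4 (e / n) = e / n * n :=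
      hs.facts 4 (by omega) _ ((code_lt he).1.trans hb1)
    rw [hf e (by omega), h5, h4, ← Nat.mod_eq_sub_div_mul]

theorem holds_isCode (hS : Setup L n adj X) (hA : Facts L n adj ms X k A) (hk : 5 ≤ k)
    (hs : s.arr = A) {e : XE} : e.isCode.holds L s ↔ e.eval L s < n * n := by
  subst hs
  have h4 : s.arr 4 n = n * n := hA 4 (by omega) n hS.bounds.1
  have h3 : s.arr 3 0 = n := hA 3 (by omega)
  simp only [XE.isCode, XE.holds_lt, XE.eval, XE.nX, h3, h4]

theorem eval_fstX (hA : Facts L n adj ms X k A) (hk : 6 ≤ k)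
    (hs : s.arr = A) {e : XE} (he : e.eval L s < n * n) : e.fstX.eval L s = e.eval L s / n := by
  subst hs
  exact hA 5 (by omega) _ he

theorem eval_sndX (hA : Facts L n adj ms X k A) (hk : 7 ≤ k)
    (hs : s.arr = A) {e : XE} (he : e.eval L s < n * n) : e.sndX.eval L s = e.eval L s % n := by
  subst hs
  exact hA 6 (by omega) _ he

theorem eval_codeX (hS : Setup L n adj X) (hA : Facts L n adj ms X k A) (hk : 5 ≤ k)
    (hs : s.arr = A) {a b : XE} (ha : a.eval L s < n) :
    (XE.codeX a b).eval L s = a.eval L s * n + b.eval L s := by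
  subst hs
  have h4 : s.arr 4 (a.eval L s) = a.eval L s * n := hA 4 (by omega) _ (ha.trans hS.bounds.1)
  simp only [XE.codeX, XE.eval, h4]

/-- The comparisons with `n` in `XE.relX` are needed because a number `i * n + j` with `j ≥ n` would
be decoded as another pair. -/
theorem holds_relX (hS : Setup L n adj X) (hA : Facts L n adj ms X k A) (hk : 5 ≤ k)
    {r : ℕ} {R : ℕ → ℕ → Prop} (hR : ∀ i j, R i j → i < n ∧ j < n)
    (hr : ∀ e, A r e ≠ 0 ↔ e < n * n ∧ R (e / n) (e % n))
    ⦃s : State⦄ (hs : s.arr = A) {a b : XE} :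
    (XE.relX r a b).holds L s ↔ R (a.eval L s) (b.eval L s) := by
  have h3 : XE.nX.eval L s = n := by subst hs; exact eval_nX hA (by omega)
  rw [XE.relX, XE.holds_and, XE.holds_and, XE.holds_lt, XE.holds_lt, XE.holds_read, h3]
  constructor
  · rintro ⟨h1, h2, h⟩
    rw [eval_codeX hS hA hk hs h1, hs, hr, code_div h2, code_mod h2] at h
    exact h.2
  · intro h
    obtain ⟨h1, h2⟩ := hR _ _ h
    refine ⟨h1, h2, ?_⟩
    rw [eval_codeX hS hA hk hs h1, hs, hr, code_div h2, code_mod h2]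
    exact ⟨pair_lt h1 h2, h⟩

theorem ready_adj (hS : Setup L n adj X) (hs : Ready L n adj ms X 7 s) :
    Ready L n adj ms X 8 ((FP.table 10 7 adjExpr).run L s) := by
  obtain ⟨hb1, hb2, -, -⟩ := hS.bounds
  refine hs.table (by omega) (fun e => e < n * n ∧ adj (e / n) (e % n)) (fun i hi t ht hti => ?_) ?_
  · rw [adjExpr, XE.holds_and, holds_isCode hS ht (by omega) rfl, XE.eval, hti]
    refine and_congr_right fun he => ?_
    have hv : (XE.var 10).eval L t < n * n := by rw [XE.eval, hti]; exact he
    have hl := code_lt he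
    have h0 : ∀ i, t.arr 0 i ≠ 0 ↔ X i := ht 0 (by omega)
    have hf := eval_fstX ht (by omega) rfl hv
    have hs := eval_sndX ht (by omega) rfl hv
    rw [XE.eval, hti] at hf hs
    rw [XE.holds_and, XE.holds_not, XE.holds_eq, XE.holds_or, XE.holds_read, XE.holds_read,
      XE.eval, XE.eval, XE.eval, XE.eval, XE.eval, XE.eval, XE.eval, eval_nX ht (by omega),
      eval_codeX hS ht (by omega) rfl (by rw [hs]; exact hl.2), hf, hs, h0, h0, hS.adj_iff, hti,
      Nat.div_add_mod']
    simp only [hl.1, hl.2, true_and, ne_eq]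
  · intro f hf e
    rw [hf]
    exact ⟨fun h => h.2, fun h => ⟨by omega, h⟩⟩

theorem holds_adj (hS : Setup L n adj X) (hA : Facts L n adj ms X k A) (hk : 8 ≤ k) :
    ∀ ⦃s : State⦄, s.arr = A → ∀ {a b : XE},
      (XE.relX 7 a b).holds L s ↔ adj (a.eval L s) (b.eval L s) :=
  holds_relX hS hA (by omega) (fun _ _ h => ⟨hS.graph.lt h, hS.graph.lt' h⟩) (hA 7 (by omega))

end

/-! ### The 2-core and the kept vertices -/

/-- Expression for: a vertex with at most one neighbour outside the array `8`. -/
def deadExpr : XE := (XE.lt (.var 10) .nX).and (.all 20 (.all 21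
  (((XE.relX 7 (.var 10) (.var 20)).and ((XE.relX 7 (.var 10) (.var 21)).and
    ((XE.not (.read 8 (.var 20))).and (XE.not (.read 8 (.var 21)))))).imp
      (.eq (.var 20) (.var 21)))))
/-- Expression for: `Core`. -/
def coreExpr : XE := (XE.lt (.var 10) .nX).and (XE.not (.read 8 (.var 10)))
/-- Expression for: a neighbour of `var 10` in the 2-core. -/
def coreNbr (a : XE) : XE := (XE.read 9 a).and (.relX 7 (.var 10) a)
/-- Expression for: `Branch`. -/
def branchExpr : XE := (XE.read 9 (.var 10)).and (.ex 20 (.ex 21 (.ex 22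
  ((coreNbr (.var 20)).and ((coreNbr (.var 21)).and ((coreNbr (.var 22)).and
    ((XE.not (.eq (.var 20) (.var 21))).and ((XE.not (.eq (.var 20) (.var 22))).and
      (XE.not (.eq (.var 21) (.var 22)))))))))))
/-- Expression for: `Inner`. -/
def innerExpr : XE := (XE.read 9 (.var 10)).and ((XE.not (.read 10 (.var 10))).and
  (.all 20 ((XE.relX 7 (.var 10) (.var 20)).imp (XE.not (.read 10 (.var 20))))))
/-- Expression for: `Supp`. -/
def suppExpr : XE := (XE.read 11 (.var 10)).and
  (.ex 20 ((XE.relX 7 (.var 10) (.var 20)).and (.read 11 (.var 20))))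
/-- Expression for: `Keep`. -/
def keepExpr : XE := (XE.read 9 (.var 10)).and (XE.not (.read 12 (.var 10)))

section

variable {L n : ℕ} {adj ms : ℕ → ℕ → Prop} {X : ℕ → Prop} {k j : ℕ} {s : State} {A : ℕ → ℕ → ℕ}

/-- Repeated deletion of vertices with at most one remaining neighbour. Core vertices are never
deleted, since two core neighbours remain, and the vertices that survive have two surviving
neighbours and so witness that they are in the core. -/
theorem ready_dead (hS : Setup L n adj X) (hs : Ready L n adj ms X 8 s) :
    Ready L n adj ms X 9 ((FP.closure 11 10 8 deadExpr).run L s) := by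
  have hG := hS.graph
  have hb1 := hS.bounds.1
  refine hs.closure (by omega) (by omega)
    (fun U v => v < n ∧ ∀ a b, adj v a → adj v b → a ∉ U → b ∉ U → a = b)
    (fun i hi t ht hti => ?_) fun f h1 h2 v => ⟨fun h => ?_, fun h => ?_⟩
  · simp only [deadExpr, XE.holds_and, XE.holds_all, XE.holds_imp, XE.holds_not, XE.holds_eq,
      XE.holds_lt, XE.holds_read, holds_adj hS ht le_rfl, arr_setVar, XE.eval, setVar_var, hti,
      eval_nX ht (by omega), Nat.reduceEqDiff, if_true, if_false, mem_supp]
    refine and_congr_right fun _ => ⟨fun h a b h1 h2 h3 h4 => ?_, fun h a _ b _ h' => ?_⟩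
    · exact h a ((hG.lt' h1).trans hb1) b ((hG.lt' h2).trans hb1) ⟨h1, h2, h3, h4⟩
    · exact h a b h'.1 h'.2.1 h'.2.2.1 h'.2.2.2
  · refine h2 {v | v < n ∧ ¬ Core adj v} (fun U hU v _ hF => ⟨hF.1, fun hc => ?_⟩) v h
    obtain ⟨a, b, ha, hb, h1, h2, h3⟩ := hc.two
    exact h3 (hF.2 a b h1 h2 (fun h => (hU h).2 ha) fun h => (hU h).2 hb)
  · by_contra hv
    refine h.2 ⟨{v | v < n ∧ ¬ f v ≠ 0}, ⟨h.1, not_not.2 hv⟩, fun u hu => ?_⟩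
    have := mt (h1 u (hu.1.trans hb1)) hu.2
    simp only [not_and, not_forall, exists_prop] at this
    obtain ⟨a, b, h3, h4, h5, h6, h7⟩ := this hu.1
    exact ⟨a, ⟨hG.lt' h3, h5⟩, b, ⟨hG.lt' h4, h6⟩, h3, h4, h7⟩

theorem ready_core (hS : Setup L n adj X) (hs : Ready L n adj ms X 9 s) :
    Ready L n adj ms X 10 ((FP.table 10 9 coreExpr).run L s) := by
  have hb1 := hS.bounds.1
  refine hs.table (by omega) (Core adj) (fun i hi t ht hti => ?_) fun f hf v => ?_
  · have h8 : ∀ v, t.arr 8 v ≠ 0 ↔ v < n ∧ ¬ Core adj v := ht 8 (by omega)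
    simp only [coreExpr, XE.holds_and, XE.holds_not, XE.holds_lt, XE.holds_read, XE.eval, hti,
      eval_nX ht (by omega), h8]
    have := fun h : Core adj i => h.lt hS.graph
    tauto
  · rw [hf]
    exact ⟨fun h => h.2, fun h => ⟨(h.lt hS.graph).trans hb1, h⟩⟩

theorem ready_branch (hS : Setup L n adj X) (hs : Ready L n adj ms X 10 s) :
    Ready L n adj ms X 11 ((FP.table 10 10 branchExpr).run L s) := by
  have hG := hS.graph
  have hb1 := hS.bounds.1
  refine hs.table (by omega) (Branch adj) (fun i hi t ht hti => ?_) fun f hf v => ?_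
  · have h9 : ∀ v, t.arr 9 v ≠ 0 ↔ Core adj v := ht 9 (by omega)
    simp only [branchExpr, coreNbr, XE.holds_and, XE.holds_ex, XE.holds_not, XE.holds_eq,
      XE.holds_read, holds_adj hS ht (by omega), arr_setVar, XE.eval, setVar_var, hti, h9,
      Nat.reduceEqDiff, if_true, if_false]
    refine and_congr_right fun _ => ⟨?_, ?_⟩
    · rintro ⟨a, _, b, _, c, _, h⟩
      exact ⟨a, b, c, h⟩
    · rintro ⟨a, b, c, h⟩
      exact ⟨a, (h.1.1.lt hG).trans hb1, b, (h.2.1.1.lt hG).trans hb1, c,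
        (h.2.2.1.1.lt hG).trans hb1, h⟩
  · rw [hf]
    exact ⟨fun h => h.2, fun h => ⟨(h.1.lt hG).trans hb1, h⟩⟩

theorem ready_inner (hS : Setup L n adj X) (hs : Ready L n adj ms X 11 s) :
    Ready L n adj ms X 12 ((FP.table 10 11 innerExpr).run L s) := by
  have hG := hS.graph
  have hb1 := hS.bounds.1
  refine hs.table (by omega) (Inner adj) (fun i hi t ht hti => ?_) fun f hf v => ?_
  · have h9 : ∀ v, t.arr 9 v ≠ 0 ↔ Core adj v := ht 9 (by omega)
    have h10 : ∀ v, t.arr 10 v ≠ 0 ↔ Branch adj v := ht 10 (by omega)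
    simp only [innerExpr, XE.holds_and, XE.holds_all, XE.holds_imp, XE.holds_not,
      XE.holds_read, holds_adj hS ht (by omega), arr_setVar, XE.eval, setVar_var, hti, h9, h10,
      Nat.reduceEqDiff, if_true, if_false]
    refine and_congr_right fun _ => and_congr_right fun _ => ⟨fun h u hu => ?_, fun h u _ => h u⟩
    exact h u ((hG.lt' hu).trans hb1) hu
  · rw [hf]
    exact ⟨fun h => h.2, fun h => ⟨(h.1.lt hG).trans hb1, h⟩⟩

theorem ready_supp (hS : Setup L n adj X) (hs : Ready L n adj ms X 12 s) :
    Ready L n adj ms X 13 ((FP.table 10 12 suppExpr).run L s) := by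
  have hG := hS.graph
  have hb1 := hS.bounds.1
  refine hs.table (by omega) (Supp adj) (fun i hi t ht hti => ?_) fun f hf v => ?_
  · have h11 : ∀ v, t.arr 11 v ≠ 0 ↔ Inner adj v := ht 11 (by omega)
    simp only [suppExpr, XE.holds_and, XE.holds_ex, XE.holds_read, holds_adj hS ht (by omega),
      arr_setVar, XE.eval, setVar_var, hti, h11, Nat.reduceEqDiff, if_true, if_false]
    refine and_congr_right fun _ => ⟨fun ⟨u, _, h⟩ => ⟨u, h⟩, fun ⟨u, h⟩ => ⟨u, ?_, h⟩⟩
    exact (hG.lt' h.1).trans hb1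
  · rw [hf]
    exact ⟨fun h => h.2, fun h => ⟨(h.core.lt hG).trans hb1, h⟩⟩

theorem ready_keep (hS : Setup L n adj X) (hs : Ready L n adj ms X 13 s) :
    Ready L n adj ms X 14 ((FP.table 10 13 keepExpr).run L s) := by
  refine hs.table (by omega) (Keep adj) (fun i hi t ht hti => ?_) fun f hf v => ?_
  · have h9 : ∀ v, t.arr 9 v ≠ 0 ↔ Core adj v := ht 9 (by omega)
    have h12 : ∀ v, t.arr 12 v ≠ 0 ↔ Supp adj v := ht 12 (by omega)
    simp only [keepExpr, XE.holds_and, XE.holds_not, XE.holds_read, XE.eval, hti, h9, h12]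
    exact Iff.rfl
  · rw [hf]
    exact ⟨fun h => h.2, fun h => ⟨(h.1.lt hS.graph).trans hS.bounds.1, h⟩⟩

end

/-! ### Components of suppressed vertices and the size of the kernel -/

/-- Expression for: rule for `Link`. -/
def linkExpr : XE := (XE.var 10).isCode.and
  (((XE.eq (XE.fstX (.var 10)) (XE.sndX (.var 10))).and (.read 12 (XE.fstX (.var 10)))).or
    ((XE.read 12 (XE.sndX (.var 10))).and (.ex 20
      ((XE.relX 7 (.var 20) (XE.sndX (.var 10))).and
        (.read 14 (.codeX (XE.fstX (.var 10)) (.var 20)))))))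
/-- Expression for: `Bdry`. -/
def bdryExpr : XE := (XE.var 10).isCode.and ((XE.read 13 (XE.sndX (.var 10))).and
  (.ex 20 ((XE.relX 14 (XE.fstX (.var 10)) (.var 20)).and
    (.relX 7 (XE.sndX (.var 10)) (.var 20)))))
/-- Expression for: number of kept vertices before `var 10`. -/
def rankExpr : XE := .count 20 ((XE.lt (.var 20) (.var 10)).and (.read 13 (.var 20)))
/-- Expression for: `rk`. -/
def tripleExpr : XE := .add rankExpr (.add rankExpr rankExpr)
/-- Expression for: rule for reachability from the vertex `0`. -/
def reachExpr : XE := (XE.eq (.var 10) (.const 0)).or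
  (.ex 20 ((XE.read 17 (.var 20)).and (.relX 7 (.var 20) (.var 10))))
/-- Expression for: `AddTwo`. -/
def addTwoExpr : XE := (XE.lt (.const 1) .nX).and (.ex 20 ((XE.lt (.var 20) .nX).and
  ((XE.not (.read 13 (.var 20))).and ((XE.not (.read 9 (.var 20))).or (XE.not (.eq .nX (.const 3)))))))
/-- Expression for: `kerSize`. -/
def kerSizeExpr : XE := .add (.read 16 .nX) (.cond addTwoExpr (.const 2) (.const 0))
/-- Expression for: multiples of `kerSize`. -/
def kerRowExpr : XE := .sum 20 (.cond (.lt (.var 20) (.var 10)) (.read 18 (.const 0)) (.const 0))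

section

variable {L n : ℕ} {adj ms : ℕ → ℕ → Prop} {X : ℕ → Prop} {k j : ℕ} {s : State} {A : ℕ → ℕ → ℕ}

theorem Supp.lt (hG : IsGraph n adj) {v : ℕ} (h : Supp adj v) : v < n := h.core.lt hG

/-- The fixed point is over codes of pairs; its rule is the inductive definition of `Link`,
extending a pair at its second vertex. -/
theorem ready_link (hS : Setup L n adj X) (hs : Ready L n adj ms X 14 s) :
    Ready L n adj ms X 15 ((FP.closure 11 10 14 linkExpr).run L s) := by
  have hG := hS.graph
  obtain ⟨hb1, hb2, -, -⟩ := hS.bounds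
  refine hs.closure (by omega) (by omega)
    (fun U e => e < n * n ∧ ((e / n = e % n ∧ Supp adj (e / n)) ∨ (Supp adj (e % n) ∧
      ∃ v, adj v (e % n) ∧ e / n * n + v ∈ U)))
    (fun i hi t ht hti => ?_) fun f h1 h2 e => ⟨fun h => ?_, fun h => ?_⟩
  · rw [linkExpr, XE.holds_and, holds_isCode hS ht (by omega) rfl, XE.eval, hti]
    refine and_congr_right fun he => ?_
    have h12 : ∀ v, t.arr 12 v ≠ 0 ↔ Supp adj v := ht 12 (by omega)
    have hf : ∀ v, (XE.fstX (.var 10)).eval L (t.setVar 20 v) = i / n := fun v => by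
      rw [eval_fstX ht (by omega) (arr_setVar _ _ _)] <;> simp [XE.eval, hti, he]
    have hs : ∀ v, (XE.sndX (.var 10)).eval L (t.setVar 20 v) = i % n := fun v => by
      rw [eval_sndX ht (by omega) (arr_setVar _ _ _)] <;> simp [XE.eval, hti, he]
    have hf0 : (XE.fstX (.var 10)).eval L t = i / n := hf 0
    have hs0 : (XE.sndX (.var 10)).eval L t = i % n := hs 0
    have hc : ∀ v, (XE.codeX (XE.fstX (.var 10)) (.var 20)).eval L (t.setVar 20 v) =
        i / n * n + v := fun v => by
      rw [eval_codeX hS ht (by omega) (arr_setVar _ _ _) (by rw [hf]; exact (code_lt he).1), hf]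
      simp [XE.eval]
    simp only [XE.holds_and, XE.holds_or, XE.holds_ex, XE.holds_eq, XE.holds_read,
      holds_adj hS ht (by omega), arr_setVar, hs, hf0, hs0, hc, h12, mem_supp]
    simp only [XE.eval, setVar_var, if_true]
    refine or_congr Iff.rfl (and_congr_right fun _ => ⟨fun ⟨v, _, h⟩ => ⟨v, h⟩, fun ⟨v, h⟩ =>
      ⟨v, (hG.lt h.1).trans hb1, h⟩⟩)
  · refine h2 {e | e < n * n ∧ Link adj (e / n) (e % n)} (fun U hU e _ hF => ⟨hF.1, ?_⟩) e h
    rcases hF.2 with ⟨h3, h4⟩ | ⟨h3, v, h4, h5⟩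
    · rw [← h3]
      exact .refl h4
    · have := (hU h5).2
      rw [code_div (hG.lt h4), code_mod (hG.lt h4)] at this
      exact .step this h4 h3
  · have key : ∀ u v, Link adj u v → f (u * n + v) ≠ 0 := by
      intro u v huv
      induction huv with
      | @refl hv =>
        have hvn := hv.lt hG
        have := pair_lt hvn hvn
        refine h1 _ (by omega) ⟨this, Or.inl ?_⟩
        rw [code_div hvn, code_mod hvn]
        exact ⟨rfl, hv⟩
      | @step v w huv hvw hw ih =>
        have hwn := hw.lt hG
        have := pair_lt (huv.left.lt hG) hwn
        refine h1 _ (by omega) ⟨this, Or.inr ?_⟩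
        rw [code_div hwn, code_mod hwn]
        exact ⟨hw, v, hvw, ih⟩
    have := key _ _ h.2
    rwa [Nat.div_add_mod'] at this

theorem holds_link (hS : Setup L n adj X) (hA : Facts L n adj ms X k A) (hk : 15 ≤ k) :
    ∀ ⦃s : State⦄, s.arr = A → ∀ {a b : XE},
      (XE.relX 14 a b).holds L s ↔ Link adj (a.eval L s) (b.eval L s) :=
  holds_relX hS hA (by omega) (fun _ _ h => ⟨h.left.lt hS.graph, h.right.lt hS.graph⟩)
    (hA 14 (by omega))

theorem ready_bdry (hS : Setup L n adj X) (hs : Ready L n adj ms X 15 s) :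
    Ready L n adj ms X 16 ((FP.table 10 15 bdryExpr).run L s) := by
  have hG := hS.graph
  obtain ⟨hb1, hb2, -, -⟩ := hS.bounds
  refine hs.table (by omega) (fun e => e < n * n ∧ Bdry adj (e / n) (e % n))
    (fun i hi t ht hti => ?_) fun f hf v => ?_
  · rw [bdryExpr, XE.holds_and, holds_isCode hS ht (by omega) rfl, XE.eval, hti]
    refine and_congr_right fun he => ?_
    have h13 : ∀ v, t.arr 13 v ≠ 0 ↔ Keep adj v := ht 13 (by omega)
    have hf : ∀ v, (XE.fstX (.var 10)).eval L (t.setVar 20 v) = i / n := fun v => by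
      rw [eval_fstX ht (by omega) (arr_setVar _ _ _)] <;> simp [XE.eval, hti, he]
    have hs : ∀ v, (XE.sndX (.var 10)).eval L (t.setVar 20 v) = i % n := fun v => by
      rw [eval_sndX ht (by omega) (arr_setVar _ _ _)] <;> simp [XE.eval, hti, he]
    have hs0 : (XE.sndX (.var 10)).eval L t = i % n := hs 0
    simp only [XE.holds_and, XE.holds_ex, XE.holds_read, holds_adj hS ht (by omega),
      holds_link hS ht le_rfl, arr_setVar, hf, hs, hs0, h13]
    simp only [XE.eval, setVar_var, if_true]
    exact and_congr_right fun _ => ⟨fun ⟨v, _, h⟩ => ⟨v, h⟩, fun ⟨v, h⟩ =>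
      ⟨v, (h.1.right.lt hG).trans hb1, h⟩⟩
  · rw [hf]
    exact ⟨fun h => h.2, fun h => ⟨by omega, h⟩⟩

theorem holds_bdry (hS : Setup L n adj X) (hA : Facts L n adj ms X k A) (hk : 16 ≤ k) :
    ∀ ⦃s : State⦄, s.arr = A → ∀ {a b : XE},
      (XE.relX 15 a b).holds L s ↔ Bdry adj (a.eval L s) (b.eval L s) :=
  holds_relX hS hA (by omega) (fun _ _ h => ⟨h.supp.lt hS.graph, h.1.1.lt hS.graph⟩)
    (hA 15 (by omega))

theorem ready_rank (hs : Ready L n adj ms X 16 s) :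
    Ready L n adj ms X 17 ((FP.table 10 16 tripleExpr).run L s) := by
  classical
  refine hs.table_val (by omega) (rk adj) (fun i hi t _ ht hti => ?_) fun f hf => hf
  have h13 : ∀ v, t.arr 13 v ≠ 0 ↔ Keep adj v := ht 13 (by omega)
  have : rankExpr.eval L t = ((Finset.range i).filter (Keep adj)).card := by
    rw [rankExpr, XE.eval_count]
    congr 1
    ext a
    simp only [Finset.mem_filter, Finset.mem_range, XE.holds_and, XE.holds_lt, XE.holds_read,
      arr_setVar, XE.eval, setVar_var, hti, h13, Nat.reduceEqDiff, if_true, if_false]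
    constructor
    · exact fun h => h.2
    · exact fun h => ⟨by omega, h⟩
  rw [tripleExpr, XE.eval, XE.eval, this, rk]
  omega

theorem ready_reach (hS : Setup L n adj X) (hs : Ready L n adj ms X 17 s) :
    Ready L n adj ms X 18 ((FP.closure 11 10 17 reachExpr).run L s) := by
  have hG := hS.graph
  obtain ⟨hb1, hb2, -, -⟩ := hS.bounds
  refine hs.closure (by omega) (by omega) (fun U v => v = 0 ∨ ∃ u, u ∈ U ∧ adj u v)
    (fun i hi t ht hti => ?_) fun f h1 h2 v => ⟨fun h => ?_, fun h => ?_⟩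
  · simp only [reachExpr, XE.holds_or, XE.holds_and, XE.holds_ex, XE.holds_eq, XE.holds_read,
      holds_adj hS ht (by omega), arr_setVar, XE.eval, setVar_var, hti, Nat.reduceEqDiff, if_true,
      if_false, mem_supp]
    exact or_congr Iff.rfl ⟨fun ⟨u, _, h⟩ => ⟨u, h⟩, fun ⟨u, h⟩ => ⟨u, (hG.lt h.2).trans hb1, h⟩⟩
  · refine h2 {v | ReflTransGen adj 0 v} (fun U hU v _ hF => ?_) v h
    rcases hF with rfl | ⟨u, hu, huv⟩
    · exact .refl
    · exact .tail (hU hu) huv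
  · induction h with
    | refl => exact h1 0 (by omega) (Or.inl rfl)
    | tail _ h ih => exact h1 _ ((hG.lt' h).trans hb1) (Or.inr ⟨_, ih, h⟩)

theorem ready_kerSize (hS : Setup L n adj X) (hs : Ready L n adj ms X 18 s) :
    Ready L n adj ms X 19 ((FP.table 10 18 kerSizeExpr).run L s) := by
  classical
  obtain ⟨hb1, hb2, -, -⟩ := hS.bounds
  refine hs.table_val (by omega) (fun _ => kerSize n adj) (fun i hi t _ ht hti => ?_)
    fun f hf => hf 0 (by omega)
  have h9 : ∀ v, t.arr 9 v ≠ 0 ↔ Core adj v := ht 9 (by omega)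
  have h13 : ∀ v, t.arr 13 v ≠ 0 ↔ Keep adj v := ht 13 (by omega)
  have h16 : t.arr 16 n = rk adj n := ht 16 (by omega) n hb1
  have : addTwoExpr.holds L t ↔ AddTwo n adj := by
    simp only [addTwoExpr, XE.holds_and, XE.holds_or, XE.holds_not, XE.holds_ex, XE.holds_eq,
      XE.holds_lt, XE.holds_read, arr_setVar, eval_nX (s := t) ht (by omega), XE.eval, setVar_var,
      if_true, h9, h13, eval_nX (s := t.setVar 20 _) ht (by omega)]
    refine and_congr Iff.rfl ⟨?_, ?_⟩
    · rintro ⟨v, _, h1, h2, h3⟩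
      exact ⟨v, h1, h2, h3⟩
    · rintro ⟨v, h1, h2, h3⟩
      exact ⟨v, by omega, h1, h2, h3⟩
  rw [kerSizeExpr, XE.eval, XE.eval, XE.eval, eval_nX ht (by omega), h16, kerSize]
  congr 1
  by_cases h : AddTwo n adj
  · rw [if_pos (show addTwoExpr.eval L t ≠ 0 from this.2 h), if_pos h]; rfl
  · rw [if_neg (show ¬ addTwoExpr.eval L t ≠ 0 from mt this.1 h), if_neg h]; rfl

theorem ready_kerRow (hs : Ready L n adj ms X 19 s) :
    Ready L n adj ms X 20 ((FP.table 10 19 kerRowExpr).run L s) := by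
  refine hs.table_val (by omega) (fun i => i * kerSize n adj) (fun i hi t _ ht hti => ?_)
    fun f hf => hf
  have h3 : t.arr 18 0 = kerSize n adj := ht 18 (by omega)
  simp only [kerRowExpr, XE.eval, arr_setVar, h3, setVar_var, if_true, hti, Nat.reduceEqDiff,
    if_false]
  have : ∀ k, (if (if k < i then 1 else 0) ≠ 0 then kerSize n adj else 0) =
      if k < i then kerSize n adj else 0 := by
    intro k; by_cases h : k < i <;> simp [h]
  simp only [this]
  rw [← Finset.sum_filter, Finset.sum_const, smul_eq_mul]
  congr 1
  have : (Finset.range L).filter (· < i) = Finset.range i := by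
    ext a; simp only [Finset.mem_filter, Finset.mem_range]; omega
  rw [this, Finset.card_range]

end

/-- The computation of the arrays `3` to `19`. -/
def analysis : FP :=
  .seq (.table 10 3 sizeExpr) <| .seq (.table 10 4 rowExpr) <| .seq (.table 10 5 fstExpr) <|
  .seq (.table 10 6 sndExpr) <| .seq (.table 10 7 adjExpr) <| .seq (.closure 11 10 8 deadExpr) <|
  .seq (.table 10 9 coreExpr) <| .seq (.table 10 10 branchExpr) <|
  .seq (.table 10 11 innerExpr) <| .seq (.table 10 12 suppExpr) <|
  .seq (.table 10 13 keepExpr) <| .seq (.closure 11 10 14 linkExpr) <|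
  .seq (.table 10 15 bdryExpr) <| .seq (.table 10 16 tripleExpr) <|
  .seq (.closure 11 10 17 reachExpr) <| .seq (.table 10 18 kerSizeExpr) (.table 10 19 kerRowExpr)

theorem analysis_wf : analysis.wf = true := by decide

theorem ready_analysis {L n : ℕ} {adj ms : ℕ → ℕ → Prop} {X : ℕ → Prop} {s : State}
    (hS : Setup L n adj X) (hs : Ready L n adj ms X 3 s) :
    Ready L n adj ms X 20 (analysis.run L s) :=
  ready_kerRow <| ready_kerSize hS <| ready_reach hS <| ready_rank <| ready_bdry hS <|
    ready_link hS <| ready_keep hS <| ready_supp hS <| ready_inner hS <| ready_branch hS <|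
    ready_core hS <| ready_dead hS <| ready_adj hS <| ready_snd hS <| ready_fst hS <|
    ready_row <| ready_size hS hs

end EnumKernel

namespace EnumKernel

open Relation Polynomial

/-! ## The kernelization algorithm -/

/-- Conversion of `e` into the value `(3 e + 3) ^ 2`, for the variable `0`. -/
def boundExpr : XE :=
  let three : XE → XE := fun e => .add e (.add e e)
  .add (.sum 20 (.add (three (three (.var 0))) (.const 18))) (.const 9)

/-- The first part of both algorithms. -/
def prelude : Program :=
  .seq (FP.assign 9 boundExpr).code (.seq (.assign 0 (.var 9)) analysis.code)

/-- The number of cells of the arrays that are used, as a function of the length of the input. -/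
noncomputable def boundPoly : ℕ[X] := (3 * X + 3) * (3 * X + 3)

noncomputable def preludeTime : ℕ[X] :=
  (FP.assign 9 boundExpr).time + (2 + analysis.time.comp boundPoly)

theorem boundPoly_eval (l : ℕ) : boundPoly.eval l = (3 * l + 3) * (3 * l + 3) := by
  simp [boundPoly]

theorem setup_graphOf (x : List Bool) : Setup (boundPoly.eval x.length) (numVertices x)
    (natAdj (graphOf x)) fun i => x.getD i false = true where
  graph := isGraph_natAdj _
  lt_iff := lt_numVertices_iff x
  adj_iff := natAdj_graphOf x
  le := by
    have := numVertices_le x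
    rw [boundPoly_eval]
    gcongr

theorem Agree.ready {L n : ℕ} {adj ms : ℕ → ℕ → Prop} {X : ℕ → Prop} {k : ℕ} {s t : State}
    (h : Agree s t) (ht : Ready L n adj ms X k t) : Ready L n adj ms X k s where
  facts := by rw [h.1]; exact ht.facts
  zero := by rw [h.1]; exact ht.zero
  var := (h.2 0 (by omega)).trans ht.var

/-- The loop bound `(3 |x| + 3)²` is computed with the length of `x`, initially in the variable `0`,
as loop bound, and then replaces it there. Hence the time of the analysis is composed with
`boundPoly`. -/
theorem runs_prelude (x : List Bool) {ms : ℕ → ℕ → Prop} {ws : List (List Bool)}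
    (hw : ws.length ≤ 2) (hms : Fact (boundPoly.eval x.length) (numVertices x) (natAdj (graphOf x))
      ms (fun i => x.getD i false = true) 2 ((initState (x :: ws)).arr 2)) :
    Runs prelude (initState (x :: ws)) (preludeTime.eval x.length)
      (Ready (boundPoly.eval x.length) (numVertices x) (natAdj (graphOf x)) ms
        (fun i => x.getD i false = true) 20) := by
  rw [prelude, preludeTime, eval_add, eval_add]
  have h1 := FP.runs_code (L := x.length) (FP.assign 9 boundExpr) (by decide)
    (Agree.refl (initState (x :: ws))) rfl
  refine h1.seq fun s₁ hs₁ => ?_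
  have h9 : s₁.var 9 = boundPoly.eval x.length := by
    rw [hs₁.2 9 (by omega), FP.run, setVar_var, if_pos rfl, boundPoly_eval]
    have h0 : (initState (x :: ws)).var 0 = x.length := rfl
    simp only [boundExpr, XE.eval, setVar_var, OfNat.zero_ne_ofNat, if_false, h0, Finset.sum_const,
      Finset.card_range, smul_eq_mul]
    -- With `l = |x|`, the `l` summands `9 l + 18` and the constant `9` give `(3 l + 3)²`.
    ring
  have h2 : Runs (.assign 0 (.var 9)) s₁ 2 fun t => t = s₁.setVar 0 (boundPoly.eval x.length) :=
    .assign (by simp [RExpr.cost]) (by rw [RExpr.eval, h9])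
  rw [eval_ofNat, eval_comp]
  refine h2.seq fun s₂ hs₂ => ?_
  have hR : Ready (boundPoly.eval x.length) (numVertices x) (natAdj (graphOf x)) ms
        (fun i => x.getD i false = true) 3 s₂ := by
    have harr : s₂.arr = (initState (x :: ws)).arr := by rw [hs₂, arr_setVar, hs₁.1]; rfl
    refine ⟨fun a ha => ?_, fun a ha i => ?_, by simp [hs₂]⟩
    · rw [harr]
      have ha' : a = 0 ∨ a = 1 ∨ a = 2 := by omega
      rcases ha' with rfl | rfl | rfl
      · intro i
        simp [initState]
      · trivial
      · exact hms
    · rw [harr]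
      have : (x :: ws).getD a [] = [] := List.getD_eq_default _ _ (by simp; omega)
      simp only [initState, this, List.getD_nil, Bool.false_eq_true, if_false]
  refine (FP.runs_code analysis analysis_wf (Agree.refl s₂) hR.var).mono le_rfl fun s₃ hs₃ => ?_
  exact hs₃.ready (ready_analysis (setup_graphOf x) hR)

/-- Expression for: `KerAdj`. -/
def kerAdjExpr (a b : XE) : XE :=
  let inTriangle : XE → XE → XE := fun a w =>
    (XE.not (.lt a (.read 16 w))).and (.lt a (.add (.read 16 w) (.const 3)))
  ((XE.not (.eq a b)).and (.ex 22 ((XE.read 13 (.var 22)).and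
    ((inTriangle a (.var 22)).and (inTriangle b (.var 22)))))).or
  ((XE.ex 22 (.ex 23 ((XE.read 13 (.var 22)).and ((XE.read 13 (.var 23)).and
    ((XE.relX 7 (.var 22) (.var 23)).and ((XE.eq a (.read 16 (.var 22))).and
      (.eq b (.read 16 (.var 23))))))))).or
  (XE.ex 22 (.ex 23 (((XE.not (.eq (.var 22) (.var 23))).and (.ex 24
    ((XE.relX 15 (.var 24) (.var 22)).and (.relX 15 (.var 24) (.var 23))))).and
      ((XE.eq a (.add (.read 16 (.var 22)) (.const 1))).and
        (.eq b (.add (.read 16 (.var 23)) (.const 1))))))))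

/-- Expression for: the encoding of the kernel. -/
def kernelExpr : XE :=
  (XE.lt (.var 10) (.read 18 (.const 0))).or (.ex 20 ((XE.lt (.var 20) (.read 18 (.const 0))).and
    (.ex 21 ((XE.lt (.var 21) (.read 18 (.const 0))).and ((XE.eq (.var 10)
      (.add (.add (.read 18 (.const 0)) (.const 1)) (.add (.read 19 (.var 20)) (.var 21)))).and
        (kerAdjExpr (.var 20) (.var 21)))))))

section

variable {L n : ℕ} {adj ms : ℕ → ℕ → Prop} {X : ℕ → Prop} {k j : ℕ} {s t : State} {A : ℕ → ℕ → ℕ}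

theorem holds_kerAdjExpr (hS : Setup L n adj X) (hA : Facts L n adj ms X k t.arr) (hk : 17 ≤ k)
    (hs : s.arr = t.arr) :
    (kerAdjExpr (.var 20) (.var 21)).holds L s ↔ KerAdj adj (s.var 20) (s.var 21) := by
  have hG := hS.graph
  have hb1 := hS.bounds.1
  have h13 : ∀ v, t.arr 13 v ≠ 0 ↔ Keep adj v := hA 13 (by omega)
  have h16 : ∀ w < L, t.arr 16 w = rk adj w := hA 16 (by omega)
  simp only [kerAdjExpr, XE.holds_or, XE.holds_and, XE.holds_not, XE.holds_ex, XE.holds_eq,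
    XE.holds_lt, XE.holds_read, holds_adj hS hA (by omega), holds_bdry hS hA (by omega), arr_setVar,
    XE.eval, setVar_var, hs, h13, Nat.reduceEqDiff, if_true, if_false, not_lt]
  refine or_congr (and_congr_right fun _ => ⟨?_, ?_⟩) (or_congr ⟨?_, ?_⟩ ⟨?_, ?_⟩)
  · rintro ⟨w, hw, h⟩
    rw [h16 w hw] at h
    exact ⟨w, h.1, h.2.1, h.2.2⟩
  · rintro ⟨w, h⟩
    have hw := (h.1.1.lt hG).trans hb1
    rw [← h16 w hw] at h
    exact ⟨w, hw, h.1, h.2.1, h.2.2⟩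
  · rintro ⟨w, hw, w', hw', h⟩
    rw [h16 w hw, h16 w' hw'] at h
    exact ⟨w, w', h⟩
  · rintro ⟨w, w', h⟩
    have hw := (h.1.1.lt hG).trans hb1
    have hw' := (h.2.1.1.lt hG).trans hb1
    rw [← h16 w hw, ← h16 w' hw'] at h
    exact ⟨w, hw, w', hw', h⟩
  · rintro ⟨w, hw, w', hw', ⟨h1, q, _, h2⟩, h3⟩
    rw [h16 w hw, h16 w' hw'] at h3
    exact ⟨w, w', ⟨h1, q, h2⟩, h3⟩
  · rintro ⟨w, w', ⟨h1, q, h2⟩, h3⟩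
    have hw := (h2.1.1.1.lt hG).trans hb1
    have hw' := (h2.2.1.1.lt hG).trans hb1
    rw [← h16 w hw, ← h16 w' hw'] at h3
    exact ⟨w, hw, w', hw', ⟨h1, q, (h2.1.supp.lt hG).trans hb1, h2⟩, h3⟩

theorem run_kernelExpr (hS : Setup L n adj X) (hs : Ready L n adj ms X 20 s) :
    Same 20 s ((FP.table 10 20 kernelExpr).run L s) ∧ ∀ e < L,
      (((FP.table 10 20 kernelExpr).run L s).arr 20 e ≠ 0 ↔
        e < kerSize n adj ∨ ∃ h < kerSize n adj, ∃ h' < kerSize n adj,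
          e = kerSize n adj + 1 + (h * kerSize n adj + h') ∧ KerAdj adj h h') := by
  have hb := hS.bounds.2.2.1
  have key : ∀ e < L, ∀ t, Same 20 s t → t.var 10 = e → (kernelExpr.holds L t ↔
      (e < kerSize n adj ∨ ∃ h < kerSize n adj, ∃ h' < kerSize n adj,
          e = kerSize n adj + 1 + (h * kerSize n adj + h') ∧ KerAdj adj h h')) := by
    intro i hi t hst hti
    have ht := hs.facts.same hst le_rfl
    have h18 : t.arr 18 0 = kerSize n adj := ht 18 (by omega)
    have h19 : ∀ h < L, t.arr 19 h = h * kerSize n adj := ht 19 (by omega)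
    simp only [kernelExpr, XE.holds_or, XE.holds_and, XE.holds_ex, XE.holds_eq, XE.holds_lt,
      holds_kerAdjExpr hS ht (by omega), arr_setVar, XE.eval, setVar_var, hti, h18,
      Nat.reduceEqDiff, if_true, if_false]
    refine or_congr Iff.rfl ⟨?_, ?_⟩
    · rintro ⟨h, hh, h1, h', _, h2, h3, h4⟩
      rw [h19 h hh] at h3
      exact ⟨h, h1, h', h2, h3, h4⟩
    · rintro ⟨h, h1, h', h2, h3, h4⟩
      refine ⟨h, by omega, h1, h', by omega, h2, ?_, h4⟩
      rwa [h19 h (by omega)]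
  obtain ⟨h1, h2⟩ := FP.run_table_holds (by omega) key
  exact ⟨h1, fun e he => (h2 e).trans (by rw [if_pos he])⟩

end

/-- The kernelization algorithm. -/
def kernelProgram : Program :=
  .seq prelude (.seq (FP.table 10 20 kernelExpr).code
    (.emit 20 (.add (.add (.read 18 (.const 0)) (.const 1)) (.read 19 (.read 18 (.const 0))))))

/-- The instance that the kernelization algorithm computes. -/
noncomputable def kernelOf (x : List Bool) : List Bool :=
  encGraph (kerSize (numVertices x) (natAdj (graphOf x))) (KerAdj (natAdj (graphOf x)))

theorem runsTo_kernelProgram : ∃ p : ℕ[X], ∀ x : List Bool, ∃ τ,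
    RunsTo kernelProgram [x] τ ∧ outputs τ = [kernelOf x] ∧ runTime τ ≤ p.eval x.length := by
  classical
  -- The output costs `8` for its length expression, `1` for the instruction, and its length, which
  -- is at most the loop bound.
  refine ⟨preludeTime + ((FP.table 10 20 kernelExpr).time.comp boundPoly + (9 + boundPoly)),
    fun x => ?_⟩
  have hS := setup_graphOf x
  have h1 := runs_prelude x (ms := fun _ _ => False) (ws := []) (by simp) (fun i _ j _ => by
    simp [initState])
  obtain ⟨τ₁, s₁, hx₁, hs₁, hR⟩ := h1
  obtain ⟨h2, h3⟩ := run_kernelExpr hS hR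
  obtain ⟨τ₂, s₂, hx₂, hs₂, hag⟩ := FP.runs_code (FP.table 10 20 kernelExpr) (by decide)
    (Agree.refl s₁) hR.var
  have harr : ∀ a < 20, s₂.arr a = s₁.arr a := fun a ha => by rw [hag.1, h2.2 a (by omega)]
  have h18 : s₂.arr 18 0 = kerSize (numVertices x) (natAdj (graphOf x)) := by
    rw [harr 18 (by omega)]; exact hR.facts 18 (by omega)
  have h19 : s₂.arr 19 (kerSize (numVertices x) (natAdj (graphOf x))) = kerSize (numVertices x) (natAdj (graphOf x)) * kerSize (numVertices x) (natAdj (graphOf x)) := by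
    rw [harr 19 (by omega)]; exact hR.facts 19 (by omega) _ hS.bounds.2.2.1
  have hlen : (RExpr.add (.add (.read 18 (.const 0)) (.const 1))
      (.read 19 (.read 18 (.const 0)))).eval s₂ =
        kerSize (numVertices x) (natAdj (graphOf x)) + 1 +
          kerSize (numVertices x) (natAdj (graphOf x)) *
            kerSize (numVertices x) (natAdj (graphOf x)) := by
    simp only [RExpr.eval, h18, h19]
  refine ⟨_, ⟨s₂, .seq hx₁ (.seq hx₂ (.emit _ _ _))⟩, ?_, ?_⟩
  · rw [outputs_append, outputs_append, outputs_append, hs₁.1, hs₂.1, outputs_ticks, hlen]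
    simp only [outputs, List.nil_append, List.filterMap_cons, List.filterMap_nil]
    congr 1
    rw [State.word, kernelOf, encGraph]
    refine List.map_congr_left fun e he => ?_
    have he' : e < boundPoly.eval x.length := by
      have := hS.bounds.2.2.2
      have := List.mem_range.1 he
      omega
    rw [decide_eq_decide, hag.1]
    exact h3 e he'
  · rw [runTime_append, runTime_append, runTime_append, runTime_ticks, hlen]
    simp only [eval_add, eval_comp, eval_ofNat, RExpr.cost, runTime]
    have := hS.bounds.2.2.2
    have := hs₁.2
    have := hs₂.2
    omega

end EnumKernel

namespace EnumKernel

open Relation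

/-! ## Expressions for the solution-lifting algorithm -/

/-- Equivalence. -/
def XE.iff (a b : XE) : XE := .eq a.not b.not

theorem XE.holds_iff {L : ℕ} {s : State} {a b : XE} :
    (a.iff b).holds L s ↔ (a.holds L s ↔ b.holds L s) := by
  by_cases h : a.eval L s = 0 <;> by_cases h' : b.eval L s = 0 <;>
    simp [holds, XE.iff, XE.not, eval, h, h']

/-- Reading of the kernel solution. -/
def solX (a b : XE) : XE := .read 2 (.add (.read 19 a) b)
/-- Expression for: `Touched`. -/
def touchedExpr : XE := (XE.read 13 (.var 10)).and (.ex 20 ((XE.read 13 (.var 20)).and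
  ((XE.relX 7 (.var 10) (.var 20)).and (solX (.read 16 (.var 10)) (.read 16 (.var 20))))))
/-- Expression for: `Target`. -/
def targetExpr : XE := .ex 20 (.ex 21 ((XE.not (.eq (.var 20) (.var 21))).and
  ((XE.relX 15 (.var 10) (.var 20)).and ((XE.relX 15 (.var 10) (.var 21)).and
    (solX (.add (.read 16 (.var 20)) (.const 1)) (.add (.read 16 (.var 21)) (.const 1)))))))
/-- Expression for: `Avail`. -/
def availExpr : XE :=
  let a := XE.fstX (.var 10)
  let b := XE.sndX (.var 10)
  (XE.var 10).isCode.and ((XE.lt a b).and ((XE.relX 7 a b).and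
    ((XE.not ((XE.read 13 a).and (.read 13 b))).and ((XE.not (.read 20 a)).and (XE.not (.read 20 b))))))

/-- The code `e` belongs to an edge of the class of `q`. -/
def clsX (q e : XE) : XE := (XE.relX 7 e.fstX e.sndX).and ((XE.read 9 e.fstX).and
  ((XE.read 9 e.sndX).and ((XE.relX 14 q e.fstX).or (.relX 14 q e.sndX))))
/-- Expression for: `Meet`. -/
def meetX (e f : XE) : XE := (XE.eq e.fstX f.fstX).or ((XE.eq e.fstX f.sndX).or
  ((XE.eq e.sndX f.fstX).or (.eq e.sndX f.sndX)))

/-- The expression for `Extends`, for the set given by `bit` and the number given by `t`. -/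
def extendsX (bit : XE → XE) (t : XE) : XE :=
  (XE.all 20 ((bit (.var 20)).imp (.read 22 (.var 20)))).and
  ((XE.all 20 (.all 21 (((bit (.var 20)).and ((bit (.var 21)).and (meetX (.var 20) (.var 21)))).imp
    (.eq (.var 20) (.var 21))))).and
  (.all 22 ((XE.read 12 (.var 22)).imp
    (((XE.ex 23 (.eq (.count 20 ((bit (.var 20)).and (clsX (.var 22) (.var 20))))
      (.add (.add (.var 23) (.var 23)) (.const 1)))).iff (.read 21 (.var 22))).or
    (.ex 21 ((XE.not (.lt (.var 21) t)).and ((XE.read 22 (.var 21)).and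
      ((clsX (.var 22) (.var 21)).and
        (.all 20 ((bit (.var 20)).imp (XE.not (meetX (.var 20) (.var 21)))))))))))))

section

variable {L n : ℕ} {adj ms : ℕ → ℕ → Prop} {X : ℕ → Prop} {k j : ℕ} {s : State} {A : ℕ → ℕ → ℕ}

theorem holds_solX (hS : Setup L n adj X) (hA : Facts L n adj ms X k A) (hk : 20 ≤ k)
    (hs : s.arr = A) {a b : XE} (ha : a.eval L s < kerSize n adj) (hb : b.eval L s < kerSize n adj) :
    (solX a b).holds L s ↔ ms (a.eval L s) (b.eval L s) := by
  subst hs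
  have h19 : s.arr 19 (a.eval L s) = a.eval L s * kerSize n adj :=
    hA 19 (by omega) _ (ha.trans hS.bounds.2.2.1)
  rw [solX, XE.holds_read, XE.eval, XE.eval, h19]
  exact hA 2 (by omega) _ ha _ hb

theorem ready_touched (hS : Setup L n adj X) (hs : Ready L n adj ms X 20 s) :
    Ready L n adj ms X 21 ((FP.table 10 20 touchedExpr).run L s) := by
  have hG := hS.graph
  have hb1 := hS.bounds.1
  refine hs.table (by omega) (Touched adj ms) (fun i hi t ht hti => ?_) fun f hf v => ?_
  · have h13 : ∀ v, t.arr 13 v ≠ 0 ↔ Keep adj v := ht 13 (by omega)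
    have h16 : ∀ w < L, t.arr 16 w = rk adj w := ht 16 (by omega)
    have hsz : ∀ {w}, Keep adj w → rk adj w < kerSize n adj := fun hw => by
      have := rk_add_le_size hG hw
      have := rk_le_kerSize (n := n) (adj := adj)
      omega
    have hsol : ∀ u < L, Keep adj i → Keep adj u →
        ((solX (.read 16 (.var 10)) (.read 16 (.var 20))).holds L (t.setVar 20 u) ↔
          ms (rk adj i) (rk adj u)) := by
      intro u hu h1 h2
      have e1 : (XE.read 16 (.var 10)).eval L (t.setVar 20 u) = rk adj i := by
        simp [XE.eval, hti, h16 i hi]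
      have e2 : (XE.read 16 (.var 20)).eval L (t.setVar 20 u) = rk adj u := by
        simp [XE.eval, h16 u hu]
      rw [holds_solX hS ht le_rfl (arr_setVar _ _ _) (by rw [e1]; exact hsz h1)
        (by rw [e2]; exact hsz h2), e1, e2]
    simp only [touchedExpr, XE.holds_and, XE.holds_ex, XE.holds_read, holds_adj hS ht (by omega),
      arr_setVar, XE.eval, setVar_var, hti, h13, Nat.reduceEqDiff, if_true, if_false]
    refine and_congr_right fun h1 => ⟨?_, ?_⟩
    · rintro ⟨u, hu, h2, h3, h4⟩
      exact ⟨u, h2, h3, (hsol u hu h1 h2).1 h4⟩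
    · rintro ⟨u, h2, h3, h4⟩
      have hu := (h2.1.lt hG).trans hb1
      exact ⟨u, hu, h2, h3, (hsol u hu h1 h2).2 h4⟩
  · rw [hf]
    exact ⟨fun h => h.2, fun h => ⟨(h.1.1.lt hG).trans hb1, h⟩⟩

theorem ready_target (hS : Setup L n adj X) (hs : Ready L n adj ms X 21 s) :
    Ready L n adj ms X 22 ((FP.table 10 21 targetExpr).run L s) := by
  have hG := hS.graph
  have hb1 := hS.bounds.1
  refine hs.table (by omega) (Target adj ms) (fun i hi t ht hti => ?_) fun f hf v => ?_
  · have h16 : ∀ w < L, t.arr 16 w = rk adj w := ht 16 (by omega)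
    have hsz : ∀ {w}, Keep adj w → rk adj w + 1 < kerSize n adj := fun hw => by
      have := rk_add_le_size hG hw
      have := rk_le_kerSize (n := n) (adj := adj)
      omega
    have hsol : ∀ u < L, ∀ v < L, Keep adj u → Keep adj v →
        ((solX (.add (.read 16 (.var 20)) (.const 1)) (.add (.read 16 (.var 21)) (.const 1))).holds L
          ((t.setVar 20 u).setVar 21 v) ↔ ms (rk adj u + 1) (rk adj v + 1)) := by
      intro u hu v hv h1 h2
      have e1 : (XE.add (.read 16 (.var 20)) (.const 1)).eval L ((t.setVar 20 u).setVar 21 v) =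
          rk adj u + 1 := by
        simp [XE.eval, h16 u hu]
      have e2 : (XE.add (.read 16 (.var 21)) (.const 1)).eval L ((t.setVar 20 u).setVar 21 v) =
          rk adj v + 1 := by
        simp [XE.eval, h16 v hv]
      rw [holds_solX hS ht (by omega) (by rw [arr_setVar, arr_setVar]) (by rw [e1]; exact hsz h1)
        (by rw [e2]; exact hsz h2), e1, e2]
    simp only [targetExpr, XE.holds_and, XE.holds_not, XE.holds_eq, XE.holds_ex,
      holds_bdry hS ht (by omega), arr_setVar, XE.eval, setVar_var, hti, Nat.reduceEqDiff, if_true,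
      if_false]
    constructor
    · rintro ⟨u, hu, v, hv, h1, h2, h3, h4⟩
      exact ⟨u, v, h1, h2, h3, (hsol u hu v hv h2.1 h3.1).1 h4⟩
    · rintro ⟨u, v, h1, h2, h3, h4⟩
      have hu := (h2.1.1.lt hG).trans hb1
      have hv := (h3.1.1.lt hG).trans hb1
      exact ⟨u, hu, v, hv, h1, h2, h3, (hsol u hu v hv h2.1 h3.1).2 h4⟩
  · rw [hf]
    refine ⟨fun h => h.2, fun h => ⟨?_, h⟩⟩
    obtain ⟨w, w', _, h, _⟩ := h
    exact (h.supp.lt hG).trans hb1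

theorem ready_avail (hS : Setup L n adj X) (hs : Ready L n adj ms X 22 s) :
    Ready L n adj ms X 23 ((FP.table 10 22 availExpr).run L s) := by
  have hG := hS.graph
  obtain ⟨hb1, hb2, -, -⟩ := hS.bounds
  refine hs.table (by omega) (Avail n adj ms) (fun i hi t ht hti => ?_) fun f hf v => ?_
  · have key : i < n * n → ((availExpr.holds L t) ↔ Avail n adj ms i) := by
      intro he
      have h13 : ∀ v, t.arr 13 v ≠ 0 ↔ Keep adj v := ht 13 (by omega)
      have h20 : ∀ v, t.arr 20 v ≠ 0 ↔ Touched adj ms v := ht 20 (by omega)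
      have hv : (XE.var 10).eval L t = i := hti
      have hf : (XE.fstX (.var 10)).eval L t = i / n := by
        rw [eval_fstX ht (by omega) rfl (by rwa [hv]), hv]
      have hs : (XE.sndX (.var 10)).eval L t = i % n := by
        rw [eval_sndX ht (by omega) rfl (by rwa [hv]), hv]
      simp only [availExpr, XE.holds_and, XE.holds_not, XE.holds_lt, XE.holds_read,
        holds_adj hS ht (by omega) rfl, holds_isCode hS ht (by omega) rfl, hf, hs, h13, h20, hv, he,
        true_and]
      exact Iff.rfl
    constructor
    · intro h
      refine (key ?_).1 h
      rw [availExpr, XE.holds_and, holds_isCode hS ht (by omega) rfl] at h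
      have h1 := h.1
      rwa [XE.eval, hti] at h1
    · exact fun h => (key (h.lt hG)).2 h
  · rw [hf]
    exact ⟨fun h => h.2, fun h => ⟨(h.lt hG).trans hb2, h⟩⟩

theorem holds_clsX (hS : Setup L n adj X) (hA : Facts L n adj ms X k A) (hk : 15 ≤ k)
    (hs : s.arr = A) {q e : XE} (he : e.eval L s < n * n) :
    (clsX q e).holds L s ↔ Cls adj (q.eval L s) (e.eval L s / n) (e.eval L s % n) := by
  subst hs
  have h9 : ∀ v, s.arr 9 v ≠ 0 ↔ Core adj v := hA 9 (by omega)
  rw [clsX, XE.holds_and, XE.holds_and, XE.holds_and, XE.holds_or, XE.holds_read, XE.holds_read,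
    holds_adj hS hA (by omega) rfl, holds_link hS hA (by omega) rfl,
    holds_link hS hA (by omega) rfl, eval_fstX hA (by omega) rfl he, eval_sndX hA (by omega) rfl he,
    h9, h9]
  exact Iff.rfl

theorem holds_meetX (hA : Facts L n adj ms X k A) (hk : 7 ≤ k)
    (hs : s.arr = A) {e f : XE} (he : e.eval L s < n * n) (hf : f.eval L s < n * n) :
    (meetX e f).holds L s ↔ Meet n (e.eval L s) (f.eval L s) := by
  rw [meetX, XE.holds_or, XE.holds_or, XE.holds_or, XE.holds_eq, XE.holds_eq, XE.holds_eq,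
    XE.holds_eq, eval_fstX hA (by omega) hs he, eval_sndX hA (by omega) hs he,
    eval_fstX hA (by omega) hs hf, eval_sndX hA (by omega) hs hf]
  exact Iff.rfl

/-- The set and the threshold are parameters because the criterion is used for the current set and
for the hypothetical prefix of a branching. Their expressions may refer only to the arrays and the
variable `10`, besides the argument of `bit`, as the variables `20` to `23` are bound here. -/
theorem holds_extendsX (hS : Setup L n adj X) (hA : Facts L n adj ms X k A) (hk : 23 ≤ k)
    {bit : XE → XE} {t : XE} {S : Set ℕ} {i τ : ℕ} (hSL : ∀ e ∈ S, e < L)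
    (hbit : ∀ ⦃u : State⦄, u.arr = A → u.var 10 = i →
      ∀ v, (bit (.var v)).holds L u ↔ u.var v ∈ S)
    (ht : ∀ ⦃u : State⦄, u.arr = A → u.var 10 = i → t.eval L u = τ)
    (hs : s.arr = A) (hi : s.var 10 = i) :
    (extendsX bit t).holds L s ↔ Extends n adj ms S τ := by
  classical
  have hG := hS.graph
  obtain ⟨hb1, hb2, -, -⟩ := hS.bounds
  have h12 : ∀ v, A 12 v ≠ 0 ↔ Supp adj v := hA 12 (by omega)
  have h21 : ∀ v, A 21 v ≠ 0 ↔ Target adj ms v := hA 21 (by omega)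
  have h22 : ∀ v, A 22 v ≠ 0 ↔ Avail n adj ms v := hA 22 (by omega)
  rw [extendsX, XE.holds_and, XE.holds_and, Extends]
  have hone : (XE.all 20 ((bit (.var 20)).imp (.read 22 (.var 20)))).holds L s ↔
      ∀ e ∈ S, Avail n adj ms e := by
    simp only [XE.holds_all, XE.holds_imp, hbit, XE.holds_read, arr_setVar, XE.eval, setVar_var, hs,
      hi, h22, Nat.reduceEqDiff, if_true, if_false]
    exact ⟨fun h e he => h e (hSL e he) he, fun h e _ => h e⟩
  rw [hone]
  -- The first conjunct ensures that all elements are codes below `n * n`, so that they are decoded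
  -- correctly in the other two.
  refine and_congr_right fun hav => ?_
  have hlt : ∀ e ∈ S, e < n * n := fun e he => (hav e he).lt hG
  refine and_congr ?_ ?_
  · simp only [XE.holds_all, XE.holds_imp, XE.holds_and, XE.holds_eq, hbit, arr_setVar, XE.eval,
      setVar_var, hs, hi, Nat.reduceEqDiff, if_true, if_false]
    have hm : ∀ e ∈ S, ∀ f ∈ S, ((meetX (.var 20) (.var 21)).holds L
        ((s.setVar 20 e).setVar 21 f) ↔ Meet n e f) := by
      intro e he f hf
      have e1 : (XE.var 20).eval L ((s.setVar 20 e).setVar 21 f) = e := by simp [XE.eval]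
      have e2 : (XE.var 21).eval L ((s.setVar 20 e).setVar 21 f) = f := by simp [XE.eval]
      rw [holds_meetX hA (by omega) (by rw [arr_setVar, arr_setVar, hs]) (by rw [e1]; exact hlt e he)
        (by rw [e2]; exact hlt f hf), e1, e2]
    constructor
    · exact fun h e he f hf h' => h e (hSL e he) f (hSL f hf) ⟨he, hf, (hm e he f hf).2 h'⟩
    · exact fun h e _ f _ h' => h e h'.1 f h'.2.1 ((hm e h'.1 f h'.2.1).1 h'.2.2)
  · rw [XE.holds_all]
    have key : ∀ q, ((XE.read 12 (.var 22)).imp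
        (((XE.ex 23 (.eq (.count 20 ((bit (.var 20)).and (clsX (.var 22) (.var 20))))
          (.add (.add (.var 23) (.var 23)) (.const 1)))).iff (.read 21 (.var 22))).or
        (.ex 21 ((XE.not (.lt (.var 21) t)).and ((XE.read 22 (.var 21)).and
          ((clsX (.var 22) (.var 21)).and
            (.all 20 ((bit (.var 20)).imp (XE.not (meetX (.var 20) (.var 21))))))))))).holds L
          (s.setVar 22 q) ↔ (Supp adj q → (Odd (clsCount n adj S q) ↔ Target adj ms q) ∨
            ∃ f, τ ≤ f ∧ Avail n adj ms f ∧ Cls adj q (f / n) (f % n) ∧ ∀ e ∈ S, ¬ Meet n e f) := by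
      intro q
      rw [XE.holds_imp, XE.holds_or, XE.holds_iff]
      have e1 : (XE.read 12 (.var 22)).holds L (s.setVar 22 q) ↔ Supp adj q := by
        simp only [XE.holds_read, arr_setVar, XE.eval, setVar_var, if_true, hs, h12]
      have e2 : (XE.read 21 (.var 22)).holds L (s.setVar 22 q) ↔ Target adj ms q := by
        simp only [XE.holds_read, arr_setVar, XE.eval, setVar_var, if_true, hs, h21]
      -- Oddness is expressed by some `k < L` with count `2 k + 1`; the restriction is harmless
      -- because the count is at most `L`.
      have e3 : (XE.ex 23 (.eq (.count 20 ((bit (.var 20)).and (clsX (.var 22) (.var 20))))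
          (.add (.add (.var 23) (.var 23)) (.const 1)))).holds L (s.setVar 22 q) ↔
          Odd (clsCount n adj S q) := by
        have hcount : ∀ k, (XE.count 20 ((bit (.var 20)).and (clsX (.var 22) (.var 20)))).eval L
            ((s.setVar 22 q).setVar 23 k) = clsCount n adj S q := by
          intro k
          rw [XE.eval_count, clsCount, ← Set.ncard_coe_finset]
          congr 1
          ext e
          simp only [Finset.coe_filter, Finset.mem_range, Set.mem_ofPred_eq, XE.holds_and, hbit,
            arr_setVar, setVar_var, hs, hi, Nat.reduceEqDiff, if_true, if_false]
          have hc : e ∈ S → ((clsX (.var 22) (.var 20)).holds L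
              (((s.setVar 22 q).setVar 23 k).setVar 20 e) ↔ Cls adj q (e / n) (e % n)) := by
            intro he
            have e1 : (XE.var 20).eval L (((s.setVar 22 q).setVar 23 k).setVar 20 e) = e := by
              simp [XE.eval]
            have e2 : (XE.var 22).eval L (((s.setVar 22 q).setVar 23 k).setVar 20 e) = q := by
              simp [XE.eval]
            rw [holds_clsX hS hA (by omega) (by rw [arr_setVar, arr_setVar, arr_setVar, hs])
              (by rw [e1]; exact hlt e he), e1, e2]
          constructor
          · exact fun h => ⟨h.2.1, (hc h.2.1).1 h.2.2⟩
          · exact fun h => ⟨hSL e h.1, h.1, (hc h.1).2 h.2⟩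
        have hle : clsCount n adj S q ≤ L := by
          rw [← hcount 0, XE.eval_count]
          exact (Finset.card_filter_le _ _).trans (Finset.card_range L).le
        simp only [XE.holds_ex, XE.holds_eq, hcount, XE.eval, setVar_var, if_true]
        constructor
        · rintro ⟨k, _, h⟩
          exact ⟨k, by omega⟩
        · rintro ⟨k, h⟩
          exact ⟨k, by omega, by omega⟩
      rw [e1, e2, e3, XE.holds_ex]
      refine imp_congr_right fun _ => or_congr Iff.rfl ?_
      have hc : ∀ f < n * n, ((clsX (.var 22) (.var 21)).holds L ((s.setVar 22 q).setVar 21 f) ↔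
          Cls adj q (f / n) (f % n)) := by
        intro f hf
        have e1 : (XE.var 21).eval L ((s.setVar 22 q).setVar 21 f) = f := by simp [XE.eval]
        have e2 : (XE.var 22).eval L ((s.setVar 22 q).setVar 21 f) = q := by simp [XE.eval]
        rw [holds_clsX hS hA (by omega) (by rw [arr_setVar, arr_setVar, hs])
          (by rw [e1]; exact hf), e1, e2]
      have hm : ∀ f < n * n, ∀ e ∈ S, ((meetX (.var 20) (.var 21)).holds L
          (((s.setVar 22 q).setVar 21 f).setVar 20 e) ↔ Meet n e f) := by
        intro f hf e he
        have e1 : (XE.var 20).eval L (((s.setVar 22 q).setVar 21 f).setVar 20 e) = e := by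
          simp [XE.eval]
        have e2 : (XE.var 21).eval L (((s.setVar 22 q).setVar 21 f).setVar 20 e) = f := by
          simp [XE.eval]
        rw [holds_meetX hA (by omega) (by rw [arr_setVar, arr_setVar, arr_setVar, hs])
          (by rw [e1]; exact hlt e he) (by rw [e2]; exact hf), e1, e2]
      simp only [XE.holds_and, XE.holds_not, XE.holds_lt, XE.holds_read, XE.holds_all, XE.holds_imp,
        hbit, ht, arr_setVar, XE.eval, setVar_var, hs, hi, h22, Nat.reduceEqDiff, if_true, if_false,
        not_lt]
      constructor
      · rintro ⟨f, _, h1, h2, h3, h4⟩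
        have hf := h2.lt hG
        exact ⟨f, h1, h2, (hc f hf).1 h3, fun e he => mt (hm f hf e he).2 (h4 e (hSL e he) he)⟩
      · rintro ⟨f, h1, h2, h3, h4⟩
        have hf := h2.lt hG
        exact ⟨f, by omega, h1, h2, (hc f hf).2 h3, fun e _ he => mt (hm f hf e he).1 (h4 e he)⟩
    simp only [key]
    exact ⟨fun h q hq => h q ((hq.lt hG).trans hb1) hq, fun h q _ => h q⟩

end

end EnumKernel

namespace EnumKernel

open Relation

/-! ## One round of the enumeration -/

/-- The array `23` holds the current set. -/
structure At (L n : ℕ) (adj ms : ℕ → ℕ → Prop) (X : ℕ → Prop) (S : Set ℕ) (s : State) : Prop where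
  facts : Facts L n adj ms X 23 s.arr
  var : s.var 0 = L
  supp : s.supp 23 = S

/-- The current set is not a prefix of a good set that omits `var 10`. -/
def forcedExpr : XE := XE.not (extendsX (.read 23) (.add (.var 10) (.const 1)))
/-- Expression for: `Branching`. -/
def branchingExpr : XE := (XE.not (.read 23 (.var 10))).and
  (extendsX (fun v => (XE.eq v (.var 10)).or ((XE.lt v (.var 10)).and (.read 23 v)))
    (.add (.var 10) (.const 1)))
/-- Expression for: `var 10` is the last branching. -/
def lastExpr : XE := (XE.read 27 (.var 10)).and
  (.all 20 ((XE.lt (.var 10) (.var 20)).imp (XE.not (.read 27 (.var 20)))))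
/-- Expression for: there is a branching. -/
def moreExpr : XE := .ex 20 (.read 28 (.var 20))
/-- Expression for: the prefix of the next set. -/
def prefixExpr : XE := .ex 20 ((XE.read 28 (.var 20)).and ((XE.eq (.var 10) (.var 20)).or
  ((XE.lt (.var 10) (.var 20)).and (.read 23 (.var 10)))))
/-- Expression for: rule of the greedy algorithm. -/
def greedyExpr : XE := (XE.ex 20 ((XE.read 28 (.var 20)).and (.lt (.var 20) (.var 10)))).and forcedExpr
/-- Expression for: `cutOf`. -/
def outExpr : XE :=
  let a := XE.fstX (.var 10)
  let b := XE.sndX (.var 10)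
  (XE.var 10).isCode.and (((XE.read 13 a).and ((XE.read 13 b).and ((XE.relX 7 a b).and
    (solX (.read 16 a) (.read 16 b))))).or ((XE.read 23 (.var 10)).or (.read 23 (.codeX b a))))
/-- Expression for: `Lists`. -/
def flagExpr : XE := (XE.ex 20 ((XE.var 20).isCode.and (.read 25 (.var 20)))).or
  (.ex 20 ((XE.lt (.var 20) .nX).and (XE.not (.read 17 (.var 20)))))

/-- The first set. -/
def startFP : FP :=
  .seq (.table 10 20 touchedExpr) <| .seq (.table 10 21 targetExpr) <|
  .seq (.table 10 22 availExpr) <| .seq (.pass 10 23 forcedExpr) (.table 10 24 (.const 1))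

/-- The string for the current set, and whether it is a solution. -/
def outFP : FP := .seq (.table 10 25 outExpr) (.table 10 26 flagExpr)

/-- The next set. -/
def nextFP : FP :=
  .seq (.table 10 27 branchingExpr) <| .seq (.table 10 28 lastExpr) <|
  .seq (.table 10 24 moreExpr) <| .seq (.table 10 29 prefixExpr) <|
  .seq (.table 10 23 (.read 29 (.var 10))) (.pass 10 23 greedyExpr)

theorem startFP_wf : startFP.wf = true := by decide
theorem outFP_wf : outFP.wf = true := by decide
theorem nextFP_wf : nextFP.wf = true := by decide

/-- A good set gives a solution unless it gives the empty set and the graph is connected. -/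
def Lists (n : ℕ) (adj ms : ℕ → ℕ → Prop) (S : Set ℕ) : Prop :=
  (∃ i j, cutOf n adj ms S i j) ∨ Disc n adj

section

variable {L n : ℕ} {adj ms : ℕ → ℕ → Prop} {X : ℕ → Prop} {k j : ℕ} {s : State} {S : Set ℕ}

theorem At.same {a : ℕ} {t : State} (h : At L n adj ms X S s) (ha : 23 < a) (h' : Same a s t) :
    At L n adj ms X S t where
  facts := h.facts.same h' (by omega)
  var := h'.1.trans h.var
  supp := by rw [← h.supp, State.supp, State.supp, h'.2 23 (by omega)]

theorem decides_extends (hG : IsGraph n adj) :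
    Decides (Extends n adj ms) {S | Good n adj ms S} := fun _ _ h => extends_iff hG h

theorem Good.lt_of_mem (hG : IsGraph n adj) (hS : Good n adj ms S) : ∀ e ∈ S, e < n * n :=
  fun e he => (hS.avail e he).lt hG

theorem holds_forcedExpr (hS : Setup L n adj X) (hA : Facts L n adj ms X 23 s.arr)
    (hz : ∀ k ≥ L, s.arr 23 k = 0) :
    forcedExpr.holds L s ↔ ¬ Extends n adj ms (s.supp 23) (s.var 10 + 1) := by
  rw [forcedExpr, XE.holds_not, holds_extendsX (S := s.supp 23) (τ := s.var 10 + 1) hS hA le_rfl ?_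
    ?_ ?_ rfl rfl]
  · intro e he
    by_contra hn
    exact he (hz e (by omega))
  · intro u hu _ v
    rw [XE.holds_read, hu]
    exact Iff.rfl
  · intro u _ hi
    simp only [XE.eval, hi]

theorem run_startFP (hS : Setup L n adj X) (hs : Ready L n adj ms X 20 s)
    (hne : ∃ S, Good n adj ms S) :
    ∃ R, At L n adj ms X R (startFP.run L s) ∧ (startFP.run L s).arr 24 0 ≠ 0 ∧ Good n adj ms R ∧
      {S | Good n adj ms S} = insert R {S ∈ {S | Good n adj ms S} | LexLT R S} := by
  have hG := hS.graph
  obtain ⟨hb1, hb2, -, -⟩ := hS.bounds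
  have h1 := ready_avail hS (ready_target hS (ready_touched hS hs))
  rw [startFP, FP.run, FP.run, FP.run, FP.run]
  set s₁ := (FP.table 10 22 availExpr).run L ((FP.table 10 21 targetExpr).run L
    ((FP.table 10 20 touchedExpr).run L s)) with hs₁
  have key : ∀ i < L, ∀ t, Same 23 s₁ t → (∀ k ≥ L, t.arr 23 k = s₁.arr 23 k) → t.var 10 = i →
      (forcedExpr.holds L t ↔ ¬ Extends n adj ms (t.supp 23) (i + 1)) := by
    intro i _ t ht hz hi
    rw [holds_forcedExpr hS (h1.facts.same ht le_rfl) fun k hk => by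
      rw [hz k hk, h1.zero 23 le_rfl], hi]
  obtain ⟨h2, -, h3⟩ := FP.run_pass (F := fun U i => ¬ Extends n adj ms U (i + 1)) (by omega) key
  have h0 : s₁.supp 23 = ∅ := by
    ext e
    simp [mem_supp, h1.zero 23 le_rfl]
  rw [h0] at h3
  obtain ⟨h4, h5⟩ := (decides_extends hG).first (fun S hS e he => (hS.lt_of_mem hG e he).trans hb2)
    hne h3
  obtain ⟨h6, h7⟩ := FP.run_table (L := L) (j := 10) (a := 24) (e := .const 1)
    (s := (FP.pass 10 23 forcedExpr).run L s₁) (f := fun _ => 1) (by omega)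
    (fun _ _ _ _ _ => rfl)
  have hAt : At L n adj ms X (((FP.pass 10 23 forcedExpr).run L s₁).supp 23)
      ((FP.pass 10 23 forcedExpr).run L s₁) := ⟨h1.facts.same h2 le_rfl, h2.1.trans h1.var, rfl⟩
  refine ⟨_, hAt.same (by omega) h6, ?_, h4, h5⟩
  rw [h7, if_pos (by omega)]
  exact one_ne_zero

theorem run_outFP (hS : Setup L n adj X) (hs : At L n adj ms X S s) (hgood : Good n adj ms S) :
    At L n adj ms X S (outFP.run L s) ∧ (outFP.run L s).arr 24 = s.arr 24 ∧
      (∀ e < n * n, (outFP.run L s).arr 25 e ≠ 0 ↔ cutOf n adj ms S (e / n) (e % n)) ∧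
      ((outFP.run L s).arr 26 0 ≠ 0 ↔ Lists n adj ms S) := by
  have hG := hS.graph
  obtain ⟨hb1, hb2, -, -⟩ := hS.bounds
  have hmem : ∀ e, s.arr 23 e ≠ 0 ↔ e ∈ S := fun e => by rw [← hs.supp]; exact Iff.rfl
  have key : ∀ i < L, ∀ t, Same 25 s t → t.var 10 = i → (outExpr.holds L t ↔
      i < n * n ∧ cutOf n adj ms S (i / n) (i % n)) := by
    intro i hi t hst hti
    have ht := hs.facts.same hst (by omega)
    have h23 : ∀ e, t.arr 23 e ≠ 0 ↔ e ∈ S := by rw [hst.2 23 (by omega)]; exact hmem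
    have hv : (XE.var 10).eval L t = i := hti
    rw [outExpr, XE.holds_and, holds_isCode hS ht (by omega) rfl, hv]
    refine and_congr_right fun he => ?_
    have hl := code_lt he
    have h13 : ∀ v, t.arr 13 v ≠ 0 ↔ Keep adj v := ht 13 (by omega)
    have h16 : ∀ w < L, t.arr 16 w = rk adj w := ht 16 (by omega)
    have hf : (XE.fstX (.var 10)).eval L t = i / n := by
      rw [eval_fstX ht (by omega) rfl (by rwa [hv]), hv]
    have hsn : (XE.sndX (.var 10)).eval L t = i % n := by
      rw [eval_sndX ht (by omega) rfl (by rwa [hv]), hv]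
    have hc : (XE.codeX (XE.sndX (.var 10)) (XE.fstX (.var 10))).eval L t = i % n * n + i / n := by
      rw [eval_codeX hS ht (by omega) rfl (by rw [hsn]; exact hl.2), hf, hsn]
    have hsz : ∀ {w}, Keep adj w → rk adj w < kerSize n adj := fun hw => by
      have := rk_add_le_size hG hw
      have := rk_le_kerSize (n := n) (adj := adj)
      omega
    have e1 : (XE.read 16 (XE.fstX (.var 10))).eval L t = rk adj (i / n) := by
      rw [XE.eval, hf, h16 _ (hl.1.trans hb1)]
    have e2 : (XE.read 16 (XE.sndX (.var 10))).eval L t = rk adj (i % n) := by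
      rw [XE.eval, hsn, h16 _ (hl.2.trans hb1)]
    have hsol : Keep adj (i / n) → Keep adj (i % n) →
        ((solX (.read 16 (XE.fstX (.var 10))) (.read 16 (XE.sndX (.var 10)))).holds L t ↔
          ms (rk adj (i / n)) (rk adj (i % n))) := by
      intro h1 h2
      rw [holds_solX hS ht (by omega) rfl (by rw [e1]; exact hsz h1) (by rw [e2]; exact hsz h2),
        e1, e2]
    simp only [XE.holds_or, XE.holds_and, XE.holds_read, holds_adj hS ht (by omega) rfl, hf, hsn, hv,
      hc, h13, h23]
    refine or_congr ?_ ?_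
    · exact and_congr_right fun h1 => and_congr_right fun h2 => and_congr_right fun _ => hsol h1 h2
    · constructor
      · rintro (h | h)
        · exact ⟨i, h, Or.inl ⟨rfl, rfl⟩⟩
        · exact ⟨_, h, Or.inr ⟨code_div hl.1, code_mod hl.1⟩⟩
      · rintro ⟨e, h, ⟨h1, h2⟩ | ⟨h1, h2⟩⟩
        · rw [code_ext h1 h2] at h
          exact Or.inl h
        · refine Or.inr ?_
          rwa [← h1, ← h2, Nat.div_add_mod']
  obtain ⟨h1, h2⟩ := FP.run_table_holds (by omega) key
  have h3 := hs.same (by omega) h1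
  have h25 : ∀ e < L, ((FP.table 10 25 outExpr).run L s).arr 25 e ≠ 0 ↔
      e < n * n ∧ cutOf n adj ms S (e / n) (e % n) := fun e he =>
    (h2 e).trans (by rw [if_pos he])
  have key' : ∀ i < L, ∀ t, Same 26 ((FP.table 10 25 outExpr).run L s) t → t.var 10 = i →
      (flagExpr.holds L t ↔ Lists n adj ms S) := by
    intro i _ t hst _
    have ht := h3.facts.same hst (by omega)
    have h25' : ∀ e < L, t.arr 25 e ≠ 0 ↔ e < n * n ∧ cutOf n adj ms S (e / n) (e % n) := by
      rw [hst.2 25 (by omega)]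
      exact h25
    have h17 : ∀ v, t.arr 17 v ≠ 0 ↔ ReflTransGen adj 0 v := ht 17 (by omega)
    have hn : ∀ v, XE.nX.eval L (t.setVar 20 v) = n := fun v => eval_nX (s := t.setVar 20 v) ht
      (by omega)
    simp only [flagExpr, XE.holds_or, XE.holds_and, XE.holds_not, XE.holds_ex, XE.holds_lt,
      XE.holds_read, holds_isCode hS ht (by omega) (arr_setVar _ _ _), hn, arr_setVar, XE.eval,
      setVar_var, if_true, h17]
    refine or_congr ⟨?_, ?_⟩ ⟨?_, ?_⟩
    · rintro ⟨e, he, _, h⟩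
      exact ⟨_, _, ((h25' e he).1 h).2⟩
    · rintro ⟨a, b, h⟩
      have hab : a < n ∧ b < n := by
        rcases h with ⟨_, _, h, _⟩ | ⟨e, he, ⟨rfl, rfl⟩ | ⟨rfl, rfl⟩⟩
        · exact ⟨hG.lt h, hG.lt' h⟩
        · exact code_lt (hgood.lt_of_mem hG e he)
        · exact (code_lt (hgood.lt_of_mem hG e he)).symm
      have hlt := pair_lt hab.1 hab.2
      refine ⟨a * n + b, by omega, hlt, (h25' _ (by omega)).2 ⟨hlt, ?_⟩⟩
      rwa [code_div hab.2, code_mod hab.2]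
    · rintro ⟨v, _, h⟩
      exact ⟨v, h⟩
    · rintro ⟨v, h⟩
      exact ⟨v, by omega, h⟩
  obtain ⟨h4, h5⟩ := FP.run_table_holds (by omega) key'
  refine ⟨h3.same (by omega) h4, ?_, fun e he => ?_, ?_⟩
  · rw [outFP, FP.run, h4.2 24 (by omega), h1.2 24 (by omega)]
  · rw [outFP, FP.run, h4.2 25 (by omega), h25 e (by omega)]
    exact and_iff_right he
  · rw [outFP, FP.run, h5, if_pos (by omega)]

theorem run_nextFP (hS : Setup L n adj X) (hs : At L n adj ms X S s) (hgood : Good n adj ms S) :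
    (∃ R, At L n adj ms X R (nextFP.run L s) ∧ (nextFP.run L s).arr 24 0 ≠ 0 ∧ Good n adj ms R ∧
      {T ∈ {T | Good n adj ms T} | LexLT S T} =
        insert R {T ∈ {T | Good n adj ms T} | LexLT R T}) ∨
    (nextFP.run L s).arr 24 0 = 0 ∧ {T ∈ {T | Good n adj ms T} | LexLT S T} = ∅ := by
  have hG := hS.graph
  obtain ⟨hb1, hb2, -, -⟩ := hS.bounds
  have hSL : ∀ T, Good n adj ms T → ∀ e ∈ T, e < L := fun T hT e he =>
    (hT.lt_of_mem hG e he).trans hb2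
  have hdec := decides_extends (ms := ms) hG
  rw [nextFP, FP.run, FP.run, FP.run, FP.run, FP.run]
  -- the table of branchings
  have k27 : ∀ i < L, ∀ t, Same 27 s t → t.var 10 = i → (branchingExpr.holds L t ↔
      Branching (Extends n adj ms) S i) := by
    intro i hi t hst hti
    have ht := (hs.same (by omega) hst)
    have hmem : ∀ e, t.arr 23 e ≠ 0 ↔ e ∈ S := fun e => by rw [← ht.supp]; exact Iff.rfl
    rw [branchingExpr, XE.holds_and, XE.holds_not, XE.holds_read,
      holds_extendsX (S := {e | e = i ∨ e < i ∧ e ∈ S}) (τ := i + 1) (i := i) hS ht.facts le_rfl ?_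
      ?_ ?_ rfl hti, XE.eval, hti, hmem]
    · exact Iff.rfl
    · rintro e (rfl | ⟨_, he⟩)
      · exact hi
      · exact hSL S hgood e he
    · intro u hu hi v
      simp only [XE.holds_or, XE.holds_and, XE.holds_eq, XE.holds_lt, XE.holds_read, XE.eval, hi, hu,
        hmem]
      exact Iff.rfl
    · intro u _ hi
      simp only [XE.eval, hi]
  obtain ⟨g1, v1⟩ := FP.run_table_holds (by omega) k27
  generalize (FP.table 10 27 branchingExpr).run L s = s₁ at g1 v1 ⊢
  have a1 := hs.same (by omega) g1
  have v1 : ∀ i < L, (s₁.arr 27 i ≠ 0 ↔ Branching (Extends n adj ms) S i) := fun i hi =>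
    (v1 i).trans (by rw [if_pos hi])
  -- the last branching
  have k28 : ∀ i < L, ∀ t, Same 28 s₁ t → t.var 10 = i → (lastExpr.holds L t ↔
      Branching (Extends n adj ms) S i ∧ ∀ u, i < u → u < L → ¬ Branching (Extends n adj ms) S u) := by
    intro i hi t hst hti
    have h27 : t.arr 27 = s₁.arr 27 := hst.2 27 (by omega)
    simp only [lastExpr, XE.holds_and, XE.holds_all, XE.holds_imp, XE.holds_not, XE.holds_lt,
      XE.holds_read, arr_setVar, XE.eval, setVar_var, hti, h27, Nat.reduceEqDiff, if_true, if_false,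
      v1 i hi]
    refine and_congr_right fun _ => ⟨fun h u h1 h2 => ?_, fun h u h2 h1 => ?_⟩
    · rw [← v1 u h2]
      exact h u h2 h1
    · rw [v1 u h2]
      exact h u h1 h2
  obtain ⟨g2, v2⟩ := FP.run_table_holds (by omega) k28
  generalize (FP.table 10 28 lastExpr).run L s₁ = s₂ at g2 v2 ⊢
  have a2 := a1.same (by omega) g2
  have v2 : ∀ i < L, (s₂.arr 28 i ≠ 0 ↔ Branching (Extends n adj ms) S i ∧
      ∀ u, i < u → u < L → ¬ Branching (Extends n adj ms) S u) := fun i hi =>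
    (v2 i).trans (by rw [if_pos hi])
  -- is there one?
  have k24 : ∀ i < L, ∀ t, Same 24 s₂ t → t.var 10 = i → (moreExpr.holds L t ↔
      ∃ b < L, s₂.arr 28 b ≠ 0) := by
    intro i hi t hst hti
    simp only [moreExpr, XE.holds_ex, XE.holds_read, arr_setVar, XE.eval, setVar_var,
      hst.2 28 (by omega), if_true]
  obtain ⟨g3, v3⟩ := FP.run_table_holds (by omega) k24
  generalize (FP.table 10 24 moreExpr).run L s₂ = s₃ at g3 v3 ⊢
  have a3 := a2.same (by omega) g3
  have v3 : s₃.arr 24 0 ≠ 0 ↔ ∃ b < L, s₂.arr 28 b ≠ 0 := (v3 0).trans (by rw [if_pos (by omega)])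
  have h28 : s₃.arr 28 = s₂.arr 28 := g3.2 28 (by omega)
  -- the new prefix
  have k29 : ∀ i < L, ∀ t, Same 29 s₃ t → t.var 10 = i → (prefixExpr.holds L t ↔
      ∃ b < L, s₂.arr 28 b ≠ 0 ∧ (i = b ∨ i < b ∧ i ∈ S)) := by
    intro i hi t hst hti
    have ht := a3.same (by omega) hst
    have hmem : ∀ e, t.arr 23 e ≠ 0 ↔ e ∈ S := fun e => by rw [← ht.supp]; exact Iff.rfl
    simp only [prefixExpr, XE.holds_ex, XE.holds_and, XE.holds_or, XE.holds_eq, XE.holds_lt,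
      XE.holds_read, arr_setVar, XE.eval, setVar_var, hst.2 28 (by omega), h28, hti, hmem,
      Nat.reduceEqDiff, if_true, if_false]
  obtain ⟨g4, v4⟩ := FP.run_table_holds (by omega) k29
  generalize (FP.table 10 29 prefixExpr).run L s₃ = s₄ at g4 v4 ⊢
  have a4 := a3.same (by omega) g4
  have h28' : s₄.arr 28 = s₂.arr 28 := (g4.2 28 (by omega)).trans h28
  -- The prefix is prepared in the array `29` and then copied, since its expression reads the array
  -- `23` that it replaces.
  have k23 : ∀ i < L, ∀ t, Same 23 s₄ t → t.var 10 = i → ((XE.read 29 (.var 10)).holds L t ↔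
      ∃ b < L, s₂.arr 28 b ≠ 0 ∧ (i = b ∨ i < b ∧ i ∈ S)) := by
    intro i hi t hst hti
    rw [XE.holds_read, XE.eval, hti, hst.2 29 (by omega), v4, if_pos hi]
  obtain ⟨g5, v5⟩ := FP.run_table_holds (by omega) k23
  generalize (FP.table 10 23 (.read 29 (.var 10))).run L s₄ = s₅ at g5 v5 ⊢
  have f5 := a4.facts.same g5 le_rfl
  have h28'' : s₅.arr 28 = s₂.arr 28 := (g5.2 28 (by omega)).trans h28'
  have z5 : ∀ k ≥ L, s₅.arr 23 k = 0 := by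
    intro k hk
    by_contra hne
    have := (v5 k).1 hne
    rw [if_neg (by omega)] at this
    have hk' : k ∈ s₄.supp 23 := this
    rw [a4.supp] at hk'
    have := hSL S hgood k hk'
    omega
  -- the greedy pass
  have kp : ∀ i < L, ∀ t, Same 23 s₅ t → (∀ k ≥ L, t.arr 23 k = s₅.arr 23 k) → t.var 10 = i →
      (greedyExpr.holds L t ↔ (∃ b < L, s₂.arr 28 b ≠ 0 ∧ b < i) ∧
        ¬ Extends n adj ms (t.supp 23) (i + 1)) := by
    intro i _ t hst hz hti
    rw [greedyExpr, XE.holds_and, holds_forcedExpr hS (f5.same hst le_rfl) fun k hk => by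
      rw [hz k hk, z5 k hk], hti]
    simp only [XE.holds_ex, XE.holds_and, XE.holds_lt, XE.holds_read, arr_setVar, XE.eval,
      setVar_var, hst.2 28 (by omega), h28'', hti, Nat.reduceEqDiff, if_true, if_false]
  obtain ⟨g6, -, v6⟩ := FP.run_pass (F := fun U i => (∃ b < L, s₂.arr 28 b ≠ 0 ∧ b < i) ∧
    ¬ Extends n adj ms U (i + 1)) (by omega) kp
  have h24 : ((FP.pass 10 23 greedyExpr).run L s₅).arr 24 = s₃.arr 24 := by
    rw [g6.2 24 (by omega), g5.2 24 (by omega), g4.2 24 (by omega)]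
  by_cases hex : ∃ b < L, s₂.arr 28 b ≠ 0
  · left
    obtain ⟨b, hb, hb'⟩ := id hex
    obtain ⟨hB, hmax⟩ := (v2 b hb).1 hb'
    have huniq : ∀ c < L, s₂.arr 28 c ≠ 0 ↔ c = b := by
      intro c hc
      refine ⟨fun h => ?_, fun h => h ▸ hb'⟩
      obtain ⟨h1, h2⟩ := (v2 c hc).1 h
      rcases lt_trichotomy c b with h3 | h3 | h3
      · exact absurd hB (h2 b h3 hb)
      · exact h3
      · exact absurd h1 (hmax c h3 hc)
    have h1 : s₅.supp 23 = {e | e = b ∨ e < b ∧ e ∈ S} := by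
      ext e
      by_cases he : e < L
      · rw [mem_supp, v5, if_pos he]
        constructor
        · rintro ⟨c, hc, h, h'⟩
          rw [huniq c hc] at h
          subst h
          exact h'
        · exact fun h => ⟨b, hb, hb', h⟩
      · rw [mem_supp, z5 e (by omega)]
        simp only [ne_eq, not_true_eq_false, false_iff, Set.mem_ofPred_eq]
        omega
    have h2 : (fun U i => (∃ b < L, s₂.arr 28 b ≠ 0 ∧ b < i) ∧ ¬ Extends n adj ms U (i + 1)) =
        fun U i => b + 1 ≤ i ∧ ¬ Extends n adj ms U (i + 1) := by
      funext U i
      refine propext (and_congr_left fun _ => ⟨?_, fun h => ⟨b, hb, hb', h⟩⟩)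
      rintro ⟨c, hc, h, h'⟩
      rw [huniq c hc] at h
      omega
    rw [h1, h2] at v6
    obtain ⟨h3, h4⟩ := hdec.next hSL hb hB hmax v6
    refine ⟨_, ⟨f5.same g6 le_rfl, ?_, rfl⟩, ?_, h3, h4⟩
    · rw [g6.1, g5.1, a4.var]
    · rw [h24]
      exact v3.2 hex
  · right
    refine ⟨by rw [h24]; exact not_not.1 (mt v3.1 hex), hdec.last hSL fun t ht hB => hex ?_⟩
    classical
    have hfin : ((Finset.range L).filter (Branching (Extends n adj ms) S)).Nonempty :=
      ⟨t, by simpa using ⟨ht, hB⟩⟩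
    have hm := Finset.max'_mem _ hfin
    simp only [Finset.mem_filter, Finset.mem_range] at hm
    refine ⟨_, hm.1, (v2 _ hm.1).2 ⟨hm.2, fun u h1 h2 hu => ?_⟩⟩
    have := Finset.le_max' _ u (Finset.mem_filter.2 ⟨Finset.mem_range.2 h2, hu⟩)
    omega

end

end EnumKernel

namespace EnumKernel

open Polynomial

/-! ## Delays -/

/-- All delays of the run are at most `d` if `c` steps have been made since the last output. -/
def GapsLE (d : ℕ) : ℕ → List Event → Prop
  | c, [] => c ≤ d
  | c, .tick :: τ => GapsLE d (c + 1) τ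
  | c, .out _ :: τ => c ≤ d ∧ GapsLE d 0 τ

theorem GapsLE.mono {d c c' : ℕ} {τ : List Event} (h : GapsLE d c τ) (hc : c' ≤ c) :
    GapsLE d c' τ := by
  induction τ generalizing c c' with
  | nil => exact hc.trans h
  | cons e τ ih =>
    cases e with
    | tick => exact ih (c := c + 1) h (by omega)
    | out w => exact ⟨hc.trans h.1, h.2⟩

theorem GapsLE.append {d c T : ℕ} {σ τ : List Event} (hσ : Silent σ T) (h : GapsLE d (c + T) τ) :
    GapsLE d c (σ ++ τ) := by
  induction σ generalizing c T with
  | nil => exact h.mono (Nat.le_add_right _ _)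
  | cons e σ ih =>
    obtain ⟨h1, h2⟩ := hσ
    cases e with
    | tick =>
      simp only [runTime] at h2
      exact ih (c := c + 1) (T := T - 1) ⟨by simpa [outputs] using h1, by omega⟩
        (h.mono (by omega))
    | out w => simp [outputs] at h1

theorem GapsLE.out {d c : ℕ} {w : List Bool} {τ : List Event} (hc : c ≤ d) (h : GapsLE d 0 τ) :
    GapsLE d c ([.out w] ++ τ) := ⟨hc, h⟩

theorem GapsLE.le {d c : ℕ} {l τ : List Event} (h : GapsLE d c (l ++ τ)) (hl : outputs l = []) :
    c + runTime l ≤ d := by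
  induction l generalizing c with
  | nil =>
    cases τ with
    | nil => exact h
    | cons e τ =>
      cases e with
      | tick =>
        clear hl
        have : ∀ τ c, GapsLE d c τ → c ≤ d := by
          intro τ
          induction τ with
          | nil => exact fun c h => h
          | cons e τ ih =>
            intro c h
            cases e with
            | tick => have := ih _ h; omega
            | out w => exact h.1
        exact this _ _ h
      | out w => exact h.1
  | cons e l ih =>
    cases e with
    | tick =>
      have := ih (c := c + 1) h (by simpa [outputs] using hl)
      simp only [runTime]
      omega
    | out w => simp [outputs] at hl

/-- `GapsLE` carries the steps since the last output as a counter, which makes it easy to compose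
along a run; an infix without outputs is met with some value of the counter. -/
theorem GapsLE.delayLE {d : ℕ} {τ : List Event} (h : GapsLE d 0 τ) : DelayLE τ d := by
  rintro l ⟨a, b, rfl⟩ hl
  have key : ∀ a c, GapsLE d c (a ++ (l ++ b)) → runTime l ≤ d := by
    intro a
    induction a with
    | nil =>
      intro c h
      have := GapsLE.le (l := l) (τ := b) h hl
      omega
    | cons e a ih =>
      intro c h
      cases e with
      | tick => exact ih _ h
      | out w => exact ih _ h.2
  rw [List.append_assoc] at h
  exact key a 0 h

theorem silent_nil_outputs {σ τ : List Event} {T : ℕ} (h : Silent σ T) :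
    outputs (σ ++ τ) = outputs τ := by
  rw [outputs_append, h.1, List.nil_append]

/-! ## The solution-lifting algorithm -/

/-- The loop that lists the solutions. -/
def liftLoop : Program := .loop (.read 24 (.const 0)) (.seq outFP.code
  (.seq (.ite (.read 26 (.const 0)) (.emit 25 (.read 4 (.read 3 (.const 0)))) .skip) nextFP.code))

/-- The solution-lifting algorithm. -/
def liftProgram : Program := .seq prelude (.seq startFP.code liftLoop)

/-- A bound for the time of one round. -/
noncomputable def roundTime : ℕ[X] := outFP.time + nextFP.time + X + 20

section

variable {L n : ℕ} {adj ms : ℕ → ℕ → Prop} {X : ℕ → Prop} {s t : State} {S : Set ℕ}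

theorem Agree.at (h : Agree s t) (ht : At L n adj ms X S t) : At L n adj ms X S s where
  facts := by rw [h.1]; exact ht.facts
  var := (h.2 0 (by omega)).trans ht.var
  supp := by rw [← ht.supp, State.supp, State.supp, h.1]

theorem finite_good (hG : IsGraph n adj) : {S | Good n adj ms S}.Finite :=
  (Set.finite_Iio (n * n)).finite_subsets.subset fun _ hS => hS.lt_of_mem hG

theorem lists_of_nonempty (h : S.Nonempty) : Lists n adj ms S := by
  obtain ⟨e, he⟩ := h
  exact Or.inl ⟨e / n, e % n, Or.inr ⟨e, he, Or.inl ⟨rfl, rfl⟩⟩⟩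

/-- Induction on the number of good sets above `S`. A listed set is output within its own round. A
set that is not listed must be empty, and every later set is nonempty, so at most one round at the
start passes without output: hence the two alternatives for `c`. -/
theorem runs_liftLoop (hS : Setup L n adj X) (N : ℕ) :
    ∀ (S : Set ℕ) (s : State), {T ∈ {T | Good n adj ms T} | LexLT S T}.ncard = N →
      At L n adj ms X S s → Good n adj ms S → s.arr 24 0 ≠ 0 →
      ∃ τ s', Exec liftLoop s τ s' ∧ (outputs τ).Nodup ∧
        (∀ w, w ∈ outputs τ ↔ ∃ T ∈ insert S {T ∈ {T | Good n adj ms T} | LexLT S T},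
          Lists n adj ms T ∧ w = encRel n (cutOf n adj ms T)) ∧
        ∀ d c, 3 * roundTime.eval L ≤ d → (Lists n adj ms S ∧ c + roundTime.eval L ≤ d ∨
          c + 2 * roundTime.eval L ≤ d) → GapsLE d c τ := by
  have hG := hS.graph
  obtain ⟨hb1, hb2, -, -⟩ := hS.bounds
  have hK : roundTime.eval L = outFP.time.eval L + nextFP.time.eval L + L + 20 := by
    simp [roundTime]
  set K := roundTime.eval L
  induction N using Nat.strong_induction_on with
  | _ N ih =>
  intro S s hN hs hgood hrun
  obtain ⟨h1, h24, hout, hflag⟩ := run_outFP hS hs hgood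
  obtain ⟨τ₁, s₁, hx₁, hq₁, hag₁⟩ := FP.runs_code outFP outFP_wf (Agree.refl s) hs.var
  have hs₁ := hag₁.at h1
  rw [← hag₁.1] at hout hflag
  obtain ⟨τ₂, s₂, hx₂, hq₂, hag₂⟩ := FP.runs_code nextFP nextFP_wf (Agree.refl s₁) hs₁.var
  have hfin := finite_good (ms := ms) hG
  obtain ⟨τ₃, s₃, hx₃, hnd, hmem, hgap⟩ : ∃ τ₃ s₃, Exec liftLoop s₂ τ₃ s₃ ∧ (outputs τ₃).Nodup ∧
      (∀ w, w ∈ outputs τ₃ ↔ ∃ T ∈ {T ∈ {T | Good n adj ms T} | LexLT S T},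
        Lists n adj ms T ∧ w = encRel n (cutOf n adj ms T)) ∧
      ∀ d c, 3 * K ≤ d → c + K ≤ d → GapsLE d c τ₃ := by
    rcases run_nextFP hS hs₁ hgood with ⟨R, hR, hR24, hRgood, hAbove⟩ | ⟨hR24, hAbove⟩
    · have hRS : LexLT S R := by
        have : R ∈ insert R {T ∈ {T | Good n adj ms T} | LexLT R T} := Set.mem_insert _ _
        rw [← hAbove] at this
        exact this.2
      have hlt : {T ∈ {T | Good n adj ms T} | LexLT R T}.ncard < N := by
        rw [← hN, hAbove, Set.ncard_insert_of_notMem (fun h => LexLT.irrefl _ h.2)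
          (hfin.subset fun _ h => h.1)]
        exact Nat.lt_succ_self _
      obtain ⟨τ₃, s₃, hx₃, hnd, hmem, hgap⟩ := ih _ hlt R s₂ rfl (hag₂.at hR) hRgood
        (by rwa [hag₂.1])
      rw [← hAbove] at hmem
      -- The successor `R` is above `S`, hence nonempty and listed.
      exact ⟨τ₃, s₃, hx₃, hnd, hmem, fun d c hd hc =>
        hgap d c hd (Or.inl ⟨lists_of_nonempty hRS.nonempty, hc⟩)⟩
    · rw [hAbove]
      refine ⟨_, s₂, .loop_false (by rw [RExpr.eval, hag₂.1]; exact hR24), ?_, ?_, ?_⟩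
      · rw [outputs_ticks]
        exact List.nodup_nil
      · simp [outputs_ticks]
      · intro d c _ hc
        have := GapsLE.append (d := d) (c := c) (τ := []) (silent_ticks
          ((RExpr.read 24 (.const 0)).cost + 1)) (by simp only [GapsLE, RExpr.cost]; omega)
        rwa [List.append_nil] at this
  have hlen : (RExpr.read 4 (.read 3 (.const 0))).eval s₁ = n * n := by
    have h3 : s₁.arr 3 0 = n := hs₁.facts 3 (by omega)
    have h4 : s₁.arr 4 n = n * n := hs₁.facts 4 (by omega) n hb1
    simp only [RExpr.eval, h3, h4]
  have hword : s₁.word 25 (n * n) = encRel n (cutOf n adj ms S) := by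
    classical
    rw [State.word, encRel]
    refine List.map_congr_left fun e he => ?_
    rw [decide_eq_decide]
    exact hout e (List.mem_range.1 he)
  have hrun' : (RExpr.read 24 (.const 0)).eval s ≠ 0 := hrun
  by_cases hl : Lists n adj ms S
  · have hmid := Exec.ite_true (q := .skip) (e := .read 26 (.const 0)) (hflag.2 hl)
      (Exec.emit 25 (.read 4 (.read 3 (.const 0))) s₁)
    rw [hlen, hword] at hmid
    refine ⟨_, s₃, .loop_true hrun' (.seq hx₁ (.seq hmid hx₂)) hx₃, ?_, ?_, ?_⟩
    all_goals simp only [List.append_assoc]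
    · simp only [outputs_append, outputs_ticks, hq₁.1, hq₂.1, List.nil_append]
      simp only [outputs, List.filterMap_cons, List.filterMap_nil, List.singleton_append,
        List.nodup_cons]
      refine ⟨fun h => ?_, hnd⟩
      obtain ⟨T, hT, _, he⟩ := (hmem _).1 h
      have hsub : ∀ T, Good n adj ms T → ∀ i j, cutOf n adj ms T i j → adj i j := by
        rintro T hT i j (⟨_, _, h, _⟩ | ⟨e, he, ⟨rfl, rfl⟩ | ⟨rfl, rfl⟩⟩)
        · exact h
        · exact (hT.avail e he).2.1
        · exact hG.symm (hT.avail e he).2.1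
      have := hgood.cutOf_inj hT.1 (encRel_inj hG (hsub S hgood) (hsub T hT.1) he)
      exact LexLT.irrefl S (by rw [this]; exact this ▸ hT.2)
    · intro w
      simp only [outputs_append, outputs_ticks, hq₁.1, hq₂.1, List.nil_append, List.mem_append, hmem]
      simp only [outputs, List.filterMap_cons, List.filterMap_nil, List.mem_singleton]
      constructor
      · rintro (rfl | ⟨T, hT, h⟩)
        · exact ⟨S, Set.mem_insert _ _, hl, rfl⟩
        · exact ⟨T, Set.mem_insert_of_mem _ hT, h⟩
      · rintro ⟨T, rfl | hT, h⟩
        · exact Or.inl h.2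
        · exact Or.inr ⟨T, hT, h⟩
    · intro d c hd hc
      refine .append (silent_ticks _) (.append hq₁ (.append (silent_ticks _)
        (.append (silent_ticks _) (.out ?_ (.append hq₂ (hgap d _ hd ?_))))))
      · simp only [RExpr.cost]
        omega
      · omega
  · have hmid := Exec.ite_false (p := .emit 25 (.read 4 (.read 3 (.const 0))))
      (e := .read 26 (.const 0)) (not_not.1 (mt hflag.1 hl)) (Exec.skip s₁)
    refine ⟨_, s₃, .loop_true hrun' (.seq hx₁ (.seq hmid hx₂)) hx₃, ?_, ?_, ?_⟩
    all_goals simp only [List.append_assoc]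
    · simpa only [outputs_append, outputs_ticks, hq₁.1, hq₂.1, List.nil_append] using hnd
    · intro w
      simp only [outputs_append, outputs_ticks, hq₁.1, hq₂.1, List.nil_append, hmem]
      constructor
      · rintro ⟨T, hT, h⟩
        exact ⟨T, Set.mem_insert_of_mem _ hT, h⟩
      · rintro ⟨T, rfl | hT, h⟩
        · exact absurd h.1 hl
        · exact ⟨T, hT, h⟩
    · intro d c hd hc
      have hc := hc.resolve_left fun h => hl h.1
      refine .append (silent_ticks _) (.append hq₁ (.append (silent_ticks _)
        (.append (silent_ticks _) (.append hq₂ (hgap d _ hd ?_)))))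
      simp only [RExpr.cost]
      omega

end

/-- The solutions that are listed for the solution `s` to the kernel of `x`. -/
def liftOf (x s : List Bool) : Set (List Bool) :=
  {w | ∃ ms m, IsCut (kerSize (numVertices x) (natAdj (graphOf x))) (KerAdj (natAdj (graphOf x))) ms ∧
    s = encRel (kerSize (numVertices x) (natAdj (graphOf x))) ms ∧
    Fibre (numVertices x) (natAdj (graphOf x)) ms m ∧ w = encRel (numVertices x) m}

theorem mem_sol_kernelOf {x s : List Bool} : s ∈ enumMC.Sol (kernelOf x) ↔
    ∃ ms, IsCut (kerSize (numVertices x) (natAdj (graphOf x))) (KerAdj (natAdj (graphOf x))) ms ∧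
      s = encRel (kerSize (numVertices x) (natAdj (graphOf x))) ms := by
  refine (mem_sol_iff (graphOf (kernelOf x)) s).trans ?_
  rw [show natAdj (graphOf (kernelOf x)) = KerAdj (natAdj (graphOf x)) from
    natAdj_encGraph (isGraph_natAdj _).kerAdj, show numVertices (kernelOf x) =
      kerSize (numVertices x) (natAdj (graphOf x)) from numVertices_encGraph _ _]

/-- The string of a kernel solution determines `ms`, so the existential quantifier over `ms` in
`liftOf` is harmless. -/
theorem mem_liftOf {x : List Bool} {ms : ℕ → ℕ → Prop} (hms : IsCut (kerSize (numVertices x)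
    (natAdj (graphOf x))) (KerAdj (natAdj (graphOf x))) ms) {w : List Bool} :
    w ∈ liftOf x (encRel (kerSize (numVertices x) (natAdj (graphOf x))) ms) ↔
      ∃ m, Fibre (numVertices x) (natAdj (graphOf x)) ms m ∧ w = encRel (numVertices x) m := by
  constructor
  · rintro ⟨ms', m, hms', he, h⟩
    obtain ⟨_, c, _, hc⟩ := id hms
    obtain ⟨_, c', _, hc'⟩ := id hms'
    rw [encRel_inj (isGraph_natAdj _).kerAdj (fun i j h => ((hc i j).1 h).1)
      (fun i j h => ((hc' i j).1 h).1) he]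
    exact ⟨m, h⟩
  · rintro ⟨m, h⟩
    exact ⟨ms, m, hms, rfl, h⟩

/-- All kernel data are recomputed from `x`; besides `x` only the kernel solution, in the array `2`,
is read. The delay is therefore bounded by a polynomial in the length of `x` alone. -/
theorem runsTo_liftProgram : ∃ p : ℕ[X], ∀ x : List Bool, ∀ s ∈ enumMC.Sol (kernelOf x),
    ∃ τ, RunsTo liftProgram [x, kernelOf x, s] τ ∧ (outputs τ).Nodup ∧
      (∀ w, w ∈ outputs τ ↔ w ∈ liftOf x s) ∧ DelayLE τ (p.eval x.length) := by
  refine ⟨preludeTime + (startFP.time.comp boundPoly + 3 * roundTime.comp boundPoly),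
    fun x s hs => ?_⟩
  obtain ⟨ms, hms, rfl⟩ := mem_sol_kernelOf.1 hs
  have hS := setup_graphOf x
  have hG := hS.graph
  obtain ⟨τ₁, s₁, hx₁, hq₁, hR⟩ := runs_prelude x (ms := ms) 
    (ws := [kernelOf x, encRel (kerSize (numVertices x) (natAdj (graphOf x))) ms])
    le_rfl (fun i hi j hj => by
      have := encRel_getD (m := ms) hi hj
      simp only [initState, List.getD_cons_succ, List.getD_cons_zero]
      rw [← this]
      by_cases h : (encRel (kerSize (numVertices x) (natAdj (graphOf x))) ms).getD
        (i * kerSize (numVertices x) (natAdj (graphOf x)) + j) false = true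
      · simp only [h, if_true, ne_eq, one_ne_zero, not_false_eq_true]
      · simp only [h, if_false, ne_eq, not_true_eq_false, Bool.false_eq_true])
  obtain ⟨R, hAt, h24, hgood, hall⟩ := run_startFP hS hR (exists_good hG)
  obtain ⟨τ₂, s₂, hx₂, hq₂, hag₂⟩ := FP.runs_code startFP startFP_wf (Agree.refl s₁) hR.var
  obtain ⟨τ₃, s₃, hx₃, hnd, hmem, hgap⟩ := runs_liftLoop hS _ R s₂ rfl (hag₂.at hAt) hgood (by rwa [hag₂.1])
  rw [← hall] at hmem
  refine ⟨_, ⟨s₃, .seq hx₁ (.seq hx₂ hx₃)⟩, ?_, fun w => ?_, ?_⟩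
  · rwa [silent_nil_outputs hq₁, silent_nil_outputs hq₂]
  · rw [silent_nil_outputs hq₁, silent_nil_outputs hq₂, hmem, mem_liftOf hms]
    constructor
    · rintro ⟨T, hT, hl, h⟩
      exact ⟨_, Good.fibre hG hms hT hl, h⟩
    · rintro ⟨m, hm, h⟩
      obtain ⟨T, hT, rfl⟩ := hm.exists_good hG
      exact ⟨T, hT, hm.nontrivial, h⟩
  · refine GapsLE.delayLE (.append hq₁ (.append hq₂ (hgap _ _ ?_ (Or.inr ?_)))) <;>
    · simp only [eval_add, eval_mul, eval_comp, eval_ofNat]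
      omega

end EnumKernel

/-! ### Assembly of the enumeration kernel -/

namespace EnumKernel

open Polynomial

theorem eval_mono (p : ℕ[X]) {a b : ℕ} (h : a ≤ b) : p.eval a ≤ p.eval b := by
  simp only [eval_eq_sum_range]
  exact Finset.sum_le_sum fun i _ => Nat.mul_le_mul_left _ (Nat.pow_le_pow_left h i)

theorem numVertices_kernelOf_le (x : List Bool) :
    numVertices (kernelOf x) ≤ 60 * enumMC.κ x + 2 := by
  rw [kernelOf, numVertices_encGraph]
  exact kerSize_le (graphOf x)

/-- The enumeration kernel for Enum MC. -/
noncomputable def matchingCutKernel : PolyDelayEnumKernel enumMC where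
  kernelize := kernelProgram
  lifting := liftProgram
  ker := kernelOf
  lift := liftOf
  kernelize_spec := by
    obtain ⟨p, hp⟩ := runsTo_kernelProgram
    refine ⟨p, fun x => ?_⟩
    obtain ⟨τ, h1, h2, h3⟩ := hp x
    exact ⟨τ, h1, h2, h3.trans (eval_mono p (by omega))⟩
  size_le := by
    -- With `N = 60 k + 2` bounding the number of kernel vertices, `N + 1 + N²` bounds the length of
    -- the encoding and the second `N²` the feedback edge number of the kernel.
    refine ⟨fun k => (60 * k + 2) + 1 + (60 * k + 2) * (60 * k + 2) + (60 * k + 2) * (60 * k + 2),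
      ?_, fun x => ?_⟩
    · have h : Primrec fun k : ℕ => 60 * k + 2 :=
        Primrec.nat_add.comp (Primrec.nat_mul.comp (.const 60) .id) (.const 2)
      have h2 := Primrec.nat_mul.comp h h
      exact (Primrec.nat_add.comp (Primrec.nat_add.comp (Primrec.nat_add.comp h (.const 1)) h2)
        h2).to_comp
    · have h1 := numVertices_kernelOf_le x
      have h2 : enumMC.κ (kernelOf x) ≤ numVertices (kernelOf x) * numVertices (kernelOf x) :=
        feedbackEdgeNumber_le _
      have h3 : (kernelOf x).length = numVertices (kernelOf x) + 1 +
          numVertices (kernelOf x) * numVertices (kernelOf x) := by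
        rw [kernelOf, numVertices_encGraph, encGraph_length]
      have h4 := Nat.mul_le_mul h1 h1
      change _ ≤ _ + 2 + 1 + _ + _
      omega
  lifting_spec := by
    obtain ⟨p, hp⟩ := runsTo_liftProgram
    refine ⟨p, fun x s hs => ?_⟩
    obtain ⟨τ, h1, h2, h3, h4⟩ := hp x s hs
    exact ⟨τ, h1, h2, h3, fun l hl hl' => (h4 l hl hl').trans (eval_mono p (by omega))⟩
  lift_nonempty x s hs := by
    obtain ⟨ms, hms, rfl⟩ := mem_sol_kernelOf.1 hs
    obtain ⟨m, hm⟩ := hms.fibre_nonempty (isGraph_natAdj _)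
    exact ⟨_, (mem_liftOf hms).2 ⟨m, hm, rfl⟩⟩
  lift_disjoint x s hs s' hs' hne := by
    obtain ⟨ms, hms, rfl⟩ := mem_sol_kernelOf.1 hs
    obtain ⟨ms', hms', rfl⟩ := mem_sol_kernelOf.1 hs'
    refine Set.disjoint_left.2 fun w hw hw' => hne ?_
    obtain ⟨m, hm, rfl⟩ := (mem_liftOf hms).1 hw
    obtain ⟨m', hm', he⟩ := (mem_liftOf hms').1 hw'
    rw [← encRel_inj (isGraph_natAdj _) hm.sub hm'.sub he] at hm'
    rw [Fibre.unique (isGraph_natAdj _) hms hms' hm hm']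
  lift_cover x := by
    ext w
    simp only [Set.mem_iUnion, exists_prop]
    refine Iff.trans ?_ (mem_sol_iff (graphOf x) w).symm
    constructor
    · rintro ⟨s, hs, hw⟩
      obtain ⟨ms, hms, rfl⟩ := mem_sol_kernelOf.1 hs
      obtain ⟨m, hm, rfl⟩ := (mem_liftOf hms).1 hw
      exact ⟨m, hm.isCut (isGraph_natAdj _) hms, rfl⟩
    · rintro ⟨m, hm, rfl⟩
      obtain ⟨ms, hms, hf⟩ := hm.exists_fibre (isGraph_natAdj _)
      exact ⟨_, mem_sol_kernelOf.2 ⟨ms, hms, rfl⟩, (mem_liftOf hms).2 ⟨m, hf, rfl⟩⟩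

end EnumKernel

theorem theorem5p8 :
    ∃ (K : EnumKernel.PolyDelayEnumKernel EnumKernel.enumMC) (c : ℕ), ∀ x : List Bool,
      EnumKernel.numVertices (K.ker x) ≤ c * (EnumKernel.enumMC.κ x + 1) := by
  refine ⟨EnumKernel.matchingCutKernel, 60, fun x => ?_⟩
  have := EnumKernel.numVertices_kernelOf_le x
  change EnumKernel.numVertices (EnumKernel.kernelOf x) ≤ _
  omega
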